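/- Let $\ell>0$ (magnetic length), $\epsilon>0$ (magnetic energy), $j\in\mathbb{N}_0$ and $\xi\geqslant 0$. For $k\in\mathbb{R}^2$ put $$K_1(k)=-\mathrm{i}\ell\,\partial_1-\tfrac{x_2}{2\ell}+\ell k_1,\qquad K_2(k)=-\mathrm{i}\ell\,\partial_2+\tfrac{x_1}{2\ell}+\ell k_2,$$ $K_i=K_i(0)$, and $$G_1=-\mathrm{i}\ell\,\partial_2-\tfrac{x_1}{2\ell},\qquad G_2=-\mathrm{i}\ell\,\partial_1+\tfrac{x_2}{2\ell}.$$ On $L^2(\mathbb{R}^2)$ let $H_B=\frac{\epsilon}{2}(K_1^2+K_2^2)$ be the Landau Hamiltonian and $Q_B=\frac12(K_1^2+K_2^2+G_1^2+G_2^2)$ (the closures of these expressions on Schwartz functions), let $\Pi_j$ be the orthogonal projection on the eigenspace of $H_B$ for the Landau level $E_j=\epsilon(j+\frac12)$, and let $Q_{B,\xi}^{-1}=(Q_B+2\xi\mathbf 1)^{-1}$. The magnetic translations are $(T_mf)(x)=(-1)^{m_1m_2}\mathrm{e}^{-\mathrm{i}\sqrt{\pi/2}\,(m_1x_2-m_2x_1)/\ell}f(x-\sqrt{2\pi}\,\ell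 m)$, $m\in\mathbb{Z}^2$. Let $Y_B=[0,\sqrt{2\pi}\,\ell]^2$ be the magnetic unit cell and $\mathbb{B}=\mathbb{R}^2/(\frac{\sqrt{2\pi}}{\ell}\mathbb{Z})^2$ the Brillouin torus. For $k\in\mathbb{R}^2$ let $H_B(k)=\frac{\epsilon}{2}(K_1(k)^2+K_2(k)^2)$ on $L^2(Y_B)$, the closure of this expression on (the restrictions to $Y_B$ of) the smooth functions on $\mathbb{R}^2$ that are invariant under all $T_m$, and let $\Pi_j(k)=\frac{\mathrm{i}}{2\pi}\oint_{|z-E_j|=\epsilon/2}(H_B(k)-z)^{-1}\,\mathrm{d}z$ be its spectral projection for $E_j$. The $j$-th Landau bundle $\mathcal{E}_j\to\mathbb{B}$ has the fibre $\mathrm{Ran}\,\Pi_j(k)$ over $[k]$, where the fibres over two representatives $k$ and $k'$ of the same point are identified by multiplication by $\mathrm{e}^{-\mathrm{i}(k'-k)\cdot y}$. For a compact operator $T$ with singular values $\mu_0(T)\geqslant\mu_1(T)\geqslant\dots$ let $\gamma_N(T)=\frac{1}{\log N}\sum_{n<N}\mu_n(T)$. The operator $T$ is in the Dixmier ideal if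 $\sup_{N>1}\gamma_N(T)<\infty$, and it is then measurable if $\gamma_N(T)$ converges. With $\sigma_s(T)=\inf\{\|R\|_1+s\|S\|: R,S\text{ compact},\ R+S=T\}$ and $\tau_\lambda(T)=\frac{1}{\log\lambda}\int_{\lambda_0}^{\lambda}\frac{\sigma_s(T)}{\log s}\frac{\mathrm{d}s}{s}$ for $\lambda\geqslant\lambda_0>\mathrm{e}$, each state $\omega$ of $C_b([\lambda_0,\infty))/C_0([\lambda_0,\infty))$ defines a Dixmier trace $\mathrm{Tr}_{\mathrm{Dix},\omega}$ on the Dixmier ideal: the linear extension of $T\mapsto\omega([\lambda\mapsto\tau_\lambda(T)])$, $T\geqslant0$. One writes $\mathrm{Tr}_{\mathrm{Dix}}(T)$ when the value does not depend on $\lambda_0$ and $\omega$. Then $Q_B+2\xi\mathbf 1$ has a bounded inverse, $Q_{B,\xi}^{-1}\Pi_j$ is a measurable element of the Dixmier ideal, $\mathcal{E}_j$ is a (locally trivial) complex vector bundle over $\mathbb{B}$, and $$\mathrm{rk}(\mathcal{E}_j)\;=\;\mathrm{Tr}_{\mathrm{Dix}}\big(Q_{B,\xi}^{-1}\Pi_j\big)\;=\;1,$$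 where $\mathrm{Tr}_{\mathrm{Dix}}$ may be computed with any $\lambda_0>\mathrm{e}$ and any state $\omega$. -/

import Mathlib

open MeasureTheory Filter Topology Complex
open scoped ComplexOrder ENNReal BoundedContinuousFunction ComplexStarModule

noncomputable section

/-! ## Unbounded operators, resolvents and spectral projections -/

namespace Landau

/-- The closed operator on `L²(μ)` obtained from a differential expression `D` on a core `C` of
functions on the plane: the operator whose graph is the closure in `L²(μ) × L²(μ)` of the set of
pairs `(f, D f)` with `f ∈ C`. (Below `C` is always a vector space of smooth functions on which `D`
is linear, so that this set of pairs is already a subspace.) -/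
def closedRealization (μ : Measure (ℝ × ℝ)) (C : Set (ℝ × ℝ → ℂ))
    (D : (ℝ × ℝ → ℂ) → (ℝ × ℝ → ℂ)) : Lp ℂ 2 μ →ₗ.[ℂ] Lp ℂ 2 μ :=
  (Submodule.span ℂ {p : Lp ℂ 2 μ × Lp ℂ 2 μ |
    ∃ f ∈ C, (p.1 : ℝ × ℝ → ℂ) =ᵐ[μ] f ∧ (p.2 : ℝ × ℝ → ℂ) =ᵐ[μ] D f}
    ).topologicalClosure.toLinearPMap

section Operators

variable {H : Type*} [NormedAddCommGroup H] [InnerProductSpace ℂ H] [CompleteSpace H]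

/-- The bounded operator `R` is a two-sided inverse of `T - z`. -/
def IsResolvent (T : H →ₗ.[ℂ] H) (z : ℂ) (R : H →L[ℂ] H) : Prop :=
  (∀ y : H, ∃ h : R y ∈ T.domain, T ⟨R y, h⟩ - z • R y = y) ∧
    ∀ x : T.domain, R (T x - z • (x : H)) = x

open Classical in
/-- The resolvent `(T - z)⁻¹` (which is unique), and `0` if `T - z` has no bounded inverse. -/
def resolventOp (T : H →ₗ.[ℂ] H) (z : ℂ) : H →L[ℂ] H :=
  if h : ∃ R, IsResolvent T z R then h.choose else 0

/-- The eigenspace `{x ∈ dom T | T x = E x}`. -/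
def eigenspace (T : H →ₗ.[ℂ] H) (E : ℂ) : Submodule ℂ H :=
  T.graph.comap ((LinearMap.id : H →ₗ[ℂ] H).prod (E • (LinearMap.id : H →ₗ[ℂ] H)))

/-- The orthogonal projection on the eigenspace of `T` for `E` (which is closed for closed `T`, so
that the closure changes nothing). -/
def eigenprojection (T : H →ₗ.[ℂ] H) (E : ℂ) : H →L[ℂ] H :=
  (eigenspace T E).topologicalClosure.starProjection

/-- The Riesz projection `(i / 2π) ∮ (T - z)⁻¹ dz` over the circle of centre `c` and radius `r`. -/
def rieszProjection (T : H →ₗ.[ℂ] H) (c : ℂ) (r : ℝ) : H →L[ℂ] H :=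
  (I / (2 * Real.pi)) • ∮ z in C(c, r), resolventOp T z

/-! ## The Dixmier trace -/

/-- The `n`-th singular value of `T`, by the min-max formula
`μ_n(T) = inf {‖T|_{V^⊥}‖ | dim V = n}`. -/
def singularValue (T : H →L[ℂ] H) (n : ℕ) : ℝ :=
  sInf {r | ∃ V : Submodule ℂ H, FiniteDimensional ℂ V ∧ Module.finrank ℂ V = n ∧
    r = ‖T ∘L Vᗮ.subtypeL‖}

/-- `γ_N(T) = (1 / log N) ∑_{n < N} μ_n(T)`. -/
def gammaSeq (T : H →L[ℂ] H) (N : ℕ) : ℝ :=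
  (∑ n ∈ Finset.range N, singularValue T n) / Real.log N

/-- The Dixmier ideal: compact `T` with `sup_{N > 1} γ_N(T) < ∞`. -/
def MemDixmierIdeal (T : H →L[ℂ] H) : Prop :=
  IsCompactOperator T ∧ ∃ C : ℝ, ∀ N : ℕ, 1 < N → gammaSeq T N ≤ C

/-- Elements of the Dixmier ideal for which `γ_N(T)` converges. -/
def IsDixmierMeasurable (T : H →L[ℂ] H) : Prop :=
  MemDixmierIdeal T ∧ ∃ L : ℝ, Tendsto (gammaSeq T) atTop (𝓝 L)

/-- The trace norm `‖T‖₁ = ∑_n μ_n(T) ∈ [0, ∞]` of a compact operator. -/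
def traceNorm (T : H →L[ℂ] H) : ℝ≥0∞ :=
  ∑' n : ℕ, ENNReal.ofReal (singularValue T n)

/-- `σ_s(T) = inf {‖R‖₁ + s ‖S‖ | R, S compact, R + S = T}` for a compact operator `T`. -/
def sigmaFun (T : H →L[ℂ] H) (s : ℝ) : ℝ :=
  (⨅ (R : H →L[ℂ] H) (S : H →L[ℂ] H)
    (_ : IsCompactOperator R ∧ IsCompactOperator S ∧ R + S = T),
    traceNorm R + ENNReal.ofReal (s * ‖S‖)).toReal

/-- The Cesàro mean `τ_t(T) = (1 / log t) ∫_{lam}^t (σ_s(T) / log s) ds / s`. -/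
def cesaroMean (lam : ℝ) (T : H →L[ℂ] H) (t : ℝ) : ℝ :=
  (1 / Real.log t) * ∫ s in lam..t, sigmaFun T s / Real.log s / s

open Classical in
/-- `t ↦ τ_t(T)` as a bounded continuous function on `[lam, ∞)` (which it is when `lam > e` and
`T` is in the Dixmier ideal; otherwise `0`). -/
def cesaroBCF (lam : ℝ) (T : H →L[ℂ] H) : Set.Ici lam →ᵇ ℂ :=
  if h : ∃ g : Set.Ici lam →ᵇ ℂ, ∀ t, g t = (cesaroMean lam T t : ℂ) then h.choose else 0

/-- A state on the C*-algebra `C_b([lam, ∞)) / C_0([lam, ∞))`: a positive normalized linear form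
on `C_b([lam, ∞))` which vanishes on the functions that tend to `0` at infinity. -/
structure StateAtInfinity (lam : ℝ) where
  toLin : (Set.Ici lam →ᵇ ℂ) →ₗ[ℂ] ℂ
  nonneg : ∀ f : Set.Ici lam →ᵇ ℂ, (∀ t, 0 ≤ f t) → 0 ≤ toLin f
  map_one : toLin 1 = 1
  vanish : ∀ f : Set.Ici lam →ᵇ ℂ, Tendsto f atTop (𝓝 0) → toLin f = 0

/-- `ω(τ(T))` for positive `T` in the Dixmier ideal. -/
def dixmierPos {lam : ℝ} (ω : StateAtInfinity lam) (T : H →L[ℂ] H) : ℂ :=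
  ω.toLin (cesaroBCF lam T)

/-- The Dixmier trace attached to the state `ω`: the linear extension of `dixmierPos` through
`T = (Re T)⁺ - (Re T)⁻ + i ((Im T)⁺ - (Im T)⁻)`. -/
def dixmierTrace {lam : ℝ} (ω : StateAtInfinity lam) (T : H →L[ℂ] H) : ℂ :=
  (dixmierPos ω (ℜ T : H →L[ℂ] H)⁺ - dixmierPos ω (ℜ T : H →L[ℂ] H)⁻) +
    I * (dixmierPos ω (ℑ T : H →L[ℂ] H)⁺ - dixmierPos ω (ℑ T : H →L[ℂ] H)⁻)

end Operators

/-! ## Differential expressions on the plane -/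

/-- The partial derivative in the first variable. -/
def d1 (f : ℝ × ℝ → ℂ) (x : ℝ × ℝ) : ℂ := fderiv ℝ f x (1, 0)

/-- The partial derivative in the second variable. -/
def d2 (f : ℝ × ℝ → ℂ) (x : ℝ × ℝ) : ℂ := fderiv ℝ f x (0, 1)

/-- The fibre momentum `K₁(k) = -i l ∂₁ - x₂ / (2 l) + l k₁`; the kinetic momentum is `K₁(0)`. -/
def K1 (l : ℝ) (k : ℝ × ℝ) (f : ℝ × ℝ → ℂ) (x : ℝ × ℝ) : ℂ :=
  -I * l * d1 f x - (x.2 / (2 * l) : ℝ) * f x + (l * k.1 : ℝ) * f x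

/-- The fibre momentum `K₂(k) = -i l ∂₂ + x₁ / (2 l) + l k₂`; the kinetic momentum is `K₂(0)`. -/
def K2 (l : ℝ) (k : ℝ × ℝ) (f : ℝ × ℝ → ℂ) (x : ℝ × ℝ) : ℂ :=
  -I * l * d2 f x + (x.1 / (2 * l) : ℝ) * f x + (l * k.2 : ℝ) * f x

/-- The dual momentum `G₁ = -i l ∂₂ - x₁ / (2 l)`. -/
def G1 (l : ℝ) (f : ℝ × ℝ → ℂ) (x : ℝ × ℝ) : ℂ :=
  -I * l * d2 f x - (x.1 / (2 * l) : ℝ) * f x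

/-- The dual momentum `G₂ = -i l ∂₁ + x₂ / (2 l)`. -/
def G2 (l : ℝ) (f : ℝ × ℝ → ℂ) (x : ℝ × ℝ) : ℂ :=
  -I * l * d1 f x + (x.2 / (2 * l) : ℝ) * f x

/-- The expression `(ε / 2) (K₁(k)² + K₂(k)²)`. -/
def landauExpr (l ε : ℝ) (k : ℝ × ℝ) (f : ℝ × ℝ → ℂ) (x : ℝ × ℝ) : ℂ :=
  (ε / 2 : ℝ) * (K1 l k (K1 l k f) x + K2 l k (K2 l k f) x)

/-- The expression `(1 / 2) (K₁² + K₂² + G₁² + G₂²)`. -/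
def oscillatorExpr (l : ℝ) (f : ℝ × ℝ → ℂ) (x : ℝ × ℝ) : ℂ :=
  (1 / 2) * (K1 l 0 (K1 l 0 f) x + K2 l 0 (K2 l 0 f) x + G1 l (G1 l f) x + G2 l (G2 l f) x)

/-! ## Operators on the whole plane -/

/-- The Hilbert space `L²(ℝ²)`. -/
abbrev L2Plane : Type := Lp ℂ 2 (volume : Measure (ℝ × ℝ))

/-- The Schwartz functions on the plane. -/
def schwartzCore : Set (ℝ × ℝ → ℂ) := Set.range fun f : SchwartzMap (ℝ × ℝ) ℂ => (f : ℝ × ℝ → ℂ)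

/-- The Landau Hamiltonian `H_B`, with magnetic length `l` and magnetic energy `ε`. -/
def landauHamiltonian (l ε : ℝ) : L2Plane →ₗ.[ℂ] L2Plane :=
  closedRealization volume schwartzCore (landauExpr l ε 0)

/-- The `j`-th Landau level `E_j = ε (j + 1/2)`. -/
def landauLevel (ε : ℝ) (j : ℕ) : ℂ := (ε * (j + 1 / 2) : ℝ)

/-- The `j`-th Landau projection `Π_j`. -/
def landauProjection (l ε : ℝ) (j : ℕ) : L2Plane →L[ℂ] L2Plane :=
  eigenprojection (landauHamiltonian l ε) (landauLevel ε j)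

/-- The harmonic oscillator `Q_B`. -/
def oscillator (l : ℝ) : L2Plane →ₗ.[ℂ] L2Plane :=
  closedRealization volume schwartzCore (oscillatorExpr l)

/-- `Q_{B,ξ}⁻¹ = (Q_B + 2 ξ)⁻¹`. -/
def oscillatorInv (l ξ : ℝ) : L2Plane →L[ℂ] L2Plane :=
  resolventOp (oscillator l) (-(2 * ξ : ℝ))

/-! ## Fibre operators and the Landau bundle -/

/-- The side `√(2π) l` of the magnetic unit cell. -/
def cellSide (l : ℝ) : ℝ := Real.sqrt (2 * Real.pi) * l

/-- The period `√(2π) / l` of the Brillouin torus. -/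
def dualSide (l : ℝ) : ℝ := Real.sqrt (2 * Real.pi) / l

/-- The magnetic unit cell `[0, √(2π) l]²`. -/
def unitCell (l : ℝ) : Set (ℝ × ℝ) := Set.Icc 0 (cellSide l) ×ˢ Set.Icc 0 (cellSide l)

/-- Lebesgue measure on the unit cell. -/
abbrev cellMeasure (l : ℝ) : Measure (ℝ × ℝ) := volume.restrict (unitCell l)

/-- The fibre Hilbert space `L²(Y_B)`. -/
abbrev L2Cell (l : ℝ) : Type := Lp ℂ 2 (cellMeasure l)

/-- The magnetic translation
`(T_m f)(x) = (-1)^{m₁ m₂} exp(-i √(π/2) (m₁ x₂ - m₂ x₁) / l) f(x - √(2π) l m)`. -/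
def magneticTranslation (l : ℝ) (m : ℤ × ℤ) (f : ℝ × ℝ → ℂ) (x : ℝ × ℝ) : ℂ :=
  (-1 : ℂ) ^ (m.1 * m.2) *
    exp (-I * (Real.sqrt (Real.pi / 2) * (m.1 * x.2 - m.2 * x.1) / l : ℝ)) *
    f (x.1 - cellSide l * m.1, x.2 - cellSide l * m.2)

/-- The smooth functions on the plane that are invariant under all magnetic translations. Such a
function is determined by its restriction to the unit cell. -/
def fibreCore (l : ℝ) : Set (ℝ × ℝ → ℂ) :=
  {f | ContDiff ℝ (⊤ : ℕ∞) f ∧ ∀ (m : ℤ × ℤ) (x : ℝ × ℝ), magneticTranslation l m f x = f x}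

/-- The fibre Hamiltonian `H_B(k) = (ε / 2) (K₁(k)² + K₂(k)²)` on `L²(Y_B)`, with magnetic
(quasi-periodic) boundary conditions. -/
def fibreHamiltonian (l ε : ℝ) (k : ℝ × ℝ) : L2Cell l →ₗ.[ℂ] L2Cell l :=
  closedRealization (cellMeasure l) (fibreCore l) (landauExpr l ε k)

/-- The spectral projection `Π_j(k)` of `H_B(k)`, as the Riesz integral over the circle of radius
`ε / 2` around the `j`-th Landau level. -/
def fibreProjection (l ε : ℝ) (j : ℕ) (k : ℝ × ℝ) : L2Cell l →L[ℂ] L2Cell l :=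
  rieszProjection (fibreHamiltonian l ε k) (landauLevel ε j) (ε / 2)

/-- The Brillouin torus `ℝ² / ((√(2π) / l) ℤ)²`. -/
abbrev BrillouinTorus (l : ℝ) : Type := AddCircle (dualSide l) × AddCircle (dualSide l)

/-- The quotient map `ℝ² → 𝔹`. -/
def toTorus (l : ℝ) (k : ℝ × ℝ) : BrillouinTorus l :=
  ((k.1 : AddCircle (dualSide l)), (k.2 : AddCircle (dualSide l)))

/-- The fibre over the torus point `κ` of the bundle obtained from `ℝ² × L²(Y_B)` by the
identifications `(k, v) ~ (k', e^{-i (k' - k) · y} v)` whenever `k` and `k'` represent the same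
point: an element is the family, indexed by the representatives `k` of `κ`, of the vectors that are
identified with each other. -/
def hilbertFibre (l : ℝ) (κ : BrillouinTorus l) :
    Submodule ℂ ({k : ℝ × ℝ // toTorus l k = κ} → L2Cell l) where
  carrier := {v | ∀ k k', (v k' : ℝ × ℝ → ℂ) =ᵐ[cellMeasure l] fun y =>
    exp (-I * ((k'.1.1 - k.1.1) * y.1 + (k'.1.2 - k.1.2) * y.2 : ℝ)) * v k y}
  add_mem' := by
    intro v w hv hw k k'
    filter_upwards [hv k k', hw k k', Lp.coeFn_add (v k) (w k), Lp.coeFn_add (v k') (w k')]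
      with y h1 h2 h3 h4
    simp only [Pi.add_apply] at h3 h4 ⊢
    rw [h4, h3, h1, h2]
    ring
  zero_mem' := by
    intro k k'
    filter_upwards [Lp.coeFn_zero ℂ 2 (cellMeasure l)] with y h1
    simp only [Pi.zero_apply] at h1 ⊢
    rw [h1, mul_zero]
  smul_mem' := by
    intro c v hv k k'
    filter_upwards [hv k k', Lp.coeFn_smul c (v k), Lp.coeFn_smul c (v k')] with y h1 h2 h3
    simp only [Pi.smul_apply, smul_eq_mul] at h2 h3 ⊢
    rw [h3, h2, h1]
    ring

/-- The fibre `Ran Π_j(k)` of the Landau bundle `ℰ_j` over the torus point `κ = [k]`. -/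
def landauBundle (l ε : ℝ) (j : ℕ) (κ : BrillouinTorus l) :
    Submodule ℂ ({k : ℝ × ℝ // toTorus l k = κ} → L2Cell l) :=
  hilbertFibre l κ ⊓ Submodule.pi Set.univ fun k => (fibreProjection l ε j k.1).range

/-- The family `E` of subspaces is a (locally trivial) complex vector bundle of rank `r` over the
Brillouin torus: around every point there are `r` continuous local sections which form a basis of
the fibre at every point of a neighbourhood. A section is continuous when the function that maps
`k` in (an open subset of) `ℝ²` to its value in `L²(Y_B)` at the representative `k` is. -/
def IsVectorBundleOfRank {l : ℝ}
    (E : ∀ κ : BrillouinTorus l, Submodule ℂ ({k : ℝ × ℝ // toTorus l k = κ} → L2Cell l))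
    (r : ℕ) : Prop :=
  ∀ κ₀ : BrillouinTorus l, ∃ U : Set (BrillouinTorus l), IsOpen U ∧ κ₀ ∈ U ∧
    ∃ s : Fin r → ∀ κ : BrillouinTorus l, E κ,
      (∀ i, ContinuousOn (fun k : ℝ × ℝ => (s i (toTorus l k)).1 ⟨k, rfl⟩) (toTorus l ⁻¹' U)) ∧
      ∀ κ ∈ U, LinearIndependent ℂ (fun i => s i κ) ∧
        Submodule.span ℂ (Set.range fun i => s i κ) = ⊤

end Landau

end

/-! Both numbers are read off from explicit diagonalizations.

On the plane, `K1`, `K2` and `G1`, `G2` are two commuting canonical pairs. Their raising operators,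
applied to the Gaussian exp(-|x|²/(4l²)), give an orthogonal family indexed by pairs (p, q), on
which `H_B` has the eigenvalue ε(p + 1/2) and `Q_B` the eigenvalue p + q + 1. Hence the product of
(Q_B + 2ξ)⁻¹ with Π_j is diagonal, and its nonzero eigenvalues are 1/(m + j + 1 + 2ξ) for m = 0, 1,
2, ...: a Landau level carries exactly one shifted harmonic series. Its partial sums are log N +
O(1), so γ_N tends to 1; likewise σ_s = log s + O(1), so the Cesàro mean differs from 1 by O(log log
t / log t) and every state at infinity takes the value 1 (`dixmier_of_diagonal`).

On the unit cell only the pair `K1 l k`, `K2 l k` is used. The cell has area 2πl², and the lowering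
operator at k = 0 annihilates a Jacobi theta function with modulus i times an exponential factor.
Its raising powers form one state per Landau level. An explicit translation with phase,
`fibreShift`, preserves the magnetic boundary conditions and intertwines K(k) with K(0); so the
fibre over [k] is the line spanned by the shifted j-th state, which varies continuously with k. This
is a line bundle, so the rank is 1 as well.

The analytic substance is completeness of the two families of eigenfunctions. Both times it is
deduced from `setIntegral_eq_zero_of_moments`: a function with exponential decay and vanishing
moments integrates to zero over all preimages of measurable sets. Once a complete orthogonal family
of eigenvectors lies in the core, `isDiagonal_topologicalClosure` shows that the closed operator is
exactly the diagonal one, and resolvents, eigenprojections and Riesz projections are computed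
coefficient by coefficient. -/

open scoped InnerProductSpace

namespace Landau

/-! ### Unbounded operators that are diagonal in a Hilbert basis. -/

section DiagonalOperators

variable {ι H : Type*} [NormedAddCommGroup H] [InnerProductSpace ℂ H]

theorem _root_.HilbertBasis.ext_inner (b : HilbertBasis ι ℂ H) {x y : H}
    (h : ∀ i, ⟪b i, x⟫_ℂ = ⟪b i, y⟫_ℂ) : x = y := by
  apply b.repr.injective
  ext i
  simp only [b.repr_apply_apply, h]

/-- Bounded diagonal operators. -/
theorem _root_.HilbertBasis.exists_diagonal (b : HilbertBasis ι ℂ H) (d : ι → ℂ) (C : ℝ)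
    (hC : 0 ≤ C) (hd : ∀ i, ‖d i‖ ≤ C) :
    ∃ D : H →L[ℂ] H, (∀ x i, ⟪b i, D x⟫_ℂ = d i * ⟪b i, x⟫_ℂ) ∧ ‖D‖ ≤ C := by
  let T : ∀ _ : ι, ℂ →L[ℂ] ℂ := fun i => d i • ContinuousLinearMap.id ℂ ℂ
  have hT : ∀ i, ‖T i‖ ≤ C := fun i => by
    have h : ‖T i‖ = ‖d i‖ := by simp [T, norm_smul]
    exact h ▸ hd i
  let M : lp (fun _ : ι => ℂ) 2 →L[ℂ] lp (fun _ : ι => ℂ) 2 := lp.mapCLM 2 T hC hT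
  refine ⟨(b.repr.symm : lp (fun _ : ι => ℂ) 2 →L[ℂ] H) ∘L M ∘L
    (b.repr : H →L[ℂ] lp (fun _ : ι => ℂ) 2), fun x i => ?_, ?_⟩
  · rw [← b.repr_apply_apply, ← b.repr_apply_apply]
    simp [M, T, lp.mapCLM]
  · refine ContinuousLinearMap.opNorm_le_bound _ hC fun x => ?_
    have h1 : ‖M (b.repr x)‖ ≤ C * ‖b.repr x‖ :=
      (M.le_opNorm _).trans (by gcongr; exact lp.norm_mapCLM_le 2 T hC hT)
    simpa using h1

/-- The unbounded operator `T` is diagonal in the Hilbert basis `b`, with eigenvalues `e`. -/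
def IsDiagonal (T : H →ₗ.[ℂ] H) (b : HilbertBasis ι ℂ H) (e : ι → ℂ) : Prop :=
  ∀ x y : H, (x, y) ∈ T.graph ↔ ∀ i, ⟪b i, y⟫_ℂ = e i * ⟪b i, x⟫_ℂ

/-- The coefficient relation is closed, so it passes from `G` to the closure. Conversely a pair that
satisfies it is the limit of the simultaneous partial sums of both expansions, which are
combinations of the pairs `(b i, e i • b i)`. No study of domains is needed. -/
theorem isDiagonal_topologicalClosure (b : HilbertBasis ι ℂ H) (e : ι → ℂ)
    (G : Submodule ℂ (H × H)) (hb : ∀ i, (b i, e i • b i) ∈ G)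
    (hG : ∀ p ∈ G, ∀ i, ⟪b i, p.2⟫_ℂ = e i * ⟪b i, p.1⟫_ℂ) :
    IsDiagonal G.topologicalClosure.toLinearPMap b e := by
  have hcl : ∀ p : H × H, p ∈ G.topologicalClosure ↔ ∀ i, ⟪b i, p.2⟫_ℂ = e i * ⟪b i, p.1⟫_ℂ := by
    intro p
    constructor
    · intro hp i
      have hclosed : IsClosed {p : H × H | ⟪b i, p.2⟫_ℂ = e i * ⟪b i, p.1⟫_ℂ} :=
        isClosed_eq (by fun_prop) (by fun_prop)
      exact closure_minimal (fun q hq => hG q hq i) hclosed hp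
    · intro hp
      have h1 := (b.hasSum_repr p.1).prodMk (b.hasSum_repr p.2)
      refine G.isClosed_topologicalClosure.mem_of_tendsto h1 (Eventually.of_forall fun s => ?_)
      refine Submodule.sum_mem _ fun i _ => G.le_topologicalClosure ?_
      have := G.smul_mem (b.repr p.1 i) (hb i)
      convert this using 1
      ext
      · rfl
      · simp only [Prod.smul_snd, smul_smul, b.repr_apply_apply, hp i, mul_comm]
  intro x y
  rw [Submodule.toLinearPMap_graph_eq, hcl]
  intro p hp h0
  refine b.ext_inner fun i => ?_
  rw [(hcl p).1 hp i, h0]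
  simp

variable {T : H →ₗ.[ℂ] H} {b : HilbertBasis ι ℂ H} {e : ι → ℂ}

theorem IsDiagonal.exists_isResolvent (hT : IsDiagonal T b e) {z : ℂ} {δ : ℝ} (hδ : 0 < δ)
    (hz : ∀ i, δ ≤ ‖e i - z‖) :
    ∃ R, IsResolvent T z R ∧ ‖R‖ ≤ δ⁻¹ := by
  have hne : ∀ i, e i - z ≠ 0 := fun i => norm_pos_iff.1 (hδ.trans_le (hz i))
  obtain ⟨R, hR, hRn⟩ := b.exists_diagonal (fun i => (e i - z)⁻¹) δ⁻¹ (by positivity)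
    (fun i => by rw [norm_inv]; exact inv_anti₀ hδ (hz i))
  refine ⟨R, ⟨fun y => ?_, fun x => ?_⟩, hRn⟩
  · have hg : (R y, y + z • R y) ∈ T.graph := by
      refine (hT _ _).2 fun i => ?_
      rw [inner_add_right, inner_smul_right, hR]
      have := hne i
      field_simp
      ring
    rw [LinearPMap.mem_graph_iff] at hg
    obtain ⟨w, hw1, hw2⟩ := hg
    simp only at hw1 hw2
    refine ⟨hw1 ▸ w.2, ?_⟩
    have : (⟨R y, hw1 ▸ w.2⟩ : T.domain) = w := Subtype.ext hw1.symm
    rw [this, hw2]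
    simp
  · refine b.ext_inner fun i => ?_
    have := (hT _ _).1 (T.mem_graph x) i
    rw [hR, inner_sub_right, inner_smul_right, this]
    have := hne i
    field_simp

/-- Derived from the resolvent property alone, because `resolventOp` is an arbitrary choice among
the resolvents. -/
theorem IsDiagonal.inner_of_isResolvent (hT : IsDiagonal T b e) {z : ℂ} {R : H →L[ℂ] H}
    (hR : IsResolvent T z R) (i : ι) (hz : e i - z ≠ 0) (y : H) :
    ⟪b i, R y⟫_ℂ = (e i - z)⁻¹ * ⟪b i, y⟫_ℂ := by
  obtain ⟨h, hy⟩ := hR.1 y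
  have h1 := (hT _ _).1 (T.mem_graph ⟨R y, h⟩) i
  have h2 := congrArg (fun w => ⟪b i, w⟫_ℂ) hy
  simp only [inner_sub_right, inner_smul_right] at h2 h1
  rw [h1] at h2
  rw [← h2]
  field_simp

theorem IsDiagonal.isResolvent_resolventOp (hT : IsDiagonal T b e) {z : ℂ} {δ : ℝ} (hδ : 0 < δ)
    (hz : ∀ i, δ ≤ ‖e i - z‖) : IsResolvent T z (resolventOp T z) := by
  obtain ⟨R, hR, -⟩ := hT.exists_isResolvent hδ hz
  have : ∃ R, IsResolvent T z R := ⟨R, hR⟩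
  rw [resolventOp, dif_pos this]
  exact this.choose_spec

theorem IsDiagonal.inner_resolventOp (hT : IsDiagonal T b e) {z : ℂ} {δ : ℝ} (hδ : 0 < δ)
    (hz : ∀ i, δ ≤ ‖e i - z‖) (i : ι) (y : H) :
    ⟪b i, resolventOp T z y⟫_ℂ = (e i - z)⁻¹ * ⟪b i, y⟫_ℂ :=
  hT.inner_of_isResolvent (hT.isResolvent_resolventOp hδ hz) i
    (norm_pos_iff.1 (hδ.trans_le (hz i))) y

theorem IsDiagonal.mem_eigenspace (hT : IsDiagonal T b e) (E : ℂ) (x : H) :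
    x ∈ eigenspace T E ↔ ∀ i, e i ≠ E → ⟪b i, x⟫_ℂ = 0 := by
  change (x, E • x) ∈ T.graph ↔ _
  rw [hT]
  refine forall_congr' fun i => ?_
  rw [inner_smul_right, mul_eq_mul_right_iff, or_iff_not_imp_left]
  exact imp_congr_left (not_congr eq_comm)

theorem IsDiagonal.inner_eigenprojection [CompleteSpace H] (hT : IsDiagonal T b e) (E : ℂ) (x : H)
    (i : ι) [Decidable (e i = E)] :
    ⟪b i, eigenprojection T E x⟫_ℂ = if e i = E then ⟪b i, x⟫_ℂ else 0 := by
  classical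
  obtain ⟨P, hP, -⟩ := b.exists_diagonal (fun i => if e i = E then 1 else 0) 1 zero_le_one
    (fun i => by split_ifs <;> simp)
  -- The closure in the definition of `eigenprojection` imposes nothing new: vanishing of a
  -- coefficient is a closed condition.
  have hclosed : ∀ v, v ∈ (eigenspace T E).topologicalClosure → ∀ i, e i ≠ E → ⟪b i, v⟫_ℂ = 0 := by
    intro v hv i hi
    have hcl : IsClosed {v : H | ⟪b i, v⟫_ℂ = 0} := isClosed_eq (by fun_prop) (by fun_prop)
    exact closure_minimal (fun q hq => (hT.mem_eigenspace E q).1 hq i hi) hcl hv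
  have key : eigenprojection T E x = P x := by
    refine Submodule.eq_starProjection_of_mem_of_inner_eq_zero
      ((eigenspace T E).le_topologicalClosure ((hT.mem_eigenspace E _).2 fun i hi => ?_))
      fun w hw => ?_
    · rw [hP, if_neg hi, zero_mul]
    · rw [← b.tsum_inner_mul_inner]
      convert tsum_zero with i
      by_cases hi : e i = E
      · rw [← inner_conj_symm, inner_sub_right, hP, if_pos hi]
        simp
      · rw [hclosed w hw i hi, mul_zero]
  rw [key, hP]
  split_ifs <;> simp

theorem IsDiagonal.inner_rieszProjection [CompleteSpace H] (hT : IsDiagonal T b e) {c : ℂ}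
    {r δ : ℝ} (hr : 0 < r) (hδ : 0 < δ) (hz : ∀ z ∈ Metric.sphere c r, ∀ i, δ ≤ ‖e i - z‖) (x : H)
    (i : ι) [Decidable (e i ∈ Metric.ball c r)] :
    ⟪b i, rieszProjection T c r x⟫_ℂ = if e i ∈ Metric.ball c r then ⟪b i, x⟫_ℂ else 0 := by
  have hne : ∀ z ∈ Metric.sphere c r, ∀ i, e i - z ≠ 0 := fun z hzs i =>
    norm_pos_iff.1 (hδ.trans_le (hz z hzs i))
  -- The resolvent identity, read on coefficients, gives the Lipschitz constant δ⁻². Norm continuity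
  -- makes the circle integral exist and lets it commute with the functional that extracts a
  -- coefficient.
  have hcont : ContinuousOn (resolventOp T) (Metric.sphere c r) := by
    have : LipschitzOnWith (Real.toNNReal (δ⁻¹ * δ⁻¹)) (resolventOp T) (Metric.sphere c r) := by
      refine LipschitzOnWith.of_dist_le_mul fun z hzs w hws => ?_
      rw [Real.coe_toNNReal _ (by positivity), dist_eq_norm, dist_eq_norm]
      obtain ⟨D, hD, hDn⟩ := b.exists_diagonal (fun i => (e i - z)⁻¹ - (e i - w)⁻¹)
        (δ⁻¹ * δ⁻¹ * ‖z - w‖) (by positivity) (fun i => by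
          have h1 := hne z hzs i
          have h2 := hne w hws i
          have h3 : (e i - z)⁻¹ - (e i - w)⁻¹ = (e i - z)⁻¹ * (e i - w)⁻¹ * (z - w) := by
            field_simp
            ring
          rw [h3, norm_mul, norm_mul, norm_inv, norm_inv]
          have := hz z hzs i
          have := hz w hws i
          gcongr)
      have hDeq : resolventOp T z - resolventOp T w = D := by
        ext y
        refine b.ext_inner fun i => ?_
        rw [hD, sub_apply, inner_sub_right, hT.inner_resolventOp hδ (hz z hzs),
          hT.inner_resolventOp hδ (hz w hws)]
        ring
      rw [hDeq]
      exact hDn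
    exact this.continuousOn
  have hint : CircleIntegrable (resolventOp T) c r := hcont.circleIntegrable hr.le
  have hcoef : ⟪b i, (∮ z in C(c, r), resolventOp T z) x⟫_ℂ =
      ∮ z in C(c, r), (e i - z)⁻¹ * ⟪b i, x⟫_ℂ := by
    let Λ : (H →L[ℂ] H) →L[ℂ] ℂ := (innerSL ℂ (b i)) ∘L (ContinuousLinearMap.apply ℂ H x)
    have h1 : ⟪b i, (∮ z in C(c, r), resolventOp T z) x⟫_ℂ =
        Λ (∮ z in C(c, r), resolventOp T z) := rfl
    rw [h1, circleIntegral, ← ContinuousLinearMap.intervalIntegral_comp_comm _ hint.out]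
    have h2 : (∮ z in C(c, r), Λ (resolventOp T z)) = ∮ z in C(c, r), (e i - z)⁻¹ * ⟪b i, x⟫_ℂ :=
      circleIntegral.integral_congr hr.le fun z hzs => hT.inner_resolventOp hδ (hz z hzs) i x
    rw [← h2, circleIntegral]
    simp only [map_smul]
  -- The sign comes from (e - z)⁻¹ = -(z - e)⁻¹ and is compensated by the prefactor, since
  -- (i/2π)(-2πi) = 1.
  have hval : (∮ z in C(c, r), (e i - z)⁻¹ * ⟪b i, x⟫_ℂ) =
      (if e i ∈ Metric.ball c r then -(2 * Real.pi * I) else 0) * ⟪b i, x⟫_ℂ := by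
    have h3 : (∮ z in C(c, r), (e i - z)⁻¹ * ⟪b i, x⟫_ℂ) =
        (-⟪b i, x⟫_ℂ) * ∮ z in C(c, r), (z - e i)⁻¹ := by
      rw [← circleIntegral.integral_const_mul]
      congr 1
      ext z
      rw [← neg_sub, inv_neg]
      ring
    rw [h3]
    split_ifs with hi
    · rw [circleIntegral.integral_sub_inv_of_mem_ball hi]
      ring
    · have hout : ∀ z ∈ Metric.closedBall c r, z - e i ≠ 0 := by
        intro z hzb h0
        have h4 : z = e i := sub_eq_zero.1 h0
        rcases (Metric.mem_closedBall.1 hzb).lt_or_eq with h5 | h5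
        · exact hi (h4 ▸ Metric.mem_ball.2 h5)
        · exact hne z h5 i (by rw [h4, sub_self])
      have hd : DifferentiableOn ℂ (fun z => (z - e i)⁻¹) (Metric.closedBall c r) :=
        (differentiableOn_id.sub_const _).inv hout
      rw [DiffContOnCl.circleIntegral_eq_zero hr.le
        (hd.diffContOnCl_ball (subset_refl _))]
      ring
  rw [rieszProjection, smul_apply, inner_smul_right, hcoef, hval]
  split_ifs
  · field_simp
    rw [I_sq]
    ring
  · ring

end DiagonalOperators

end Landau

namespace Landau

set_option linter.unusedSectionVars false

/-! ### Singular values and the functional σ_s of diagonal operators. -/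

section SingularValues

variable {ι H : Type*} [NormedAddCommGroup H] [InnerProductSpace ℂ H] [CompleteSpace H]

theorem singularValue_le {T : H →L[ℂ] H} {n : ℕ} (V : Submodule ℂ H) [FiniteDimensional ℂ V]
    (hV : Module.finrank ℂ V = n) {C : ℝ} (hC : 0 ≤ C) (h : ∀ x ∈ Vᗮ, ‖T x‖ ≤ C * ‖x‖) :
    singularValue T n ≤ C := by
  have hb : ‖T ∘L Vᗮ.subtypeL‖ ≤ C :=
    ContinuousLinearMap.opNorm_le_bound _ hC fun x => h x x.2
  refine le_trans (csInf_le ⟨0, ?_⟩ ⟨V, inferInstance, hV, rfl⟩) hb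
  rintro r ⟨W, -, -, rfl⟩
  exact ContinuousLinearMap.opNorm_nonneg _

theorem singularValue_nonneg (T : H →L[ℂ] H) (n : ℕ) : 0 ≤ singularValue T n := by
  refine Real.sInf_nonneg ?_
  rintro r ⟨W, -, -, rfl⟩
  exact ContinuousLinearMap.opNorm_nonneg _

/-- A space that contains an infinite orthonormal family has subspaces of every dimension. -/
theorem exists_finrank_eq {e : ℕ → H} (he : Orthonormal ℂ e) (n : ℕ) :
    ∃ V : Submodule ℂ H, FiniteDimensional ℂ V ∧ Module.finrank ℂ V = n ∧ ∀ m < n, e m ∈ V := by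
  have hli : LinearIndependent ℂ (fun m : Fin n => e m) :=
    he.linearIndependent.comp _ Fin.val_injective
  refine ⟨Submodule.span ℂ (Set.range fun m : Fin n => e m), ?_, ?_, fun m hm => ?_⟩
  · exact FiniteDimensional.span_of_finite ℂ (Set.finite_range _)
  · rw [finrank_span_eq_card hli, Fintype.card_fin]
  · exact Submodule.subset_span ⟨⟨m, hm⟩, rfl⟩

/-- The orthonormal sequence makes the space infinite dimensional, so that the infimum runs over a
nonempty set and does not take its default value 0. -/
theorem le_singularValue {e : ℕ → H} (he : Orthonormal ℂ e) {T : H →L[ℂ] H} {n : ℕ} {C : ℝ}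
    (h : ∀ V : Submodule ℂ H, FiniteDimensional ℂ V → Module.finrank ℂ V = n →
      C ≤ ‖T ∘L Vᗮ.subtypeL‖) : C ≤ singularValue T n := by
  obtain ⟨V, hV, hVn, -⟩ := exists_finrank_eq he n
  refine le_csInf ⟨_, V, hV, hVn, rfl⟩ ?_
  rintro r ⟨W, hW, hWn, rfl⟩
  exact h W hW hWn

theorem singularValue_le_add_norm {e : ℕ → H} (he : Orthonormal ℂ e) (R S : H →L[ℂ] H) (n : ℕ) :
    singularValue (R + S) n ≤ singularValue R n + ‖S‖ := by
  rw [← sub_le_iff_le_add]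
  refine le_singularValue he fun V hV hVn => ?_
  rw [sub_le_iff_le_add]
  refine singularValue_le V hVn (by positivity) fun x hx => ?_
  rw [add_apply, add_mul]
  refine (norm_add_le _ _).trans (add_le_add ?_ (S.le_opNorm x))
  exact (R ∘L Vᗮ.subtypeL).le_opNorm ⟨x, hx⟩

/-- The span of the first n + 1 eigenvectors has too large a dimension to be projected injectively
onto an n-dimensional `V`, so it meets `Vᗮ` in some nonzero x. There ⟨x, T x⟩ ≥ C‖x‖². -/
theorem le_singularValue_of_orthonormal {e : ℕ → H} (he : Orthonormal ℂ e) {T : H →L[ℂ] H}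
    {a : ℕ → ℝ} (hT : ∀ m, T (e m) = (a m : ℂ) • e m) {n : ℕ} {C : ℝ}
    (hC : ∀ m ≤ n, C ≤ a m) : C ≤ singularValue T n := by
  refine le_singularValue he fun V hV hVn => ?_
  let f : (Fin (n + 1) → ℂ) →ₗ[ℂ] V := V.orthogonalProjectionOnto.toLinearMap ∘ₗ
    Fintype.linearCombination ℂ (fun m : Fin (n + 1) => e m)
  have hf : LinearMap.ker f ≠ ⊥ := LinearMap.ker_ne_bot_of_finrank_lt (by simp [hVn])
  obtain ⟨c, hc, hc0⟩ := (Submodule.ne_bot_iff _).1 hf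
  set x := Fintype.linearCombination ℂ (fun m : Fin (n + 1) => e m) c with hx
  have hon : Orthonormal ℂ (fun m : Fin (n + 1) => e m) := he.comp _ Fin.val_injective
  have hxs : x = ∑ m : Fin (n + 1), c m • e m := Fintype.linearCombination_apply _ _ _
  have hTx : T x = ∑ m : Fin (n + 1), (c m * a m) • e m := by
    rw [hxs, map_sum]
    simp only [map_smul, hT, smul_smul]
  have hxV : x ∈ Vᗮ := Submodule.orthogonalProjectionOnto_eq_zero_iff.1 hc
  have h1 : ⟪x, T x⟫_ℂ = ((∑ m : Fin (n + 1), a m * ‖c m‖ ^ 2 : ℝ) : ℂ) := by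
    rw [hTx, hxs, hon.inner_sum]
    push_cast
    refine Finset.sum_congr rfl fun m _ => ?_
    rw [← mul_assoc, Complex.conj_mul', mul_comm]
  have h2 : ‖x‖ ^ 2 = ∑ m : Fin (n + 1), ‖c m‖ ^ 2 := by
    have : ⟪x, x⟫_ℂ = ((∑ m : Fin (n + 1), ‖c m‖ ^ 2 : ℝ) : ℂ) := by
      rw [hxs, hon.inner_sum]
      push_cast
      exact Finset.sum_congr rfl fun m _ => Complex.conj_mul' _
    rw [← inner_self_eq_norm_sq (𝕜 := ℂ), this]
    exact ofReal_re _
  have hxpos : 0 < ‖x‖ := by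
    refine norm_pos_iff.2 fun h0 => hc0 ?_
    have : ∑ m : Fin (n + 1), ‖c m‖ ^ 2 = 0 := by rw [← h2, h0]; simp
    rw [Finset.sum_eq_zero_iff_of_nonneg (fun _ _ => by positivity)] at this
    ext m
    simpa using this m (Finset.mem_univ m)
  have h3 : C * ‖x‖ ^ 2 ≤ ‖x‖ * ‖T x‖ := by
    calc C * ‖x‖ ^ 2 = ∑ m : Fin (n + 1), C * ‖c m‖ ^ 2 := by rw [h2, Finset.mul_sum]
      _ ≤ ∑ m : Fin (n + 1), a m * ‖c m‖ ^ 2 := by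
          gcongr with m
          exact hC m (Nat.lt_succ_iff.1 m.2)
      _ ≤ ‖⟪x, T x⟫_ℂ‖ := by
          rw [h1, Complex.norm_real]
          exact le_abs_self _
      _ ≤ ‖x‖ * ‖T x‖ := norm_inner_le_norm _ _
  have h4 : ‖T x‖ ≤ ‖T ∘L Vᗮ.subtypeL‖ * ‖x‖ := (T ∘L Vᗮ.subtypeL).le_opNorm ⟨x, hxV⟩
  have h5 : C * ‖x‖ ≤ ‖T x‖ := by
    refine le_of_mul_le_mul_left ?_ hxpos
    linarith [h3, sq ‖x‖]
  exact le_of_mul_le_mul_right (h5.trans h4) hxpos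

/-- In any splitting T = R + S one has μ_n(T) ≤ μ_n(R) + ‖S‖; summation over n < N costs N‖S‖ ≤ s‖S‖
besides the trace norm of R. -/
theorem sum_singularValue_le_sigmaFun {e : ℕ → H} (he : Orthonormal ℂ e) {T : H →L[ℂ] H}
    (hT : IsCompactOperator T) {N : ℕ} {s : ℝ} (hs : N ≤ s) :
    ∑ n ∈ Finset.range N, singularValue T n ≤ sigmaFun T s := by
  have hs0 : 0 ≤ s := (Nat.cast_nonneg N).trans hs
  rw [sigmaFun, ← ENNReal.ofReal_le_iff_le_toReal]
  · refine le_iInf fun R => le_iInf fun S => le_iInf fun h => ?_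
    have h1 : ∑ n ∈ Finset.range N, singularValue T n ≤
        ∑ n ∈ Finset.range N, singularValue R n + s * ‖S‖ := by
      calc ∑ n ∈ Finset.range N, singularValue T n
          ≤ ∑ n ∈ Finset.range N, (singularValue R n + ‖S‖) := by
            gcongr with n
            rw [← h.2.2]
            exact singularValue_le_add_norm he R S n
        _ = ∑ n ∈ Finset.range N, singularValue R n + N * ‖S‖ := by
            rw [Finset.sum_add_distrib]
            simp
        _ ≤ _ := by gcongr
    refine (ENNReal.ofReal_le_ofReal h1).trans (ENNReal.ofReal_add_le.trans ?_)
    gcongr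
    rw [ENNReal.ofReal_sum_of_nonneg fun n _ => singularValue_nonneg R n]
    exact ENNReal.sum_le_tsum _
  -- The splitting 0 + T shows that the infimum is finite, so `toReal` loses nothing.
  · refine ne_top_of_le_ne_top (b := traceNorm (0 : H →L[ℂ] H) + ENNReal.ofReal (s * ‖T‖)) ?_
      (iInf_le_of_le 0 (iInf_le_of_le T (iInf_le _ ⟨isCompactOperator_zero, hT, zero_add T⟩)))
    have h0 : traceNorm (0 : H →L[ℂ] H) = 0 := by
      refine ENNReal.tsum_eq_zero.2 fun n => ENNReal.ofReal_eq_zero.2 ?_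
      obtain ⟨V, hV, hVn, -⟩ := exists_finrank_eq he n
      exact singularValue_le V hVn le_rfl (by simp)
    simp [h0]

theorem sigmaFun_le {T R S : H →L[ℂ] H} (hR : IsCompactOperator R) (hS : IsCompactOperator S)
    (h : R + S = T) {s A : ℝ} (hs : 0 ≤ s) (hA : 0 ≤ A) (hRA : traceNorm R ≤ ENNReal.ofReal A) :
    sigmaFun T s ≤ A + s * ‖S‖ := by
  rw [sigmaFun]
  refine ENNReal.toReal_le_of_le_ofReal (by positivity)
    ((iInf_le_of_le R (iInf_le_of_le S (iInf_le _ ⟨hR, hS, h⟩))).trans ?_)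
  rw [ENNReal.ofReal_add hA (by positivity)]
  gcongr

theorem sigmaFun_mono {T : H →L[ℂ] H} (hT : IsCompactOperator T) {e : ℕ → H}
    (he : Orthonormal ℂ e) {s t : ℝ} (hst : s ≤ t) : sigmaFun T s ≤ sigmaFun T t := by
  refine ENNReal.toReal_mono ?_ ?_
  · refine ne_top_of_le_ne_top (b := traceNorm (0 : H →L[ℂ] H) + ENNReal.ofReal (t * ‖T‖)) ?_
      (iInf_le_of_le 0 (iInf_le_of_le T (iInf_le _ ⟨isCompactOperator_zero, hT, zero_add T⟩)))
    have h0 : traceNorm (0 : H →L[ℂ] H) = 0 := by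
      refine ENNReal.tsum_eq_zero.2 fun n => ENNReal.ofReal_eq_zero.2 ?_
      obtain ⟨V, hV, hVn, -⟩ := exists_finrank_eq he n
      exact singularValue_le V hVn le_rfl (by simp)
    simp [h0]
  · gcongr

theorem isCompactOperator_toSpanSingleton_comp (f : H →L[ℂ] ℂ) (v : H) :
    IsCompactOperator (ContinuousLinearMap.toSpanSingleton ℂ v ∘L f) := by
  have h : IsCompactOperator (ContinuousLinearMap.id ℂ ℂ) :=
    ⟨Metric.closedBall 0 1, isCompact_closedBall _ _, Metric.closedBall_mem_nhds 0 one_pos⟩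
  exact (h.comp_clm f).clm_comp (ContinuousLinearMap.toSpanSingleton ℂ v)

variable {b : HilbertBasis ι ℂ H} {s : ℕ → ι} {T : H →L[ℂ] H} {d : ι → ℝ} {a : ℕ → ℝ}

theorem apply_basis (hT : ∀ x i, ⟪b i, T x⟫_ℂ = d i * ⟪b i, x⟫_ℂ) (i : ι) :
    T (b i) = (d i : ℂ) • b i := by
  classical
  refine b.ext_inner fun k => ?_
  rw [hT, inner_smul_right, orthonormal_iff_ite.1 b.orthonormal]
  split_ifs with h
  · rw [h]
  · simp

/-- Setting the eigenvalues larger than C to zero changes nothing at x, and the changed operator has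
norm at most C. -/
theorem norm_le_of_diagonal (hT : ∀ x i, ⟪b i, T x⟫_ℂ = d i * ⟪b i, x⟫_ℂ) {C : ℝ} (hC : 0 ≤ C)
    {x : H} (hx : ∀ i, |d i| ≤ C ∨ ⟪b i, x⟫_ℂ = 0) : ‖T x‖ ≤ C * ‖x‖ := by
  classical
  obtain ⟨D, hD, hDn⟩ := b.exists_diagonal (fun i => if |d i| ≤ C then (d i : ℂ) else 0) C hC
    (fun i => by
      split_ifs with h
      · rwa [Complex.norm_real]
      · simpa using hC)
  have h : T x = D x := by
    refine b.ext_inner fun i => ?_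
    rw [hT, hD]
    rcases hx i with h | h
    · rw [if_pos h]
    · rw [h, mul_zero, mul_zero]
  rw [h]
  exact (D.le_opNorm x).trans (by gcongr)

theorem singularValue_le_of_diagonal (hs : Function.Injective s)
    (hT : ∀ x i, ⟪b i, T x⟫_ℂ = d i * ⟪b i, x⟫_ℂ) {C : ℝ} (hC : 0 ≤ C) {n : ℕ}
    (h : ∀ i, |d i| ≤ C ∨ ∃ m < n, s m = i) : singularValue T n ≤ C := by
  obtain ⟨V, hV, hVn, hVm⟩ := exists_finrank_eq (b.orthonormal.comp s hs) n
  refine singularValue_le V hVn hC fun x hx => norm_le_of_diagonal hT hC fun i => ?_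
  refine (h i).imp_right ?_
  rintro ⟨m, hm, rfl⟩
  exact hx _ (hVm m hm)

/-- The finite-rank truncations of a diagonal operator. -/
theorem exists_truncation (hs : Function.Injective s) (ha : Antitone a) (ha0 : ∀ n, 0 ≤ a n)
    (hT : ∀ x i, ⟪b i, T x⟫_ℂ = d i * ⟪b i, x⟫_ℂ) (hds : ∀ m, d (s m) = a m)
    (hdz : ∀ i, i ∉ Set.range s → d i = 0) (N : ℕ) :
    ∃ R : H →L[ℂ] H, IsCompactOperator R ∧
      traceNorm R ≤ ENNReal.ofReal (∑ n ∈ Finset.range N, a n) ∧ ‖T - R‖ ≤ a N := by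
  classical
  let R : H →L[ℂ] H := ∑ m ∈ Finset.range N,
    ContinuousLinearMap.toSpanSingleton ℂ ((a m : ℂ) • b (s m)) ∘L innerSL ℂ (b (s m))
  let r : ι → ℝ := fun i => if ∃ m < N, s m = i then d i else 0
  have hR : ∀ x i, ⟪b i, R x⟫_ℂ = r i * ⟪b i, x⟫_ℂ := by
    intro x i
    simp only [R, sum_apply, ContinuousLinearMap.comp_apply,
      ContinuousLinearMap.toSpanSingleton_apply, inner_sum, inner_smul_right, innerSL_apply_apply,
      orthonormal_iff_ite.1 b.orthonormal, r]
    split_ifs with h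
    · obtain ⟨m, hm, rfl⟩ := h
      rw [Finset.sum_eq_single m]
      · simp [hds]
        ring
      · intro k _ hk
        rw [if_neg fun h => hk (hs h).symm]
        simp
      · intro h
        exact absurd (Finset.mem_range.2 hm) h
    · rw [ofReal_zero, zero_mul]
      refine Finset.sum_eq_zero fun m hm => ?_
      rw [if_neg fun h' => h ⟨m, Finset.mem_range.1 hm, h'.symm⟩]
      simp
  -- By monotonicity, `a n` dominates every eigenvalue except the first n.
  have hrest : ∀ i, ∀ n ≤ N, (¬ ∃ m < n, s m = i) → |d i| ≤ a n := by
    intro i n _ h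
    by_cases hi : i ∈ Set.range s
    · obtain ⟨m, rfl⟩ := hi
      rw [hds, abs_of_nonneg (ha0 m)]
      exact ha (not_lt.1 fun hm => h ⟨m, hm, rfl⟩)
    · rw [hdz i hi]
      simpa using ha0 n
  refine ⟨R, ?_, ?_, ?_⟩
  · have : ∀ t : Finset ℕ, IsCompactOperator (∑ m ∈ t,
        ContinuousLinearMap.toSpanSingleton ℂ ((a m : ℂ) • b (s m)) ∘L innerSL ℂ (b (s m)) :
          H →L[ℂ] H) := by
      intro t
      induction t using Finset.induction_on with
      | empty => exact isCompactOperator_zero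
      | insert m t hm ih =>
        rw [Finset.sum_insert hm]
        exact (isCompactOperator_toSpanSingleton_comp _ _).add ih
    exact this _
  · rw [traceNorm, tsum_eq_sum (s := Finset.range N),
      ENNReal.ofReal_sum_of_nonneg fun n _ => ha0 n]
    · refine Finset.sum_le_sum fun n hn => ENNReal.ofReal_le_ofReal ?_
      refine singularValue_le_of_diagonal hs hR (ha0 n) fun i => ?_
      rw [or_iff_not_imp_right]
      intro h
      simp only [r]
      split_ifs
      · exact hrest i n (Finset.mem_range.1 hn).le h
      · simpa using ha0 n
    · intro n hn
      -- For n ≥ N, removing the first n eigenvectors removes the whole support of the truncation,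
      -- so the singular value is 0.
      refine ENNReal.ofReal_eq_zero.2 (singularValue_le_of_diagonal hs hR le_rfl fun i => ?_)
      rw [or_iff_not_imp_right]
      intro h
      simp only [r]
      rw [if_neg, abs_zero]
      rintro ⟨m, hm, hmi⟩
      exact h ⟨m, hm.trans_le (not_lt.1 fun h' => hn (Finset.mem_range.2 h')), hmi⟩
  · refine ContinuousLinearMap.opNorm_le_bound _ (ha0 N) fun x => ?_
    refine norm_le_of_diagonal (T := T - R) (b := b) (d := fun i => d i - r i) (fun x i => ?_)
      (ha0 N) fun i => Or.inl ?_
    · rw [sub_apply, inner_sub_right, hT, hR]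
      push_cast
      ring
    · simp only [r]
      split_ifs with h
      · simpa using ha0 N
      · rw [sub_zero]
        exact hrest i N le_rfl h

theorem isCompactOperator_of_diagonal (hs : Function.Injective s) (ha : Antitone a)
    (ha0 : ∀ n, 0 ≤ a n) (hlim : Tendsto a atTop (𝓝 0))
    (hT : ∀ x i, ⟪b i, T x⟫_ℂ = d i * ⟪b i, x⟫_ℂ) (hds : ∀ m, d (s m) = a m)
    (hdz : ∀ i, i ∉ Set.range s → d i = 0) : IsCompactOperator T := by
  choose R hR _ hRn using exists_truncation hs ha ha0 hT hds hdz
  refine isCompactOperator_of_tendsto (F := R) (l := atTop) ?_ (Eventually.of_forall hR)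
  rw [tendsto_iff_norm_sub_tendsto_zero]
  refine squeeze_zero (fun _ => norm_nonneg _) (fun n => ?_) hlim
  rw [norm_sub_rev]
  exact hRn n

theorem singularValue_eq_of_diagonal (hs : Function.Injective s) (ha : Antitone a)
    (ha0 : ∀ n, 0 ≤ a n) (hT : ∀ x i, ⟪b i, T x⟫_ℂ = d i * ⟪b i, x⟫_ℂ)
    (hds : ∀ m, d (s m) = a m) (hdz : ∀ i, i ∉ Set.range s → d i = 0) (n : ℕ) :
    singularValue T n = a n := by
  refine le_antisymm (singularValue_le_of_diagonal hs hT (ha0 n) fun i => ?_)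
    (le_singularValue_of_orthonormal (b.orthonormal.comp s hs) (a := a) (fun m => ?_)
      fun m hm => ha hm)
  · rw [or_iff_not_imp_right]
    intro h
    by_cases hi : i ∈ Set.range s
    · obtain ⟨m, rfl⟩ := hi
      rw [hds, abs_of_nonneg (ha0 m)]
      exact ha (not_lt.1 fun hm => h ⟨m, hm, rfl⟩)
    · rw [hdz i hi]
      simpa using ha0 n
  · rw [Function.comp_apply, apply_basis hT, hds]

theorem nonneg_of_diagonal (hd : ∀ i, 0 ≤ d i)
    (hT : ∀ x i, ⟪b i, T x⟫_ℂ = d i * ⟪b i, x⟫_ℂ) : 0 ≤ T := by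
  rw [ContinuousLinearMap.nonneg_iff_isPositive, ContinuousLinearMap.isPositive_iff_complex]
  intro x
  have h : ⟪T x, x⟫_ℂ = ((∑' i, d i * ‖⟪b i, x⟫_ℂ‖ ^ 2 : ℝ) : ℂ) := by
    rw [← b.tsum_inner_mul_inner, ofReal_tsum]
    refine tsum_congr fun i => ?_
    rw [← inner_conj_symm, hT, map_mul, conj_ofReal, mul_assoc, Complex.conj_mul']
    push_cast
    ring
  rw [h]
  exact ⟨by simp, by
    simpa using tsum_nonneg fun i => mul_nonneg (hd i) (sq_nonneg _)⟩

end SingularValues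

end Landau

namespace Landau

set_option linter.unusedSectionVars false

/-! ### Shifted harmonic sums are log N + O(1). -/

section HarmonicSums

theorem log_sub_log_le_sum (c : ℝ) (hc : 1 ≤ c) (N : ℕ) :
    Real.log (N + c) - Real.log c ≤ ∑ n ∈ Finset.range N, 1 / ((n : ℝ) + c) := by
  induction N with
  | zero => simp
  | succ N ih =>
    rw [Finset.sum_range_succ]
    have hN : (0 : ℝ) < N + c := by positivity
    have h : Real.log ((N + 1 : ℕ) + c) - Real.log (N + c) ≤ 1 / (N + c) := by
      rw [← Real.log_div (by positivity) hN.ne']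
      refine (Real.log_le_sub_one_of_pos (by positivity)).trans (le_of_eq ?_)
      push_cast
      field_simp
      ring
    linarith

/-- The 1 pays for the first term 1/c ≤ 1; each later term is at most the increment of the
logarithm, by 1 - 1/x ≤ log x. The induction therefore starts at sums with one term. -/
theorem sum_le_one_add_log (c : ℝ) (hc : 1 ≤ c) (N : ℕ) :
    ∑ n ∈ Finset.range N, 1 / ((n : ℝ) + c) ≤ 1 + Real.log (N + c) - Real.log c := by
  have key : ∀ N : ℕ, ∑ n ∈ Finset.range (N + 1), 1 / ((n : ℝ) + c) ≤
      1 + Real.log (N + c) - Real.log c := by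
    intro N
    induction N with
    | zero =>
      simp only [zero_add, Finset.range_one, Finset.sum_singleton, Nat.cast_zero]
      have : 1 / c ≤ 1 := (div_le_one (by positivity)).2 hc
      linarith
    | succ N ih =>
      rw [Finset.sum_range_succ]
      have hN : (0 : ℝ) < N + c := by positivity
      have h : 1 / (((N + 1 : ℕ) : ℝ) + c) ≤ Real.log ((N + 1 : ℕ) + c) - Real.log (N + c) := by
        rw [← Real.log_div (by positivity) hN.ne']
        refine le_trans (le_of_eq ?_) (Real.one_sub_inv_le_log_of_pos (by positivity))
        push_cast
        field_simp
        ring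
      linarith
  rcases N with _ | N
  · simp
  · refine (key N).trans ?_
    have : Real.log (N + c) ≤ Real.log ((N + 1 : ℕ) + c) :=
      Real.log_le_log (by positivity) (by push_cast; linarith)
    linarith

/-- The shift c costs only a constant, since N + c ≤ N(1 + c). So j and ξ cannot affect the limit.
-/
theorem abs_sum_sub_log_le (c : ℝ) (hc : 1 ≤ c) {N : ℕ} (hN : 1 ≤ N) :
    |∑ n ∈ Finset.range N, 1 / ((n : ℝ) + c) - Real.log N| ≤ 1 + Real.log (1 + c) := by
  have h1 := log_sub_log_le_sum c hc N
  have h2 := sum_le_one_add_log c hc N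
  have hN' : (1 : ℝ) ≤ N := by exact_mod_cast hN
  have h3 : Real.log N ≤ Real.log (N + c) := Real.log_le_log (by positivity) (by linarith)
  have h4 : Real.log (N + c) ≤ Real.log N + Real.log (1 + c) := by
    rw [← Real.log_mul (by positivity) (by positivity)]
    exact Real.log_le_log (by positivity) (by nlinarith)
  have h5 : Real.log c ≤ Real.log (1 + c) := Real.log_le_log (by positivity) (by linarith)
  have h6 := Real.log_nonneg hc
  rw [abs_le]
  constructor <;> linarith

theorem tendsto_sum_div_log (c : ℝ) (hc : 1 ≤ c) :
    Tendsto (fun N : ℕ => (∑ n ∈ Finset.range N, 1 / ((n : ℝ) + c)) / Real.log N) atTop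
      (𝓝 1) := by
  have hlog : Tendsto (fun N : ℕ => Real.log N) atTop atTop :=
    Real.tendsto_log_atTop.comp tendsto_natCast_atTop_atTop
  rw [tendsto_iff_norm_sub_tendsto_zero]
  refine squeeze_zero' (Eventually.of_forall fun _ => norm_nonneg _) ?_
    (hlog.const_div_atTop (1 + Real.log (1 + c)))
  filter_upwards [eventually_ge_atTop 1, hlog.eventually_gt_atTop 0] with N hN hpos
  rw [div_sub_one hpos.ne', norm_div, Real.norm_eq_abs, Real.norm_eq_abs, abs_of_pos hpos]
  gcongr
  exact abs_sum_sub_log_le c hc hN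

end HarmonicSums

/-! ### Cesàro means and the Dixmier trace of a harmonic spectrum. -/

section CesaroMean

/-- The Cesàro mean of a function that differs from the logarithm by a bounded amount. -/
theorem abs_integral_sub_log_le {σ : ℝ → ℝ} {lam K t : ℝ} (hlam : Real.exp 1 < lam)
    (hσ : MonotoneOn σ (Set.Ici lam)) (hK : ∀ s, lam ≤ s → |σ s - Real.log s| ≤ K)
    (ht : lam ≤ t) :
    IntervalIntegrable (fun s => σ s / Real.log s / s) volume lam t ∧
    |(∫ s in lam..t, σ s / Real.log s / s) - (Real.log t - Real.log lam)| ≤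
      K * (Real.log (Real.log t) - Real.log (Real.log lam)) := by
  have hpos : ∀ s ∈ Set.uIcc lam t, 0 < s ∧ 1 < Real.log s := by
    intro s hs
    rw [Set.uIcc_of_le ht] at hs
    have h1 : Real.exp 1 < s := hlam.trans_le hs.1
    exact ⟨(Real.exp_pos 1).trans h1, (Real.lt_log_iff_exp_lt ((Real.exp_pos 1).trans h1)).2 h1⟩
  have hcinv : ContinuousOn (fun s : ℝ => s⁻¹) (Set.uIcc lam t) :=
    continuousOn_id.inv₀ fun s hs => (hpos s hs).1.ne'
  have hclog : ContinuousOn (fun s : ℝ => (Real.log s)⁻¹) (Set.uIcc lam t) :=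
    (Real.continuousOn_log.mono fun s hs => (hpos s hs).1.ne').inv₀
      fun s hs => (zero_lt_one.trans (hpos s hs).2).ne'
  have hint : IntervalIntegrable (fun s => σ s / Real.log s / s) volume lam t := by
    -- Monotonicity of σ serves only to make it integrable.
    have h1 : IntervalIntegrable σ volume lam t := by
      refine MonotoneOn.intervalIntegrable (hσ.mono ?_)
      rw [Set.uIcc_of_le ht]
      exact Set.Icc_subset_Ici_self
    have h2 := (h1.mul_continuousOn hclog).mul_continuousOn hcinv
    exact h2.congr fun s _ => by simp only [div_eq_mul_inv]
  refine ⟨hint, ?_⟩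
  have hinv : IntervalIntegrable (fun s : ℝ => s⁻¹) volume lam t := hcinv.intervalIntegrable
  have hI1 : ∫ s in lam..t, s⁻¹ = Real.log t - Real.log lam :=
    intervalIntegral.integral_eq_sub_of_hasDerivAt
      (fun s hs => Real.hasDerivAt_log (hpos s hs).1.ne') hinv
  have hg : IntervalIntegrable (fun s : ℝ => K * ((Real.log s)⁻¹ * s⁻¹)) volume lam t :=
    ((hclog.mul hcinv).const_smul K).intervalIntegrable
  -- The derivative of log log s is 1/(s log s).
  have hI2 : ∫ s in lam..t, K * ((Real.log s)⁻¹ * s⁻¹) =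
      K * (Real.log (Real.log t) - Real.log (Real.log lam)) := by
    rw [intervalIntegral.integral_eq_sub_of_hasDerivAt
      (f := fun s => K * Real.log (Real.log s)) (fun s hs => ?_) hg]
    · ring
    · refine HasDerivAt.const_mul K ?_
      have := (Real.hasDerivAt_log (hpos s hs).1.ne').log
        (zero_lt_one.trans (hpos s hs).2).ne'
      rwa [div_eq_mul_inv, mul_comm] at this
  rw [← hI1, ← hI2, ← intervalIntegral.integral_sub hint hinv, ← Real.norm_eq_abs]
  refine intervalIntegral.norm_integral_le_of_norm_le ht ?_ hg
  refine Eventually.of_forall fun s hs => ?_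
  have hs' : s ∈ Set.uIcc lam t := by
    rw [Set.uIcc_of_le ht]
    exact Set.Ioc_subset_Icc_self hs
  obtain ⟨h1, h2⟩ := hpos s hs'
  have h3 : σ s / Real.log s / s - s⁻¹ = (σ s - Real.log s) * ((Real.log s)⁻¹ * s⁻¹) := by
    field_simp
  rw [h3, norm_mul, Real.norm_eq_abs, Real.norm_eq_abs, abs_of_pos (a := _ * _) (by positivity)]
  gcongr
  exact hK s hs.1.le

variable {H : Type*} [NormedAddCommGroup H] [InnerProductSpace ℂ H] [CompleteSpace H]

/-- If σ_s = log s + O(1), the integrand is 1/s + O(1/(s log s)), and the mean is 1 + O(log log t /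
log t). Its difference from the constant 1 vanishes at infinity, where every state is blind to it.
-/
theorem dixmierPos_eq_one {T : H →L[ℂ] H} {lam K : ℝ} (hlam : Real.exp 1 < lam)
    (hmono : MonotoneOn (sigmaFun T) (Set.Ici lam))
    (hK : ∀ s, lam ≤ s → |sigmaFun T s - Real.log s| ≤ K) (ω : StateAtInfinity lam) :
    dixmierPos ω T = 1 := by
  have hlog : ∀ t, lam ≤ t → 0 < t ∧ 1 < Real.log t := fun t ht => by
    have h1 : Real.exp 1 < t := hlam.trans_le ht
    exact ⟨(Real.exp_pos 1).trans h1, (Real.lt_log_iff_exp_lt ((Real.exp_pos 1).trans h1)).2 h1⟩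
  have hK0 : 0 ≤ K := (abs_nonneg _).trans (hK lam le_rfl)
  have hest : ∀ t, lam ≤ t →
      |cesaroMean lam T t - 1| ≤
        Real.log lam / Real.log t + K * (Real.log (Real.log t) / Real.log t) := by
    intro t ht
    obtain ⟨h1, h2⟩ := hlog t ht
    have h3 := (abs_integral_sub_log_le hlam hmono hK ht).2
    have h4 : 0 ≤ Real.log (Real.log lam) := Real.log_nonneg (hlog lam le_rfl).2.le
    have h5 : 0 < Real.log lam := zero_lt_one.trans (hlog lam le_rfl).2
    have h6 : cesaroMean lam T t - 1 =
        ((∫ s in lam..t, sigmaFun T s / Real.log s / s) - Real.log t) / Real.log t := by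
      rw [cesaroMean]
      have : Real.log t ≠ 0 := by positivity
      field_simp
    rw [h6, abs_div, abs_of_pos (zero_lt_one.trans h2), mul_div_assoc', ← add_div]
    gcongr
    rw [abs_le] at h3 ⊢
    -- The contribution of the lower limit can be dropped from the bound because lam > e makes log
    -- log lam positive.
    have : 0 ≤ K * Real.log (Real.log lam) := by positivity
    constructor <;> linarith [h3.1, h3.2]
  have hcont : Continuous fun t : Set.Ici lam => cesaroMean lam T t := by
    suffices h : ContinuousOn (cesaroMean lam T) (Set.Ici lam) from
      h.comp_continuous continuous_subtype_val fun t => t.2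
    refine ContinuousOn.mul ?_ ?_
    · refine continuousOn_const.div (Real.continuousOn_log.mono fun t ht => (hlog t ht).1.ne')
        fun t ht => (zero_lt_one.trans (hlog t ht).2).ne'
    -- Continuity of the primitive is available on compact intervals; [lam, t + 1] contains a
    -- neighbourhood of t in the half-line.
    · intro t ht
      have ht1 : lam ≤ t + 1 := (Set.mem_Ici.1 ht).trans (by linarith)
      have h1 := (abs_integral_sub_log_le hlam hmono hK ht1).1
      have h2 := intervalIntegral.continuousOn_primitive_interval
        ((intervalIntegrable_iff' (by simp)).1 h1) t (by
          rw [Set.uIcc_of_le ht1]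
          exact ⟨ht, by linarith⟩)
      refine h2.mono_of_mem_nhdsWithin ?_
      rw [Set.uIcc_of_le ht1, ← Set.Ici_inter_Iic]
      exact inter_mem self_mem_nhdsWithin
        (mem_nhdsWithin_of_mem_nhds (Iic_mem_nhds (by linarith)))
  have hbdd : ∀ t : Set.Ici lam, ‖((cesaroMean lam T t : ℝ) : ℂ)‖ ≤ 2 + K := by
    intro t
    obtain ⟨h1, h2⟩ := hlog t t.2
    have h3 := hest t t.2
    have h4 : Real.log lam / Real.log t ≤ 1 := by
      rw [div_le_one (by linarith)]
      exact Real.log_le_log (hlog lam le_rfl).1 t.2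
    have h5 : Real.log (Real.log t) / Real.log t ≤ 1 := by
      rw [div_le_one (by linarith)]
      linarith [Real.log_le_sub_one_of_pos (zero_lt_one.trans h2)]
    have h6 : K * (Real.log (Real.log t) / Real.log t) ≤ K * 1 := by gcongr
    rw [Complex.norm_real, Real.norm_eq_abs]
    rw [abs_le] at h3 ⊢
    constructor <;> linarith [h3.1, h3.2]
  -- Continuity and boundedness ensure that `cesaroBCF` is the actual Cesàro mean and not its
  -- default value 0.
  have hex : ∃ g : Set.Ici lam →ᵇ ℂ, ∀ t, g t = (cesaroMean lam T t : ℂ) :=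
    ⟨BoundedContinuousFunction.ofNormedAddCommGroup _ (continuous_ofReal.comp hcont) _ hbdd,
      fun t => rfl⟩
  have hg : ∀ t, cesaroBCF lam T t = (cesaroMean lam T t : ℂ) := by
    rw [cesaroBCF, dif_pos hex]
    exact hex.choose_spec
  have hlim : Tendsto (cesaroBCF lam T - 1 : Set.Ici lam →ᵇ ℂ) atTop (𝓝 0) := by
    have h1 : Tendsto (fun t : ℝ =>
        Real.log lam / Real.log t + K * (Real.log (Real.log t) / Real.log t)) atTop (𝓝 0) := by
      have h2 := Real.tendsto_log_atTop.const_div_atTop (Real.log lam)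
      have h3 := ((Real.isLittleO_log_id_atTop.tendsto_div_nhds_zero).comp
        Real.tendsto_log_atTop).const_mul K
      simpa using h2.add h3
    have h2 := tendsto_comp_val_Ici_atTop (a := lam) |>.2 h1
    refine squeeze_zero_norm (fun t => ?_) h2
    have h3 := hest t t.2
    rw [BoundedContinuousFunction.sub_apply, hg, BoundedContinuousFunction.coe_one, Pi.one_apply,
      ← ofReal_one, ← ofReal_sub, Complex.norm_real]
    exact h3
  have h0 := ω.vanish _ hlim
  rw [map_sub, ω.map_one, sub_eq_zero] at h0
  exact h0

/-- For positive T the negative part of Re T and both parts of Im T are zero; this disposes of their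
terms in `dixmierTrace`. -/
theorem dixmierPos_zero (hH : ∃ e : ℕ → H, Orthonormal ℂ e) {lam : ℝ} (hlam : 0 ≤ lam)
    (ω : StateAtInfinity lam) : dixmierPos ω (0 : H →L[ℂ] H) = 0 := by
  obtain ⟨e, he⟩ := hH
  have hσ : ∀ s, 0 ≤ s → sigmaFun (0 : H →L[ℂ] H) s = 0 := fun s hs => by
    have h0 : traceNorm (0 : H →L[ℂ] H) ≤ ENNReal.ofReal 0 := by
      refine le_of_eq ?_
      rw [ENNReal.ofReal_zero]
      refine ENNReal.tsum_eq_zero.2 fun n => ENNReal.ofReal_eq_zero.2 ?_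
      obtain ⟨V, hV, hVn, -⟩ := exists_finrank_eq he n
      exact singularValue_le V hVn le_rfl (by simp)
    refine le_antisymm ?_ ENNReal.toReal_nonneg
    simpa using sigmaFun_le (T := 0) isCompactOperator_zero isCompactOperator_zero (zero_add 0)
      hs le_rfl h0
  have hc : ∀ t : Set.Ici lam, cesaroMean lam (0 : H →L[ℂ] H) t = 0 := fun t => by
    rw [cesaroMean, intervalIntegral.integral_congr (g := fun _ => 0)]
    · simp
    · intro s hs
      rw [Set.uIcc_of_le t.2] at hs
      simp [hσ s (hlam.trans hs.1)]
  have hex : ∃ g : Set.Ici lam →ᵇ ℂ, ∀ t, g t = (cesaroMean lam (0 : H →L[ℂ] H) t : ℂ) :=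
    ⟨0, fun t => by simp [hc]⟩
  have hg : cesaroBCF lam (0 : H →L[ℂ] H) = 0 := by
    ext t
    rw [cesaroBCF, dif_pos hex, hex.choose_spec, hc]
    simp
  rw [dixmierPos, hg, map_zero]

theorem dixmierTrace_of_nonneg (hH : ∃ e : ℕ → H, Orthonormal ℂ e) {lam : ℝ} (hlam : 0 ≤ lam)
    (ω : StateAtInfinity lam) {T : H →L[ℂ] H} (hT : 0 ≤ T) :
    dixmierTrace ω T = dixmierPos ω T := by
  have hsa : IsSelfAdjoint T := IsSelfAdjoint.of_nonneg hT
  have h1 : (T : H →L[ℂ] H)⁺ = T := (CFC.posPart_eq_self T).2 hT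
  have h2 : (T : H →L[ℂ] H)⁻ = 0 := (CFC.negPart_eq_zero_iff T hsa).2 hT
  rw [dixmierTrace, hsa.coe_realPart, hsa.imaginaryPart, h1, h2]
  simp [dixmierPos_zero hH hlam ω]

variable {ι : Type*} {b : HilbertBasis ι ℂ H} {s : ℕ → ι} {T : H →L[ℂ] H} {d : ι → ℝ}

/-- The singular values are 1/(m + c), so γ_N is a harmonic sum over log N. For σ_t, cut at N = ⌊t⌋:
the sum of the first N singular values bounds σ_t from below, and the splitting into the truncation
of rank N and the rest exceeds that sum by t‖T - R‖ ≤ t/(N + c) ≤ 1. -/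
theorem dixmier_of_diagonal (hs : Function.Injective s)
    (hT : ∀ x i, ⟪b i, T x⟫_ℂ = d i * ⟪b i, x⟫_ℂ) {c : ℝ} (hc : 1 ≤ c)
    (hds : ∀ m, d (s m) = 1 / ((m : ℝ) + c)) (hdz : ∀ i, i ∉ Set.range s → d i = 0) :
    IsDixmierMeasurable T ∧
      ∀ lam : ℝ, Real.exp 1 < lam → ∀ ω : StateAtInfinity lam, dixmierTrace ω T = 1 := by
  have ha : Antitone fun m : ℕ => 1 / ((m : ℝ) + c) := fun m n hmn => by
    have : (m : ℝ) ≤ n := by exact_mod_cast hmn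
    simp only
    gcongr
  have ha0 : ∀ m : ℕ, 0 ≤ 1 / ((m : ℝ) + c) := fun m => by positivity
  have hlim : Tendsto (fun m : ℕ => 1 / ((m : ℝ) + c)) atTop (𝓝 0) :=
    (tendsto_atTop_add_const_right _ c tendsto_natCast_atTop_atTop).const_div_atTop 1
  have hcomp := isCompactOperator_of_diagonal hs ha ha0 hlim hT hds hdz
  have hsv := singularValue_eq_of_diagonal hs ha ha0 hT hds hdz
  have hon : Orthonormal ℂ (b ∘ s) := b.orthonormal.comp s hs
  have hγ : Tendsto (gammaSeq T) atTop (𝓝 1) := by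
    have : gammaSeq T = fun N : ℕ =>
        (∑ n ∈ Finset.range N, 1 / ((n : ℝ) + c)) / Real.log N := by
      funext N
      rw [gammaSeq, Finset.sum_congr rfl fun n _ => hsv n]
    rw [this]
    exact tendsto_sum_div_log c hc
  refine ⟨⟨⟨hcomp, ?_⟩, 1, hγ⟩, fun lam hlam ω => ?_⟩
  · obtain ⟨C, hC⟩ := hγ.bddAbove_range
    exact ⟨C, fun N _ => hC ⟨N, rfl⟩⟩
  · have hlam0 : 1 ≤ lam := (Real.one_le_exp zero_le_one).trans hlam.le
    have hd : ∀ i, 0 ≤ d i := fun i => by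
      by_cases hi : i ∈ Set.range s
      · obtain ⟨m, rfl⟩ := hi
        rw [hds]
        exact ha0 m
      · rw [hdz i hi]
    rw [dixmierTrace_of_nonneg ⟨_, hon⟩ (by linarith) ω (nonneg_of_diagonal hd hT)]
    -- The constant covers the error 1 + log(1 + c) of the harmonic sum, the remainder t‖T - R‖ ≤ 1
    -- and the difference log t - log ⌊t⌋ ≤ 1.
    refine dixmierPos_eq_one (K := 3 + Real.log (1 + c)) hlam
      (fun x _ y _ hxy => sigmaFun_mono hcomp hon hxy) (fun t ht => ?_) ω
    have ht1 : 1 ≤ t := hlam0.trans ht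
    have hN1 : 1 ≤ ⌊t⌋₊ := Nat.one_le_floor_iff t |>.2 ht1
    have hNt : (⌊t⌋₊ : ℝ) ≤ t := Nat.floor_le (by linarith)
    have hNt' : t < ⌊t⌋₊ + 1 := Nat.lt_floor_add_one t
    have hN1' : (1 : ℝ) ≤ ⌊t⌋₊ := by exact_mod_cast hN1
    have hlow := sum_singularValue_le_sigmaFun hon hcomp hNt
    simp only [hsv] at hlow
    obtain ⟨R, hR, hRt, hRn⟩ := exists_truncation hs ha ha0 hT hds hdz ⌊t⌋₊
    have hup := sigmaFun_le (T := T) hR (S := T - R) (hcomp.sub hR) (by abel) (s := t) (by linarith)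
      (Finset.sum_nonneg fun n _ => ha0 n) hRt
    have h1 : t * ‖T - R‖ ≤ 1 := by
      calc t * ‖T - R‖ ≤ t * (1 / (⌊t⌋₊ + c)) := by gcongr
        _ ≤ 1 := by
          rw [mul_one_div, div_le_one (by positivity)]
          linarith
    have h2 := abs_le.1 (abs_sum_sub_log_le c hc hN1)
    have h3 : Real.log ⌊t⌋₊ ≤ Real.log t := Real.log_le_log (by linarith) hNt
    have h4 : Real.log t ≤ Real.log ⌊t⌋₊ + 1 := by
      have : Real.log t - Real.log ⌊t⌋₊ ≤ 1 := by
        rw [← Real.log_div (by linarith) (by linarith)]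
        refine (Real.log_le_sub_one_of_pos (by positivity)).trans ?_
        rw [sub_le_iff_le_add, div_le_iff₀ (by linarith)]
        linarith
      linarith
    rw [abs_le]
    constructor <;> linarith [h2.1, h2.2]

end CesaroMean

end Landau

namespace Landau

/-! ### Ladder operators of a canonical pair. -/

section Ladder

variable {V H : Type*} [AddCommGroup V] [Module ℂ V] [NormedAddCommGroup H]
  [InnerProductSpace ℂ H]

/-- A pair of symmetric operators with the canonical commutation relation `[P, X] = -i`. -/
structure IsCanonicalPair (J : V →ₗ[ℂ] H) (P X : Module.End ℂ V) : Prop where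
  symmP : ∀ u v, ⟪J (P u), J v⟫_ℂ = ⟪J u, J (P v)⟫_ℂ
  symmX : ∀ u v, ⟪J (X u), J v⟫_ℂ = ⟪J u, J (X v)⟫_ℂ
  comm : ∀ u, P (X u) = X (P u) - I • u

/-- The raising operator. -/
def raising (P X : Module.End ℂ V) : Module.End ℂ V := X - I • P

/-- The lowering operator. -/
def lowering (P X : Module.End ℂ V) : Module.End ℂ V := X + I • P

/-- The quadratic operator `P² + X²`. -/
def quadratic (P X : Module.End ℂ V) : Module.End ℂ V := P * P + X * X

theorem inner_eq_zero_of_eigenvalue_ne {J : V →ₗ[ℂ] H} {N : Module.End ℂ V}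
    (hN : ∀ u v, ⟪J (N u), J v⟫_ℂ = ⟪J u, J (N v)⟫_ℂ) {u v : V} {α β : ℝ}
    (hu : N u = (α : ℂ) • u) (hv : N v = (β : ℂ) • v) (h : α ≠ β) : ⟪J u, J v⟫_ℂ = 0 := by
  have h1 := hN u v
  rw [hu, hv, map_smul, map_smul, inner_smul_left, inner_smul_right, conj_ofReal] at h1
  have h2 : ((α : ℂ) - β) * ⟪J u, J v⟫_ℂ = 0 := by rw [sub_mul, h1, sub_self]
  exact (mul_eq_zero.1 h2).resolve_left (sub_ne_zero.2 (by exact_mod_cast h))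

namespace IsCanonicalPair

variable {J : V →ₗ[ℂ] H} {P X : Module.End ℂ V} (h : IsCanonicalPair J P X)

theorem symm_quadratic (h : IsCanonicalPair J P X) (u v : V) :
    ⟪J (quadratic P X u), J v⟫_ℂ = ⟪J u, J (quadratic P X v)⟫_ℂ := by
  simp only [quadratic, LinearMap.add_apply, Module.End.mul_apply, map_add, inner_add_left,
    inner_add_right, h.symmP, h.symmX]

theorem inner_raising (h : IsCanonicalPair J P X) (u v : V) :
    ⟪J (raising P X u), J v⟫_ℂ = ⟪J u, J (lowering P X v)⟫_ℂ := by
  simp only [raising, lowering, LinearMap.add_apply, LinearMap.sub_apply, LinearMap.smul_apply,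
    map_add, map_sub, map_smul, inner_add_right, inner_sub_left, inner_smul_left,
    inner_smul_right, h.symmP, h.symmX, conj_I]
  ring

theorem lowering_raising (h : IsCanonicalPair J P X) (u : V) :
    lowering P X (raising P X u) = quadratic P X u + u := by
  simp only [raising, lowering, quadratic, LinearMap.add_apply, LinearMap.sub_apply,
    LinearMap.smul_apply, map_sub, map_smul, h.comm, Module.End.mul_apply, smul_sub, smul_smul]
  match_scalars <;> ring_nf <;> simp

theorem raising_lowering (h : IsCanonicalPair J P X) (u : V) :
    raising P X (lowering P X u) = quadratic P X u - u := by
  simp only [raising, lowering, quadratic, LinearMap.add_apply, LinearMap.sub_apply,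
    LinearMap.smul_apply, map_add, map_smul, h.comm, Module.End.mul_apply, smul_sub,
    smul_smul, I_mul_I]
  module

/-- Comparing the two factorizations on R L R, with R raising and L lowering: R(LR) = R(Q + 1),
while (RL)R = (Q - 1)R. -/
theorem quadratic_raising (h : IsCanonicalPair J P X) (u : V) :
    quadratic P X (raising P X u) = raising P X (quadratic P X u) + (2 : ℂ) • raising P X u := by
  have h1 := h.raising_lowering (raising P X u)
  rw [h.lowering_raising, map_add] at h1
  rw [eq_add_of_sub_eq h1.symm]
  module

variable {Ω : V}

theorem quadratic_raising_pow (h : IsCanonicalPair J P X) (hΩ : lowering P X Ω = 0) (n : ℕ) :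
    quadratic P X ((raising P X ^ n) Ω) = ((2 * n + 1 : ℝ) : ℂ) • (raising P X ^ n) Ω := by
  induction n with
  | zero =>
    have h1 := h.raising_lowering Ω
    rw [hΩ, map_zero] at h1
    simp [sub_eq_zero.1 h1.symm]
  | succ n ih =>
    rw [pow_succ', Module.End.mul_apply, h.quadratic_raising, ih, map_smul, ← add_smul]
    congr 1
    push_cast
    ring

/-- The truncated index n - 1 is harmless at n = 0, where the factor 2n vanishes. -/
theorem lowering_raising_pow (h : IsCanonicalPair J P X) (hΩ : lowering P X Ω = 0) (n : ℕ) :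
    lowering P X ((raising P X ^ n) Ω) = (2 * n : ℂ) • (raising P X ^ (n - 1)) Ω := by
  rcases n with _ | n
  · simpa using hΩ
  · rw [pow_succ', Module.End.mul_apply, h.lowering_raising, h.quadratic_raising_pow hΩ,
      Nat.add_sub_cancel]
    push_cast
    module

/-- The norms satisfy ‖RⁿΩ‖² = 2n‖Rⁿ⁻¹Ω‖². -/
theorem raising_pow_ne_zero (h : IsCanonicalPair J P X) (hΩ : lowering P X Ω = 0)
    (hJ : J Ω ≠ 0) (n : ℕ) : J ((raising P X ^ n) Ω) ≠ 0 := by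
  induction n with
  | zero => simpa using hJ
  | succ n ih =>
    intro h0
    have h1 := h.inner_raising ((raising P X ^ n) Ω) ((raising P X ^ (n + 1)) Ω)
    rw [h0, h.lowering_raising_pow hΩ, map_smul, inner_smul_right, Nat.add_sub_cancel,
      inner_zero_right, eq_comm, mul_eq_zero, inner_self_eq_zero] at h1
    rcases h1 with h1 | h1
    · rw [← Nat.cast_ofNat, ← Nat.cast_mul, Nat.cast_eq_zero] at h1
      omega
    · exact ih h1

theorem apply_eq_half (P X : Module.End ℂ V) (u : V) :
    X u = (2⁻¹ : ℂ) • (raising P X u + lowering P X u) := by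
  simp only [raising, lowering, LinearMap.add_apply, LinearMap.sub_apply, LinearMap.smul_apply]
  module

theorem apply_eq_half' (P X : Module.End ℂ V) (u : V) :
    P u = (2⁻¹ * I : ℂ) • (raising P X u - lowering P X u) := by
  simp only [raising, lowering, LinearMap.add_apply, LinearMap.sub_apply, LinearMap.smul_apply]
  have : (2⁻¹ * I : ℂ) • (X u - I • P u - (X u + I • P u)) = (-(I * I)) • P u := by module
  rw [this]
  simp

/-- X is half the sum of raising and lowering, and both preserve the span. A vector orthogonal to
all eigenvectors is thus orthogonal to all XⁿΩ, which turns completeness into a moment problem. -/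
theorem pow_mem_span (h : IsCanonicalPair J P X) (hΩ : lowering P X Ω = 0) (n : ℕ) :
    (X ^ n) Ω ∈ Submodule.span ℂ (Set.range fun n : ℕ => (raising P X ^ n) Ω) := by
  set W := Submodule.span ℂ (Set.range fun n : ℕ => (raising P X ^ n) Ω)
  have hX : W ≤ W.comap X := by
    refine Submodule.span_le.2 ?_
    rintro _ ⟨n, rfl⟩
    change X _ ∈ W
    rw [apply_eq_half P X, h.lowering_raising_pow hΩ]
    refine W.smul_mem _ (W.add_mem ?_ (W.smul_mem _ (Submodule.subset_span ⟨n - 1, rfl⟩)))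
    exact Submodule.subset_span ⟨n + 1, by simp only [pow_succ', Module.End.mul_apply]⟩
  induction n with
  | zero => exact Submodule.subset_span ⟨0, rfl⟩
  | succ n ih =>
    rw [pow_succ', Module.End.mul_apply]
    exact hX ih

end IsCanonicalPair

end Ladder

/-! ### Determinacy of the moment problem under exponential decay. -/

section Moments

variable {S W : Type*} [MeasurableSpace S] {μ : Measure S} [NormedAddCommGroup W]
  [NormedSpace ℝ W] [CompleteSpace W] [SecondCountableTopology W] [MeasurableSpace W]
  [BorelSpace W] {τ : S → W}

/-- The exponential series may be integrated term by term, with ‖F‖ e^|ℓ| as the sum of the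
dominating series. -/
theorem integral_mul_exp_eq_zero {F : S → ℂ} {ℓ : S → ℝ} (hℓ : AEStronglyMeasurable ℓ μ)
    (hF : AEStronglyMeasurable F μ) (hint : Integrable (fun x => ‖F x‖ * Real.exp |ℓ x|) μ)
    (h0 : ∀ n : ℕ, ∫ x, F x * (ℓ x : ℂ) ^ n ∂μ = 0) : ∫ x, F x * exp (ℓ x * I) ∂μ = 0 := by
  have hsum : HasSum (fun n : ℕ => ∫ x, F x * ((ℓ x * I) ^ n / n.factorial) ∂μ)
      (∫ x, F x * exp (ℓ x * I) ∂μ) := by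
    refine hasSum_integral_of_dominated_convergence
      (fun n x => ‖F x‖ * (|ℓ x| ^ n / n.factorial)) (fun n => ?_) (fun n => ?_) ?_ ?_ ?_
    · refine hF.mul ?_
      exact (Continuous.comp_aestronglyMeasurable
        (by fun_prop : Continuous fun t : ℝ => ((t : ℂ) * I) ^ n / n.factorial) hℓ)
    · refine Eventually.of_forall fun x => le_of_eq ?_
      simp
    · exact Eventually.of_forall fun x => (Real.summable_pow_div_factorial _).mul_left _
    · refine hint.congr (Eventually.of_forall fun x => ?_)
      simp only
      rw [tsum_mul_left, Real.exp_eq_exp_ℝ, NormedSpace.exp_eq_tsum_div]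
    · refine Eventually.of_forall fun x => HasSum.mul_left _ ?_
      rw [Complex.exp_eq_exp_ℂ]
      exact NormedSpace.expSeries_div_hasSum_exp _
  rw [← hsum.tsum_eq]
  convert tsum_zero with n
  have : ∀ x, F x * ((ℓ x * I) ^ n / n.factorial) =
      (I ^ n / n.factorial) * (F x * (ℓ x : ℂ) ^ n) := fun x => by
    rw [mul_pow]
    ring
  simp_rw [this]
  rw [integral_const_mul, h0, mul_zero]

/-- The images under τ of the measures with densities f⁺ and f⁻ have the same characteristic
function, hence coincide. -/
theorem setIntegral_eq_zero_of_integral_exp_eq_zero (hτ : Measurable τ) {f : S → ℝ}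
    (hf : Integrable f μ)
    (h0 : ∀ Λ : StrongDual ℝ W, ∫ x, (f x : ℂ) * exp (Λ (τ x) * I) ∂μ = 0) {s : Set W}
    (hs : MeasurableSet s) : ∫ x in τ ⁻¹' s, f x ∂μ = 0 := by
  let ν (g : S → ℝ) : Measure W := (μ.withDensity fun x => ENNReal.ofReal (g x)).map τ
  have hfin : ∀ g : S → ℝ, Integrable g μ → IsFiniteMeasure (ν g) := fun g hg => by
    have := isFiniteMeasure_withDensity_ofReal hg.2
    exact inferInstanceAs (IsFiniteMeasure (Measure.map _ _))
  have h1 := hfin _ hf.pos_part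
  have h2 := hfin _ hf.neg_part
  have hchar : ∀ g : S → ℝ, Integrable g μ → (∀ x, 0 ≤ g x) → ∀ Λ : StrongDual ℝ W,
      charFunDual (ν g) Λ = ∫ x, (g x : ℂ) * exp (Λ (τ x) * I) ∂μ := by
    intro g hg hg0 Λ
    rw [charFunDual_apply, integral_map hτ.aemeasurable (by fun_prop),
      integral_withDensity_eq_integral_toReal_smul₀ hg.1.aemeasurable.ennreal_ofReal
        (Eventually.of_forall fun _ => ENNReal.ofReal_lt_top)]
    refine integral_congr_ae (Eventually.of_forall fun x => ?_)
    simp only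
    rw [ENNReal.toReal_ofReal (hg0 x), real_smul]
  have hexp : ∀ (g : S → ℝ), Integrable g μ → ∀ Λ : StrongDual ℝ W,
      Integrable (fun x => (g x : ℂ) * exp (Λ (τ x) * I)) μ := by
    intro g hg Λ
    refine hg.ofReal.mul_bdd (c := 1) ?_ (Eventually.of_forall fun x => ?_)
    · exact (Continuous.measurable (by fun_prop : Continuous fun w : W =>
        exp (Λ w * I))).comp hτ |>.aestronglyMeasurable
    · rw [Complex.norm_exp_ofReal_mul_I]
  have heq : ν (fun x => max (f x) 0) = ν (fun x => max (-f x) 0) := by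
    refine Measure.ext_of_charFunDual ?_
    ext Λ
    rw [hchar _ hf.pos_part (fun x => le_max_right _ _),
      hchar _ hf.neg_part (fun x => le_max_right _ _), ← sub_eq_zero,
      ← integral_sub (hexp _ hf.pos_part Λ) (hexp _ hf.neg_part Λ), ← h0 Λ]
    refine integral_congr_ae (Eventually.of_forall fun x => ?_)
    simp only
    rw [← sub_mul, ← ofReal_sub, max_zero_sub_max_neg_zero_eq_self]
  have hval : ∀ g : S → ℝ, Integrable g μ → (∀ x, 0 ≤ g x) →
      ν g s = ENNReal.ofReal (∫ x in τ ⁻¹' s, g x ∂μ) := by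
    intro g hg hg0
    rw [Measure.map_apply hτ hs, withDensity_apply _ (hτ hs),
      ofReal_integral_eq_lintegral_ofReal hg.integrableOn (Eventually.of_forall hg0)]
  have hnn : ∀ g : S → ℝ, 0 ≤ ∫ x in τ ⁻¹' s, max (g x) 0 ∂μ := fun g =>
    integral_nonneg fun x => le_max_right _ _
  have h3 := congrArg (fun m : Measure W => m s) heq
  beta_reduce at h3
  rw [hval _ hf.pos_part (fun x => le_max_right _ _),
    hval _ hf.neg_part (fun x => le_max_right _ _),
    ENNReal.ofReal_eq_ofReal_iff (hnn f) (hnn fun x => -f x), ← sub_eq_zero,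
    ← integral_sub hf.pos_part.integrableOn hf.neg_part.integrableOn] at h3
  rw [← h3]
  refine integral_congr_ae (Eventually.of_forall fun x => ?_)
  exact (max_zero_sub_max_neg_zero_eq_self _).symm

/-- A function with exponential decay all of whose moments vanish. -/
theorem setIntegral_eq_zero_of_moments (hτ : Measurable τ) {F : S → ℂ}
    (hF : AEStronglyMeasurable F μ)
    (hint : ∀ Λ : StrongDual ℝ W, Integrable (fun x => ‖F x‖ * Real.exp |Λ (τ x)|) μ)
    (h0 : ∀ (Λ : StrongDual ℝ W) (n : ℕ), ∫ x, F x * (Λ (τ x) : ℂ) ^ n ∂μ = 0) {s : Set W}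
    (hs : MeasurableSet s) : ∫ x in τ ⁻¹' s, F x ∂μ = 0 := by
  have hmeas : ∀ Λ : StrongDual ℝ W, AEStronglyMeasurable (fun x => Λ (τ x)) μ := fun Λ =>
    (Λ.continuous.measurable.comp hτ).aestronglyMeasurable
  have hFint : Integrable F μ := by
    have := hint 0
    simp only [zero_apply, abs_zero, Real.exp_zero, mul_one] at this
    exact (integrable_norm_iff hF).1 this
  have hexp : ∀ Λ : StrongDual ℝ W, Integrable (fun x => F x * exp (Λ (τ x) * I)) μ := by
    intro Λ
    refine hFint.mul_bdd (c := 1) ?_ (Eventually.of_forall fun x => ?_)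
    · exact (Continuous.measurable (by fun_prop : Continuous fun w : W =>
        exp (Λ w * I))).comp hτ |>.aestronglyMeasurable
    · rw [Complex.norm_exp_ofReal_mul_I]
  have h1 : ∀ Λ : StrongDual ℝ W, ∫ x, F x * exp (Λ (τ x) * I) ∂μ = 0 := fun Λ =>
    integral_mul_exp_eq_zero (hmeas Λ) hF (hint Λ) (h0 Λ)
  -- Conjugating the identity for -Λ gives the one for the conjugate of F; together they yield the
  -- real and imaginary parts separately.
  have h2 : ∀ Λ : StrongDual ℝ W, ∫ x, (starRingEnd ℂ) (F x) * exp (Λ (τ x) * I) ∂μ = 0 := by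
    intro Λ
    have h3 := congrArg (starRingEnd ℂ) (h1 (-Λ))
    rw [map_zero, ← integral_conj] at h3
    rw [← h3]
    refine integral_congr_ae (Eventually.of_forall fun x => ?_)
    simp [← exp_conj]
  have hcexp : ∀ Λ : StrongDual ℝ W,
      Integrable (fun x => (starRingEnd ℂ) (F x) * exp (Λ (τ x) * I)) μ := by
    intro Λ
    refine Integrable.mul_bdd (c := 1) ?_ ?_ (Eventually.of_forall fun x => ?_)
    · exact (conjCLE.toContinuousLinearMap.integrable_comp hFint)
    · exact (Continuous.measurable (by fun_prop : Continuous fun w : W =>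
        exp (Λ w * I))).comp hτ |>.aestronglyMeasurable
    · rw [Complex.norm_exp_ofReal_mul_I]
  have hre : ∫ x in τ ⁻¹' s, (F x).re ∂μ = 0 := by
    refine setIntegral_eq_zero_of_integral_exp_eq_zero (f := fun x => (F x).re) hτ hFint.re (fun Λ => ?_) hs
    have h3 := integral_add (hexp Λ) (hcexp Λ)
    rw [h1, h2, add_zero] at h3
    have h4 : ∀ x, ((F x).re : ℂ) * exp (Λ (τ x) * I) =
        2⁻¹ * (F x * exp (Λ (τ x) * I) + (starRingEnd ℂ) (F x) * exp (Λ (τ x) * I)) := fun x => by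
      rw [← add_mul, Complex.add_conj]
      push_cast
      ring
    simp_rw [h4]
    rw [integral_const_mul, h3, mul_zero]
  have him : ∫ x in τ ⁻¹' s, (F x).im ∂μ = 0 := by
    refine setIntegral_eq_zero_of_integral_exp_eq_zero (f := fun x => (F x).im) hτ hFint.im (fun Λ => ?_) hs
    have h3 := integral_sub (hexp Λ) (hcexp Λ)
    rw [h1, h2, sub_zero] at h3
    have h4 : ∀ x, ((F x).im : ℂ) * exp (Λ (τ x) * I) = (2 * I)⁻¹ *
        (F x * exp (Λ (τ x) * I) - (starRingEnd ℂ) (F x) * exp (Λ (τ x) * I)) := fun x => by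
      rw [← sub_mul, Complex.sub_conj]
      field_simp
      push_cast
      ring
    simp_rw [h4]
    rw [integral_const_mul, h3, mul_zero]
  rw [← integral_re_add_im hFint.integrableOn]
  simp only [RCLike.re_to_complex, RCLike.im_to_complex]
  rw [hre, him]
  simp

end Moments

end Landau

namespace Landau

/-! ### Partial derivatives, commutation relations and symmetry of the momenta. -/

section Calculus

local notation "conj" => starRingEnd ℂ

variable {f g : ℝ × ℝ → ℂ} {x : ℝ × ℝ}

theorem _root_.HasFDerivAt.d1 {f' : ℝ × ℝ →L[ℝ] ℂ} (h : HasFDerivAt f f' x) :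
    Landau.d1 f x = f' (1, 0) := by rw [Landau.d1, h.fderiv]

theorem _root_.HasFDerivAt.d2 {f' : ℝ × ℝ →L[ℝ] ℂ} (h : HasFDerivAt f f' x) :
    Landau.d2 f x = f' (0, 1) := by rw [Landau.d2, h.fderiv]

theorem d1_add (hf : DifferentiableAt ℝ f x) (hg : DifferentiableAt ℝ g x) :
    d1 (fun y => f y + g y) x = d1 f x + d1 g x :=
  (hf.hasFDerivAt.add hg.hasFDerivAt).d1

theorem d2_add (hf : DifferentiableAt ℝ f x) (hg : DifferentiableAt ℝ g x) :
    d2 (fun y => f y + g y) x = d2 f x + d2 g x :=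
  (hf.hasFDerivAt.add hg.hasFDerivAt).d2

theorem d1_sub (hf : DifferentiableAt ℝ f x) (hg : DifferentiableAt ℝ g x) :
    d1 (fun y => f y - g y) x = d1 f x - d1 g x :=
  (hf.hasFDerivAt.sub hg.hasFDerivAt).d1

theorem d2_sub (hf : DifferentiableAt ℝ f x) (hg : DifferentiableAt ℝ g x) :
    d2 (fun y => f y - g y) x = d2 f x - d2 g x :=
  (hf.hasFDerivAt.sub hg.hasFDerivAt).d2

theorem d1_mul (hf : DifferentiableAt ℝ f x) (hg : DifferentiableAt ℝ g x) :
    d1 (fun y => f y * g y) x = d1 f x * g x + f x * d1 g x := by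
  have h : d1 (fun y => f y * g y) x = _ := (hf.hasFDerivAt.mul hg.hasFDerivAt).d1
  rw [h]
  simp [d1]
  ring

theorem d2_mul (hf : DifferentiableAt ℝ f x) (hg : DifferentiableAt ℝ g x) :
    d2 (fun y => f y * g y) x = d2 f x * g x + f x * d2 g x := by
  have h : d2 (fun y => f y * g y) x = _ := (hf.hasFDerivAt.mul hg.hasFDerivAt).d2
  rw [h]
  simp [d2]
  ring

theorem d1_const (c : ℂ) : d1 (fun _ => c) x = 0 := by simp [d1]

theorem d2_const (c : ℂ) : d2 (fun _ => c) x = 0 := by simp [d2]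

theorem d1_cexp (hf : DifferentiableAt ℝ f x) :
    d1 (fun y => exp (f y)) x = exp (f x) * d1 f x := by
  rw [hf.hasFDerivAt.cexp.d1]
  simp [d1]

theorem d2_cexp (hf : DifferentiableAt ℝ f x) :
    d2 (fun y => exp (f y)) x = exp (f x) * d2 f x := by
  rw [hf.hasFDerivAt.cexp.d2]
  simp [d2]

theorem hasFDerivAt_ofReal_fst : HasFDerivAt (fun y : ℝ × ℝ => (y.1 : ℂ))
    (ofRealCLM ∘L ContinuousLinearMap.fst ℝ ℝ ℝ) x :=
  (ofRealCLM ∘L ContinuousLinearMap.fst ℝ ℝ ℝ).hasFDerivAt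

theorem hasFDerivAt_ofReal_snd : HasFDerivAt (fun y : ℝ × ℝ => (y.2 : ℂ))
    (ofRealCLM ∘L ContinuousLinearMap.snd ℝ ℝ ℝ) x :=
  (ofRealCLM ∘L ContinuousLinearMap.snd ℝ ℝ ℝ).hasFDerivAt

theorem d1_fst : d1 (fun y => (y.1 : ℂ)) x = 1 := by
  rw [hasFDerivAt_ofReal_fst.d1]; simp

theorem d1_snd : d1 (fun y => (y.2 : ℂ)) x = 0 := by
  rw [hasFDerivAt_ofReal_snd.d1]; simp

theorem d2_fst : d2 (fun y => (y.1 : ℂ)) x = 0 := by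
  rw [hasFDerivAt_ofReal_fst.d2]; simp

theorem d2_snd : d2 (fun y => (y.2 : ℂ)) x = 1 := by
  rw [hasFDerivAt_ofReal_snd.d2]; simp

theorem differentiable_ofReal_fst : Differentiable ℝ (fun y : ℝ × ℝ => (y.1 : ℂ)) :=
  fun _ => hasFDerivAt_ofReal_fst.differentiableAt

theorem differentiable_ofReal_snd : Differentiable ℝ (fun y : ℝ × ℝ => (y.2 : ℂ)) :=
  fun _ => hasFDerivAt_ofReal_snd.differentiableAt

theorem contDiff_ofReal_fst {n : ℕ∞} : ContDiff ℝ n (fun y : ℝ × ℝ => (y.1 : ℂ)) :=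
  (ofRealCLM ∘L ContinuousLinearMap.fst ℝ ℝ ℝ).contDiff

theorem contDiff_ofReal_snd {n : ℕ∞} : ContDiff ℝ n (fun y : ℝ × ℝ => (y.2 : ℂ)) :=
  (ofRealCLM ∘L ContinuousLinearMap.snd ℝ ℝ ℝ).contDiff

theorem contDiff_d1 (hf : ContDiff ℝ (⊤ : ℕ∞) f) : ContDiff ℝ (⊤ : ℕ∞) (d1 f) :=
  (hf.fderiv_right (m := (⊤ : ℕ∞)) le_rfl).clm_apply contDiff_const

theorem contDiff_d2 (hf : ContDiff ℝ (⊤ : ℕ∞) f) : ContDiff ℝ (⊤ : ℕ∞) (d2 f) :=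
  (hf.fderiv_right (m := (⊤ : ℕ∞)) le_rfl).clm_apply contDiff_const

theorem d1_d2_comm (hf : ContDiff ℝ (⊤ : ℕ∞) f) : d1 (d2 f) x = d2 (d1 f) x := by
  have hd : Differentiable ℝ (fderiv ℝ f) :=
    (hf.fderiv_right (m := (⊤ : ℕ∞)) le_rfl).differentiable (by simp)
  have h : ∀ v w : ℝ × ℝ, fderiv ℝ (fun y => fderiv ℝ f y v) x w = fderiv ℝ (fderiv ℝ f) x w v := by
    intro v w
    rw [((hd x).hasFDerivAt.clm_apply (hasFDerivAt_const v x)).fderiv]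
    simp
  change fderiv ℝ (fun y => fderiv ℝ f y (0, 1)) x (1, 0) =
    fderiv ℝ (fun y => fderiv ℝ f y (1, 0)) x (0, 1)
  rw [h, h]
  exact (hf.contDiffAt.isSymmSndFDerivAt
    (by simpa using WithTop.coe_le_coe.2 (le_top : (2 : ℕ∞) ≤ ⊤))) _ _

/-- `K₁(k)` with its coefficients written as complex numbers. -/
theorem K1_apply (l : ℝ) (k : ℝ × ℝ) (f : ℝ × ℝ → ℂ) : K1 l k f = fun x =>
    (-I * l) * d1 f x + (-(1 / (2 * l))) * (x.2 * f x) + (l * k.1) * f x := by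
  ext x
  simp only [K1]
  push_cast
  ring

theorem K2_apply (l : ℝ) (k : ℝ × ℝ) (f : ℝ × ℝ → ℂ) : K2 l k f = fun x =>
    (-I * l) * d2 f x + (1 / (2 * l)) * (x.1 * f x) + (l * k.2) * f x := by
  ext x
  simp only [K2]
  push_cast
  ring

theorem G1_apply (l : ℝ) (f : ℝ × ℝ → ℂ) : G1 l f = fun x =>
    (-I * l) * d2 f x + (-(1 / (2 * l))) * (x.1 * f x) := by
  ext x
  simp only [G1]
  push_cast
  ring

theorem G2_apply (l : ℝ) (f : ℝ × ℝ → ℂ) : G2 l f = fun x =>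
    (-I * l) * d1 f x + (1 / (2 * l)) * (x.2 * f x) := by
  ext x
  simp only [G2]
  push_cast
  ring

theorem contDiff_K1 (l : ℝ) (k : ℝ × ℝ) (hf : ContDiff ℝ (⊤ : ℕ∞) f) :
    ContDiff ℝ (⊤ : ℕ∞) (K1 l k f) := by
  rw [K1_apply]
  exact ((contDiff_const.mul (contDiff_d1 hf)).add
    (contDiff_const.mul (contDiff_ofReal_snd.mul hf))).add (contDiff_const.mul hf)

theorem contDiff_K2 (l : ℝ) (k : ℝ × ℝ) (hf : ContDiff ℝ (⊤ : ℕ∞) f) :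
    ContDiff ℝ (⊤ : ℕ∞) (K2 l k f) := by
  rw [K2_apply]
  exact ((contDiff_const.mul (contDiff_d2 hf)).add
    (contDiff_const.mul (contDiff_ofReal_fst.mul hf))).add (contDiff_const.mul hf)

variable {l : ℝ} {k : ℝ × ℝ}

theorem K1_K2_comm (hl : l ≠ 0) (hf : ContDiff ℝ (⊤ : ℕ∞) f) :
    K1 l k (K2 l k f) x = K2 l k (K1 l k f) x - I * f x := by
  have hf0 : Differentiable ℝ f := hf.differentiable (by simp)
  have hf1 : Differentiable ℝ (d1 f) := (contDiff_d1 hf).differentiable (by simp)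
  have hf2 : Differentiable ℝ (d2 f) := (contDiff_d2 hf).differentiable (by simp)
  have h1 := differentiable_ofReal_fst
  have h2 := differentiable_ofReal_snd
  simp (disch := fun_prop) only [K1_apply, K2_apply, d1_add, d1_mul, d2_add, d2_mul, d1_const,
    d2_const, d1_fst, d2_snd, d1_d2_comm hf]
  have hl' : (l : ℂ) ≠ 0 := by exact_mod_cast hl
  field_simp
  ring

theorem G1_G2_comm (hl : l ≠ 0) (hf : ContDiff ℝ (⊤ : ℕ∞) f) :
    G1 l (G2 l f) x = G2 l (G1 l f) x - I * f x := by
  have hf0 : Differentiable ℝ f := hf.differentiable (by simp)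
  have hf1 : Differentiable ℝ (d1 f) := (contDiff_d1 hf).differentiable (by simp)
  have hf2 : Differentiable ℝ (d2 f) := (contDiff_d2 hf).differentiable (by simp)
  have h1 := differentiable_ofReal_fst
  have h2 := differentiable_ofReal_snd
  simp (disch := fun_prop) only [G1_apply, G2_apply, d1_add, d1_mul, d2_add, d2_mul, d1_const,
    d2_const, d1_fst, d2_snd, d1_d2_comm hf]
  have hl' : (l : ℂ) ≠ 0 := by exact_mod_cast hl
  field_simp
  ring

theorem K1_G1_comm (hl : l ≠ 0) (hf : ContDiff ℝ (⊤ : ℕ∞) f) :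
    K1 l 0 (G1 l f) x = G1 l (K1 l 0 f) x := by
  have hf0 : Differentiable ℝ f := hf.differentiable (by simp)
  have hf1 : Differentiable ℝ (d1 f) := (contDiff_d1 hf).differentiable (by simp)
  have hf2 : Differentiable ℝ (d2 f) := (contDiff_d2 hf).differentiable (by simp)
  have h1 := differentiable_ofReal_fst
  have h2 := differentiable_ofReal_snd
  simp (disch := fun_prop) only [K1_apply, G1_apply, d1_add, d1_mul, d2_add, d2_mul, d1_const,
    d2_const, d1_fst, d2_snd, d1_d2_comm hf]
  have hl' : (l : ℂ) ≠ 0 := by exact_mod_cast hl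
  field_simp
  ring

theorem K1_G2_comm (hf : ContDiff ℝ (⊤ : ℕ∞) f) :
    K1 l 0 (G2 l f) x = G2 l (K1 l 0 f) x := by
  have hf0 : Differentiable ℝ f := hf.differentiable (by simp)
  have hf1 : Differentiable ℝ (d1 f) := (contDiff_d1 hf).differentiable (by simp)
  have h2 := differentiable_ofReal_snd
  simp (disch := fun_prop) only [K1_apply, G2_apply, d1_add, d1_mul, d1_const, d1_snd]
  ring

theorem K2_G1_comm (hf : ContDiff ℝ (⊤ : ℕ∞) f) :
    K2 l 0 (G1 l f) x = G1 l (K2 l 0 f) x := by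
  have hf0 : Differentiable ℝ f := hf.differentiable (by simp)
  have hf2 : Differentiable ℝ (d2 f) := (contDiff_d2 hf).differentiable (by simp)
  have h1 := differentiable_ofReal_fst
  simp (disch := fun_prop) only [K2_apply, G1_apply, d2_add, d2_mul, d2_const, d2_fst]
  ring

theorem K2_G2_comm (hl : l ≠ 0) (hf : ContDiff ℝ (⊤ : ℕ∞) f) :
    K2 l 0 (G2 l f) x = G2 l (K2 l 0 f) x := by
  have hf0 : Differentiable ℝ f := hf.differentiable (by simp)
  have hf1 : Differentiable ℝ (d1 f) := (contDiff_d1 hf).differentiable (by simp)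
  have hf2 : Differentiable ℝ (d2 f) := (contDiff_d2 hf).differentiable (by simp)
  have h1 := differentiable_ofReal_fst
  have h2 := differentiable_ofReal_snd
  simp (disch := fun_prop) only [K2_apply, G2_apply, d1_add, d1_mul, d2_add, d2_mul, d1_const,
    d2_const, d1_fst, d2_snd, d1_d2_comm hf]
  have hl' : (l : ℂ) ≠ 0 := by exact_mod_cast hl
  field_simp
  ring

/-- Pointwise form of symmetry: the defect is the derivative of the product of g with the conjugate
of f, whose integral vanishes both for Schwartz functions on the plane and for magnetic-periodic
functions on the cell. -/
theorem conj_K1_mul (l : ℝ) (k : ℝ × ℝ) (f g : ℝ × ℝ → ℂ) (x : ℝ × ℝ) :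
    conj (K1 l k f x) * g x = conj (f x) * K1 l k g x +
      I * l * (conj (d1 f x) * g x + conj (f x) * d1 g x) := by
  simp only [K1, map_add, map_sub, map_mul, map_neg, conj_I, conj_ofReal]
  ring

theorem conj_K2_mul (l : ℝ) (k : ℝ × ℝ) (f g : ℝ × ℝ → ℂ) (x : ℝ × ℝ) :
    conj (K2 l k f x) * g x = conj (f x) * K2 l k g x +
      I * l * (conj (d2 f x) * g x + conj (f x) * d2 g x) := by
  simp only [K2, map_add, map_mul, map_neg, conj_I, conj_ofReal]
  ring

theorem conj_G1_mul (l : ℝ) (f g : ℝ × ℝ → ℂ) (x : ℝ × ℝ) :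
    conj (G1 l f x) * g x = conj (f x) * G1 l g x +
      I * l * (conj (d2 f x) * g x + conj (f x) * d2 g x) := by
  simp only [G1, map_sub, map_mul, map_neg, conj_I, conj_ofReal]
  ring

theorem conj_G2_mul (l : ℝ) (f g : ℝ × ℝ → ℂ) (x : ℝ × ℝ) :
    conj (G2 l f x) * g x = conj (f x) * G2 l g x +
      I * l * (conj (d1 f x) * g x + conj (f x) * d1 g x) := by
  simp only [G2, map_add, map_mul, map_neg, conj_I, conj_ofReal]
  ring

end Calculus

end Landau

namespace Landau

/-! ### Gaussians as Schwartz functions. -/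

section Gaussian

/-- The power is absorbed by one more unit in the exponent, |x|ⁿ ≤ n! e^|x|; completing the square
then gives (c + 1)|x| - ax² ≤ (c + 1)²/(4a). -/
theorem abs_pow_mul_exp_le (n : ℕ) (c : ℝ) {a : ℝ} (ha : 0 < a) (x : ℝ) :
    |x| ^ n * Real.exp (c * |x|) * Real.exp (-(a * x ^ 2)) ≤
      n.factorial * Real.exp ((c + 1) ^ 2 / (4 * a)) := by
  have h1 : |x| ^ n ≤ n.factorial * Real.exp |x| := by
    have := Real.pow_div_factorial_le_exp |x| (abs_nonneg x) n
    rwa [div_le_iff₀' (by positivity)] at this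
  calc |x| ^ n * Real.exp (c * |x|) * Real.exp (-(a * x ^ 2))
      ≤ n.factorial * Real.exp |x| * Real.exp (c * |x|) * Real.exp (-(a * x ^ 2)) := by gcongr
    _ = n.factorial * Real.exp (|x| + c * |x| + -(a * x ^ 2)) := by
        rw [Real.exp_add, Real.exp_add]
        ring
    _ ≤ _ := by
        gcongr
        rw [le_div_iff₀ (by positivity), ← sq_abs x]
        nlinarith [sq_nonneg (2 * a * |x| - (c + 1))]

theorem exists_bound_polynomial_mul_gaussian (p : Polynomial ℝ) :
    ∃ C, ∀ x : ℝ, |p.eval x| * Real.exp (-(x ^ 2 / 2)) ≤ C := by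
  induction p using Polynomial.induction_on' with
  | add p q hp hq =>
    obtain ⟨C, hC⟩ := hp
    obtain ⟨D, hD⟩ := hq
    refine ⟨C + D, fun x => le_trans ?_ (add_le_add (hC x) (hD x))⟩
    rw [Polynomial.eval_add, ← add_mul]
    gcongr
    exact abs_add_le _ _
  | monomial n c =>
    refine ⟨|c| * (n.factorial * Real.exp ((0 + 1) ^ 2 / (4 * (1 / 2)))), fun x => ?_⟩
    have := abs_pow_mul_exp_le n 0 (a := 1 / 2) (by norm_num) x
    rw [zero_mul, Real.exp_zero, mul_one] at this
    rw [Polynomial.eval_monomial, abs_mul, abs_pow, mul_assoc]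
    rw [show 1 / 2 * x ^ 2 = x ^ 2 / 2 by ring] at this
    exact mul_le_mul_of_nonneg_left this (abs_nonneg c)

/-- The derivatives of exp(-x²/2) are Hermite polynomials times the same Gaussian; the general case
follows by the dilation √(2a). -/
theorem exists_schwartz_gaussian {a : ℝ} (ha : 0 < a) :
    ∃ f : SchwartzMap ℝ ℂ, ∀ x, f x = (Real.exp (-(a * x ^ 2)) : ℝ) := by
  let g : SchwartzMap ℝ ℝ :=
    { toFun := fun x => Real.exp (-(x ^ 2 / 2))
      smooth' := by fun_prop
      decay' := by
        intro k n
        obtain ⟨C, hC⟩ := exists_bound_polynomial_mul_gaussian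
          (Polynomial.X ^ k * (Polynomial.hermite n).map (Int.castRingHom ℝ))
        refine ⟨C, fun x => ?_⟩
        rw [norm_iteratedFDeriv_eq_norm_iteratedDeriv, iteratedDeriv_eq_iterate,
          Polynomial.deriv_gaussian_eq_hermite_mul_gaussian]
        refine le_trans (le_of_eq ?_) (hC x)
        rw [Polynomial.eval_mul, Polynomial.eval_pow, Polynomial.eval_X, Polynomial.eval_map,
          abs_mul, abs_pow, norm_mul, norm_mul, norm_pow, norm_neg, norm_one, one_pow, one_mul,
          Real.norm_eq_abs, Real.norm_eq_abs, Real.norm_eq_abs, abs_of_pos (Real.exp_pos _),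
          Polynomial.aeval_def, mul_assoc]
        rfl }
  let e : ℝ ≃L[ℝ] ℝ := ContinuousLinearEquiv.smulLeft
    (Units.mk0 (Real.sqrt (2 * a)) (by positivity))
  refine ⟨SchwartzMap.postcompCLM (𝕜 := ℝ) ofRealCLM (SchwartzMap.compCLMOfContinuousLinearEquiv ℝ e g), fun x => ?_⟩
  have he : e x = Real.sqrt (2 * a) * x := rfl
  rw [SchwartzMap.postcompCLM_apply, SchwartzMap.compCLMOfContinuousLinearEquiv_apply,
    Function.comp_apply, he, ofRealCLM_apply]
  change ((Real.exp (-((Real.sqrt (2 * a) * x) ^ 2 / 2)) : ℝ) : ℂ) = _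
  rw [mul_pow, Real.sq_sqrt (by positivity)]
  congr 3
  ring

theorem norm_iteratedFDeriv_comp_clm_le {f : ℝ → ℂ} (hf : ContDiff ℝ (⊤ : ℕ∞) f)
    {L : ℝ × ℝ →L[ℝ] ℝ} (hL : ‖L‖ ≤ 1) (n : ℕ) (x : ℝ × ℝ) :
    ‖iteratedFDeriv ℝ n (f ∘ L) x‖ ≤ ‖iteratedFDeriv ℝ n f (L x)‖ := by
  rw [L.iteratedFDeriv_comp_right hf x (i := n) (by exact_mod_cast le_top)]
  refine (ContinuousMultilinearMap.norm_compContinuousLinearMap_le _ _).trans ?_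
  rw [Finset.prod_const]
  exact mul_le_of_le_one_right (norm_nonneg _) (pow_le_one₀ (norm_nonneg _) hL)

/-- The tensor product of two Schwartz functions on the line. -/
noncomputable def schwartzTensor (f g : SchwartzMap ℝ ℂ) : SchwartzMap (ℝ × ℝ) ℂ where
  toFun := fun x => f x.1 * g x.2
  smooth' := ((f.smooth _).comp contDiff_fst).mul ((g.smooth _).comp contDiff_snd)
  decay' := by
    intro k n
    refine ⟨∑ i ∈ Finset.range (n + 1), (n.choose i : ℝ) *
      (SchwartzMap.seminorm ℝ k i f * SchwartzMap.seminorm ℝ 0 (n - i) g +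
        SchwartzMap.seminorm ℝ 0 i f * SchwartzMap.seminorm ℝ k (n - i) g), fun x => ?_⟩
    have h1 : ‖iteratedFDeriv ℝ n (fun x : ℝ × ℝ => f x.1 * g x.2) x‖ ≤ _ :=
      norm_iteratedFDeriv_mul_le ((f.smooth ⊤).comp contDiff_fst)
        ((g.smooth ⊤).comp contDiff_snd) x (n := n) (by exact_mod_cast le_top)
    refine (mul_le_mul_of_nonneg_left h1 (by positivity)).trans ?_
    rw [Finset.mul_sum]
    refine Finset.sum_le_sum fun i _ => ?_
    have hf := norm_iteratedFDeriv_comp_clm_le (f.smooth ⊤)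
      (ContinuousLinearMap.norm_fst_le ℝ ℝ ℝ) i x
    have hg := norm_iteratedFDeriv_comp_clm_le (g.smooth ⊤)
      (ContinuousLinearMap.norm_snd_le ℝ ℝ ℝ) (n - i) x
    -- The norm of the plane is the maximum norm, so the weight splits between the two factors.
    have hx : ‖x‖ ^ k ≤ ‖x.1‖ ^ k + ‖x.2‖ ^ k := by
      rw [Prod.norm_def]
      rcases max_cases ‖x.1‖ ‖x.2‖ with h | h <;> rw [h.1]
      · exact le_add_of_nonneg_right (by positivity)
      · exact le_add_of_nonneg_left (by positivity)
    have a1 := f.le_seminorm ℝ k i x.1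
    have a2 := f.le_seminorm ℝ 0 i x.1
    have b1 := g.le_seminorm ℝ k (n - i) x.2
    have b2 := g.le_seminorm ℝ 0 (n - i) x.2
    rw [pow_zero, one_mul] at a2 b2
    calc ‖x‖ ^ k * ((n.choose i : ℝ) * ‖iteratedFDeriv ℝ i (f ∘ Prod.fst) x‖ *
          ‖iteratedFDeriv ℝ (n - i) (g ∘ Prod.snd) x‖)
        ≤ (‖x.1‖ ^ k + ‖x.2‖ ^ k) * ((n.choose i : ℝ) * ‖iteratedFDeriv ℝ i f x.1‖ *
          ‖iteratedFDeriv ℝ (n - i) g x.2‖) := by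
          gcongr
          · exact hf
          · exact hg
      _ = (n.choose i : ℝ) * ((‖x.1‖ ^ k * ‖iteratedFDeriv ℝ i f x.1‖) *
            ‖iteratedFDeriv ℝ (n - i) g x.2‖ + ‖iteratedFDeriv ℝ i f x.1‖ *
            (‖x.2‖ ^ k * ‖iteratedFDeriv ℝ (n - i) g x.2‖)) := by ring
      _ ≤ _ := by gcongr

end Gaussian

end Landau
open scoped LineDeriv

namespace Landau

/-! ### The momenta on Schwartz space and their common ground state. -/

section Plane

local notation "conj" => starRingEnd ℂ

/-- The Schwartz space of the plane. -/
abbrev SchwartzPlane : Type := SchwartzMap (ℝ × ℝ) ℂ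

theorem hasTemperateGrowth_fst :
    Function.HasTemperateGrowth fun x : ℝ × ℝ => (x.1 : ℂ) :=
  (ofRealCLM ∘L ContinuousLinearMap.fst ℝ ℝ ℝ).hasTemperateGrowth

theorem hasTemperateGrowth_snd :
    Function.HasTemperateGrowth fun x : ℝ × ℝ => (x.2 : ℂ) :=
  (ofRealCLM ∘L ContinuousLinearMap.snd ℝ ℝ ℝ).hasTemperateGrowth

/-- Partial derivative on Schwartz space. -/
noncomputable def schwartzDeriv (v : ℝ × ℝ) : Module.End ℂ SchwartzPlane :=
  (LineDeriv.lineDerivOpCLM ℂ SchwartzPlane v).toLinearMap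

/-- Multiplication by the first coordinate on Schwartz space. -/
noncomputable def schwartzFst : Module.End ℂ SchwartzPlane :=
  (SchwartzMap.smulLeftCLM ℂ (fun x : ℝ × ℝ => (x.1 : ℂ))).toLinearMap

/-- Multiplication by the second coordinate on Schwartz space. -/
noncomputable def schwartzSnd : Module.End ℂ SchwartzPlane :=
  (SchwartzMap.smulLeftCLM ℂ (fun x : ℝ × ℝ => (x.2 : ℂ))).toLinearMap

theorem schwartzFst_apply (f : SchwartzPlane) (x : ℝ × ℝ) : schwartzFst f x = x.1 * f x :=
  SchwartzMap.smulLeftCLM_apply_apply hasTemperateGrowth_fst f x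

theorem schwartzSnd_apply (f : SchwartzPlane) (x : ℝ × ℝ) : schwartzSnd f x = x.2 * f x :=
  SchwartzMap.smulLeftCLM_apply_apply hasTemperateGrowth_snd f x

/-- `K₁` on Schwartz space. -/
noncomputable def schwartzK1 (l : ℝ) : Module.End ℂ SchwartzPlane :=
  (-I * l) • schwartzDeriv (1, 0) + (-(1 / (2 * l)) : ℂ) • schwartzSnd

/-- `K₂` on Schwartz space. -/
noncomputable def schwartzK2 (l : ℝ) : Module.End ℂ SchwartzPlane :=
  (-I * l) • schwartzDeriv (0, 1) + (1 / (2 * l) : ℂ) • schwartzFst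

/-- `G₁` on Schwartz space. -/
noncomputable def schwartzG1 (l : ℝ) : Module.End ℂ SchwartzPlane :=
  (-I * l) • schwartzDeriv (0, 1) + (-(1 / (2 * l)) : ℂ) • schwartzFst

/-- `G₂` on Schwartz space. -/
noncomputable def schwartzG2 (l : ℝ) : Module.End ℂ SchwartzPlane :=
  (-I * l) • schwartzDeriv (1, 0) + (1 / (2 * l) : ℂ) • schwartzSnd

variable {l : ℝ} (f : SchwartzPlane)

theorem coe_schwartzK1 : ⇑(schwartzK1 l f) = K1 l 0 f := by
  ext x
  have h1 := schwartzSnd_apply f x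
  simp only [K1_apply, schwartzK1, LinearMap.add_apply, LinearMap.smul_apply, add_apply,
    smul_apply, smul_eq_mul, h1]
  simp [schwartzDeriv, d1, SchwartzMap.lineDerivOp_apply_eq_fderiv]

theorem coe_schwartzK2 : ⇑(schwartzK2 l f) = K2 l 0 f := by
  ext x
  have h1 := schwartzFst_apply f x
  simp only [K2_apply, schwartzK2, LinearMap.add_apply, LinearMap.smul_apply, add_apply,
    smul_apply, smul_eq_mul, h1]
  simp [schwartzDeriv, d2, SchwartzMap.lineDerivOp_apply_eq_fderiv]

theorem coe_schwartzG1 : ⇑(schwartzG1 l f) = G1 l f := by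
  ext x
  have h1 := schwartzFst_apply f x
  simp only [G1_apply, schwartzG1, LinearMap.add_apply, LinearMap.smul_apply, add_apply,
    smul_apply, smul_eq_mul, h1]
  simp [schwartzDeriv, d2, SchwartzMap.lineDerivOp_apply_eq_fderiv]

theorem coe_schwartzG2 : ⇑(schwartzG2 l f) = G2 l f := by
  ext x
  have h1 := schwartzSnd_apply f x
  simp only [G2_apply, schwartzG2, LinearMap.add_apply, LinearMap.smul_apply, add_apply,
    smul_apply, smul_eq_mul, h1]
  simp [schwartzDeriv, d1, SchwartzMap.lineDerivOp_apply_eq_fderiv]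

/-- The embedding of Schwartz space into `L²`. -/
noncomputable def schwartzToL2 : SchwartzPlane →ₗ[ℂ] L2Plane :=
  (SchwartzMap.toLpCLM ℂ ℂ 2 (volume : Measure (ℝ × ℝ))).toLinearMap

theorem coeFn_schwartzToL2 : (schwartzToL2 f : ℝ × ℝ → ℂ) =ᵐ[volume] f :=
  SchwartzMap.coeFn_toLp f 2 volume

theorem inner_schwartzToL2 (f g : SchwartzPlane) :
    ⟪schwartzToL2 f, schwartzToL2 g⟫_ℂ = ∫ x, conj (f x) * g x := by
  refine (SchwartzMap.inner_toL2_toL2_eq f g volume).trans ?_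
  simp only [RCLike.inner_apply, mul_comm]

theorem integrable_conj_mul (f g : SchwartzPlane) :
    Integrable (fun x => conj (f x) * g x) := by
  refine (f.integrable.bdd_mul (g := fun x => f x) (f := fun x => g x)
    (c := SchwartzMap.seminorm ℝ 0 0 g) g.continuous.aestronglyMeasurable
    (Eventually.of_forall fun x => g.norm_le_seminorm ℝ x)).mono
    ((continuous_conj.comp f.continuous).mul g.continuous).aestronglyMeasurable
    (Eventually.of_forall fun x => le_of_eq ?_)
  simp [mul_comm]

theorem integral_conj_deriv (f g : SchwartzPlane) (v : ℝ × ℝ) :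
    ∫ x, (conj (fderiv ℝ f x v) * g x + conj (f x) * fderiv ℝ g x v) = 0 := by
  have h := SchwartzMap.integral_bilinear_lineDerivOp_right_eq_neg_left (μ := volume) f g
    ((ContinuousLinearMap.mul ℝ ℂ).comp conjCLE.toContinuousLinearMap) v
  refine (integral_add (integrable_conj_mul (∂_{v} f) g)
    (integrable_conj_mul f (∂_{v} g))).trans ?_
  rw [add_comm, add_eq_zero_iff_eq_neg]
  exact h

/-- Integration by parts, done once for all four momenta. -/
theorem inner_symm_of_conj_mul {A : Module.End ℂ SchwartzPlane} {c : ℂ} {v : ℝ × ℝ}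
    (hA : ∀ f g : SchwartzPlane, ∀ x, conj (A f x) * g x = conj (f x) * A g x +
      c * (conj (fderiv ℝ f x v) * g x + conj (f x) * fderiv ℝ g x v)) (f g : SchwartzPlane) :
    ⟪schwartzToL2 (A f), schwartzToL2 g⟫_ℂ = ⟪schwartzToL2 f, schwartzToL2 (A g)⟫_ℂ := by
  rw [inner_schwartzToL2, inner_schwartzToL2]
  simp_rw [hA]
  rw [integral_add (integrable_conj_mul f (A g)), integral_const_mul, integral_conj_deriv,
    mul_zero, add_zero]
  exact ((integrable_conj_mul (∂_{v} f) g).add (integrable_conj_mul f (∂_{v} g))).const_mul c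

theorem isCanonicalPair_K (hl : l ≠ 0) :
    IsCanonicalPair schwartzToL2 (schwartzK1 l) (schwartzK2 l) where
  symmP := inner_symm_of_conj_mul fun f g x => by
    rw [coe_schwartzK1, coe_schwartzK1]
    exact conj_K1_mul l 0 f g x
  symmX := inner_symm_of_conj_mul fun f g x => by
    rw [coe_schwartzK2, coe_schwartzK2]
    exact conj_K2_mul l 0 f g x
  comm := fun f => by
    ext x
    rw [sub_apply, smul_apply, coe_schwartzK1, coe_schwartzK2, coe_schwartzK2, coe_schwartzK1]
    exact K1_K2_comm hl (f.smooth ⊤)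

theorem isCanonicalPair_G (hl : l ≠ 0) :
    IsCanonicalPair schwartzToL2 (schwartzG1 l) (schwartzG2 l) where
  symmP := inner_symm_of_conj_mul fun f g x => by
    rw [coe_schwartzG1, coe_schwartzG1]
    exact conj_G1_mul l f g x
  symmX := inner_symm_of_conj_mul fun f g x => by
    rw [coe_schwartzG2, coe_schwartzG2]
    exact conj_G2_mul l f g x
  comm := fun f => by
    ext x
    rw [sub_apply, smul_apply, coe_schwartzG1, coe_schwartzG2, coe_schwartzG2, coe_schwartzG1]
    exact G1_G2_comm hl (f.smooth ⊤)

theorem commute_K1_G1 (hl : l ≠ 0) : Commute (schwartzK1 l) (schwartzG1 l) := by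
  ext f x
  simp only [Module.End.mul_apply, coe_schwartzK1, coe_schwartzG1]
  exact K1_G1_comm hl (f.smooth ⊤)

theorem commute_K1_G2 (l : ℝ) : Commute (schwartzK1 l) (schwartzG2 l) := by
  ext f x
  simp only [Module.End.mul_apply, coe_schwartzK1, coe_schwartzG2]
  exact K1_G2_comm (f.smooth ⊤)

theorem commute_K2_G1 (l : ℝ) : Commute (schwartzK2 l) (schwartzG1 l) := by
  ext f x
  simp only [Module.End.mul_apply, coe_schwartzK2, coe_schwartzG1]
  exact K2_G1_comm (f.smooth ⊤)

theorem commute_K2_G2 (hl : l ≠ 0) : Commute (schwartzK2 l) (schwartzG2 l) := by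
  ext f x
  simp only [Module.End.mul_apply, coe_schwartzK2, coe_schwartzG2]
  exact K2_G2_comm hl (f.smooth ⊤)

/-- The two annihilation equations read (∂₁ ∓ i∂₂)Ω = -(x₁ ∓ ix₂)Ω/(2l²). Together they say ∂ᵢΩ =
-xᵢΩ/(2l²), which forces this Gaussian up to a factor. -/
theorem exists_groundState (hl : 0 < l) : ∃ Ω : SchwartzPlane,
    (∀ x, Ω x = exp (-(1 / (4 * l ^ 2)) * (x.1 * x.1) + -(1 / (4 * l ^ 2)) * (x.2 * x.2))) ∧
    lowering (schwartzK1 l) (schwartzK2 l) Ω = 0 ∧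
    lowering (schwartzG1 l) (schwartzG2 l) Ω = 0 := by
  obtain ⟨g, hg⟩ := exists_schwartz_gaussian (a := 1 / (4 * l ^ 2)) (by positivity)
  have hΩ : ∀ x, schwartzTensor g g x =
      exp (-(1 / (4 * l ^ 2)) * (x.1 * x.1) + -(1 / (4 * l ^ 2)) * (x.2 * x.2)) := by
    intro x
    change g x.1 * g x.2 = _
    rw [hg, hg, exp_add]
    push_cast
    congr 2 <;> ring
  refine ⟨schwartzTensor g g, hΩ, ?_⟩
  have hfun : ⇑(schwartzTensor g g) = fun x : ℝ × ℝ =>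
      exp (-(1 / (4 * l ^ 2)) * (x.1 * x.1) + -(1 / (4 * l ^ 2)) * (x.2 * x.2)) := funext hΩ
  have h1 := differentiable_ofReal_fst
  have h2 := differentiable_ofReal_snd
  have hl' : (l : ℂ) ≠ 0 := by exact_mod_cast hl.ne'
  constructor <;> ext x
  · simp only [lowering, LinearMap.add_apply, LinearMap.smul_apply, add_apply, smul_apply,
      coe_schwartzK1, coe_schwartzK2, smul_eq_mul, zero_apply, hfun]
    simp (disch := fun_prop) only [K1_apply, K2_apply, d1_add, d1_mul, d2_add, d2_mul, d1_const,
      d2_const, d1_fst, d1_snd, d2_fst, d2_snd, d1_cexp, d2_cexp]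
    field_simp
    ring_nf
    simp [I_sq]
    try ring
  · simp only [lowering, LinearMap.add_apply, LinearMap.smul_apply, add_apply, smul_apply,
      coe_schwartzG1, coe_schwartzG2, smul_eq_mul, zero_apply, hfun]
    simp (disch := fun_prop) only [G1_apply, G2_apply, d1_add, d1_mul, d2_add, d2_mul, d1_const,
      d2_const, d1_fst, d1_snd, d2_fst, d2_snd, d1_cexp, d2_cexp]
    field_simp
    ring_nf
    simp [I_sq]
    try ring

end Plane

end Landau
open scoped LineDeriv

namespace Landau

/-! ### Joint eigenvectors of two commuting canonical pairs. -/

section TwoModes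

variable {V H : Type*} [AddCommGroup V] [Module ℂ V] [NormedAddCommGroup H]
  [InnerProductSpace ℂ H]

/-- Two commuting canonical pairs. -/
structure AreCommutingPairs (P X P' X' : Module.End ℂ V) : Prop where
  PP : Commute P P'
  PX : Commute P X'
  XP : Commute X P'
  XX : Commute X X'

variable {J : V →ₗ[ℂ] H} {P X P' X' : Module.End ℂ V} {Ω : V}

theorem AreCommutingPairs.symm (h : AreCommutingPairs P X P' X') :
    AreCommutingPairs P' X' P X :=
  ⟨h.PP.symm, h.XP.symm, h.PX.symm, h.XX.symm⟩

theorem AreCommutingPairs.raising_lowering (h : AreCommutingPairs P X P' X') :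
    Commute (raising P X) (lowering P' X') :=
  (h.XX.add_right (h.XP.smul_right I)).sub_left
    ((h.PX.add_right (h.PP.smul_right I)).smul_left I)

theorem AreCommutingPairs.raising_quadratic (h : AreCommutingPairs P X P' X') :
    Commute (raising P X) (quadratic P' X') :=
  ((h.XP.mul_right h.XP).add_right (h.XX.mul_right h.XX)).sub_left
    (((h.PP.mul_right h.PP).add_right (h.PX.mul_right h.PX)).smul_left I)

/-- The vectors obtained from `Ω` by applying both raising operators. -/
def twoModeVector (P X P' X' : Module.End ℂ V) (Ω : V) (p : ℕ × ℕ) : V :=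
  (raising P' X' ^ p.2) ((raising P X ^ p.1) Ω)

theorem quadratic_twoModeVector (h : IsCanonicalPair J P X) (hc : AreCommutingPairs P X P' X')
    (hΩ : lowering P X Ω = 0) (p : ℕ × ℕ) :
    quadratic P X (twoModeVector P X P' X' Ω p) =
      ((2 * p.1 + 1 : ℝ) : ℂ) • twoModeVector P X P' X' Ω p := by
  have h1 := DFunLike.congr_fun (hc.symm.raising_quadratic.pow_left p.2) ((raising P X ^ p.1) Ω)
  simp only [Module.End.mul_apply] at h1
  rw [twoModeVector, ← h1, h.quadratic_raising_pow hΩ, map_smul]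

theorem lowering_raising_pow_eq_zero (hc : AreCommutingPairs P X P' X')
    (hΩ : lowering P' X' Ω = 0) (n : ℕ) : lowering P' X' ((raising P X ^ n) Ω) = 0 := by
  have h1 := DFunLike.congr_fun (hc.raising_lowering.pow_left n) Ω
  simp only [Module.End.mul_apply] at h1
  rw [← h1, hΩ, map_zero]

theorem quadratic_twoModeVector' (h' : IsCanonicalPair J P' X')
    (hc : AreCommutingPairs P X P' X') (hΩ : lowering P' X' Ω = 0) (p : ℕ × ℕ) :
    quadratic P' X' (twoModeVector P X P' X' Ω p) =
      ((2 * p.2 + 1 : ℝ) : ℂ) • twoModeVector P X P' X' Ω p :=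
  h'.quadratic_raising_pow (lowering_raising_pow_eq_zero hc hΩ p.1) p.2

theorem twoModeVector_ne_zero (h : IsCanonicalPair J P X) (h' : IsCanonicalPair J P' X')
    (hc : AreCommutingPairs P X P' X') (hΩ : lowering P X Ω = 0) (hΩ' : lowering P' X' Ω = 0)
    (hJ : J Ω ≠ 0) (p : ℕ × ℕ) : J (twoModeVector P X P' X' Ω p) ≠ 0 :=
  h'.raising_pow_ne_zero (lowering_raising_pow_eq_zero hc hΩ' p.1)
    (h.raising_pow_ne_zero hΩ hJ p.1) p.2

/-- Distinct index pairs are separated by the eigenvalue of one of the two symmetric quadratic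
operators. -/
theorem twoModeVector_orthogonal (h : IsCanonicalPair J P X) (h' : IsCanonicalPair J P' X')
    (hc : AreCommutingPairs P X P' X') (hΩ : lowering P X Ω = 0) (hΩ' : lowering P' X' Ω = 0)
    {p q : ℕ × ℕ} (hpq : p ≠ q) :
    ⟪J (twoModeVector P X P' X' Ω p), J (twoModeVector P X P' X' Ω q)⟫_ℂ = 0 := by
  by_cases h1 : p.1 = q.1
  · refine inner_eq_zero_of_eigenvalue_ne h'.symm_quadratic
      (quadratic_twoModeVector' h' hc hΩ' p) (quadratic_twoModeVector' h' hc hΩ' q) fun h2 => ?_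
    refine hpq (Prod.ext h1 ?_)
    have : (p.2 : ℝ) = q.2 := by linarith
    exact_mod_cast this
  · refine inner_eq_zero_of_eigenvalue_ne h.symm_quadratic
      (quadratic_twoModeVector h hc hΩ p) (quadratic_twoModeVector h hc hΩ q) fun h2 => h1 ?_
    have : (p.1 : ℝ) = q.1 := by linarith
    exact_mod_cast this

/-- The span of the vectors is invariant under the operators `X` and `P` of the second mode. -/
theorem map_twoModeVector_mem_span (h' : IsCanonicalPair J P' X')
    (hc : AreCommutingPairs P X P' X') (hΩ' : lowering P' X' Ω = 0) {A : Module.End ℂ V}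
    (hA : ∀ u, ∃ a b : ℂ, A u = a • raising P' X' u + b • lowering P' X' u) (p : ℕ × ℕ) :
    A (twoModeVector P X P' X' Ω p) ∈
      Submodule.span ℂ (Set.range (twoModeVector P X P' X' Ω)) := by
  obtain ⟨a, b, hab⟩ := hA (twoModeVector P X P' X' Ω p)
  rw [hab]
  refine Submodule.add_mem _ (Submodule.smul_mem _ _ ?_) (Submodule.smul_mem _ _ ?_)
  · exact Submodule.subset_span ⟨(p.1, p.2 + 1), by
      simp only [twoModeVector, pow_succ', Module.End.mul_apply]⟩
  · rw [twoModeVector, h'.lowering_raising_pow (lowering_raising_pow_eq_zero hc hΩ' p.1)]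
    exact Submodule.smul_mem _ _ (Submodule.subset_span ⟨(p.1, p.2 - 1), rfl⟩)

theorem twoModeVector_swap (hc : AreCommutingPairs P X P' X') (p : ℕ × ℕ) :
    twoModeVector P' X' P X Ω p.swap = twoModeVector P X P' X' Ω p := by
  have h1 : Commute (raising P X) (raising P' X') :=
    (hc.XX.sub_right (hc.XP.smul_right I)).sub_left
      ((hc.PX.sub_right (hc.PP.smul_right I)).smul_left I)
  have h2 := DFunLike.congr_fun (h1.pow_pow p.1 p.2) Ω
  simpa only [Module.End.mul_apply, twoModeVector, Prod.fst_swap, Prod.snd_swap] using h2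

/-- Each of the four operators combines raising and lowering of its own mode. The first mode is
reduced to the second by exchanging the pairs, which only permutes the family. -/
theorem span_twoModeVector_invariant (h : IsCanonicalPair J P X) (h' : IsCanonicalPair J P' X')
    (hc : AreCommutingPairs P X P' X') (hΩ : lowering P X Ω = 0) (hΩ' : lowering P' X' Ω = 0)
    {A : Module.End ℂ V} (hA : A = X ∨ A = P ∨ A = X' ∨ A = P') {v : V}
    (hv : v ∈ Submodule.span ℂ (Set.range (twoModeVector P X P' X' Ω))) :
    A v ∈ Submodule.span ℂ (Set.range (twoModeVector P X P' X' Ω)) := by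
  set W := Submodule.span ℂ (Set.range (twoModeVector P X P' X' Ω)) with hW
  have hX : ∀ (P X : Module.End ℂ V) (u : V),
      ∃ a b : ℂ, X u = a • raising P X u + b • lowering P X u := fun P X u =>
    ⟨2⁻¹, 2⁻¹, by rw [← smul_add]; exact IsCanonicalPair.apply_eq_half P X u⟩
  have hP : ∀ (P X : Module.End ℂ V) (u : V),
      ∃ a b : ℂ, P u = a • raising P X u + b • lowering P X u := fun P X u =>
    ⟨2⁻¹ * I, -(2⁻¹ * I), by
      rw [neg_smul, ← sub_eq_add_neg, ← smul_sub]; exact IsCanonicalPair.apply_eq_half' P X u⟩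
  have hspan : Submodule.span ℂ (Set.range (twoModeVector P' X' P X Ω)) = W := by
    rw [hW]
    congr 1
    ext w
    constructor
    · rintro ⟨p, rfl⟩
      exact ⟨p.swap, by rw [← twoModeVector_swap hc, Prod.swap_swap]⟩
    · rintro ⟨p, rfl⟩
      exact ⟨p.swap, twoModeVector_swap hc p⟩
  suffices hle : W ≤ W.comap A from hle hv
  rcases hA with rfl | rfl | rfl | rfl
  · conv_lhs => rw [← hspan]
    refine Submodule.span_le.2 ?_
    rintro _ ⟨p, rfl⟩
    rw [← hspan]
    exact map_twoModeVector_mem_span h hc.symm hΩ (hX P A) p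
  · conv_lhs => rw [← hspan]
    refine Submodule.span_le.2 ?_
    rintro _ ⟨p, rfl⟩
    rw [← hspan]
    exact map_twoModeVector_mem_span h hc.symm hΩ (hP A X) p
  · refine Submodule.span_le.2 ?_
    rintro _ ⟨p, rfl⟩
    exact map_twoModeVector_mem_span h' hc hΩ' (hX P' A) p
  · refine Submodule.span_le.2 ?_
    rintro _ ⟨p, rfl⟩
    exact map_twoModeVector_mem_span h' hc hΩ' (hP A X') p

/-- Normalization of an orthogonal family that is complete. -/
theorem exists_hilbertBasis_of_orthogonal [CompleteSpace H] {ι : Type*} {w : ι → H}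
    (h0 : ∀ i, w i ≠ 0) (hw : ∀ i j, i ≠ j → ⟪w i, w j⟫_ℂ = 0)
    (hcomp : ∀ u : H, (∀ i, ⟪w i, u⟫_ℂ = 0) → u = 0) :
    ∃ b : HilbertBasis ι ℂ H, ∀ i, b i = ((‖w i‖⁻¹ : ℝ) : ℂ) • w i := by
  have hon : Orthonormal ℂ fun i => ((‖w i‖⁻¹ : ℝ) : ℂ) • w i := by
    refine ⟨fun i => ?_, fun i j hij => ?_⟩
    · rw [norm_smul, Complex.norm_real, norm_inv, norm_norm,
        inv_mul_cancel₀ (norm_ne_zero_iff.2 (h0 i))]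
    · change ⟪_, _⟫_ℂ = 0
      rw [inner_smul_left, inner_smul_right, hw i j hij, mul_zero, mul_zero]
  have hbot : (Submodule.span ℂ (Set.range fun i => ((‖w i‖⁻¹ : ℝ) : ℂ) • w i))ᗮ = ⊥ := by
    refine (Submodule.eq_bot_iff _).2 fun u hu => hcomp u fun i => ?_
    have h1 := hu _ (Submodule.subset_span ⟨i, rfl⟩)
    rw [inner_smul_left, mul_eq_zero] at h1
    refine h1.resolve_left ?_
    simpa using h0 i
  exact ⟨HilbertBasis.mkOfOrthogonalEqBot hon hbot,
    fun i => congrFun (HilbertBasis.coe_mkOfOrthogonalEqBot hon hbot) i⟩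

end TwoModes

end Landau

namespace Landau

local notation "conj" => starRingEnd ℂ

/-! ### From eigenvectors in the core to a diagonal closed operator. -/

section Core

variable {ι V : Type*} [AddCommGroup V] [Module ℂ V] {μ : Measure (ℝ × ℝ)}

/-- A differential operator that is symmetric on its core and has a complete orthogonal system of
eigenvectors in the core. -/
theorem isDiagonal_closedRealization {J : V →ₗ[ℂ] Lp ℂ 2 μ} {c : V → ℝ × ℝ → ℂ}
    (hJ : ∀ f, (J f : ℝ × ℝ → ℂ) =ᵐ[μ] c f) {C : Set (ℝ × ℝ → ℂ)} (hC : C = Set.range c)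
    {A : Module.End ℂ V} {D : (ℝ × ℝ → ℂ) → ℝ × ℝ → ℂ} (hA : ∀ f, c (A f) = D (c f))
    (hsymm : ∀ u v, ⟪J (A u), J v⟫_ℂ = ⟪J u, J (A v)⟫_ℂ) {b : HilbertBasis ι ℂ (Lp ℂ 2 μ)}
    {w : ι → V} {r : ι → ℂ} (hb : ∀ i, b i = r i • J (w i)) {e : ι → ℝ}
    (he : ∀ i, A (w i) = (e i : ℂ) • w i) :
    IsDiagonal (closedRealization μ C D) b fun i => (e i : ℂ) := by
  have hset : ∀ f, (J f, J (A f)) ∈ {p : Lp ℂ 2 μ × Lp ℂ 2 μ |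
      ∃ f ∈ C, (p.1 : ℝ × ℝ → ℂ) =ᵐ[μ] f ∧ (p.2 : ℝ × ℝ → ℂ) =ᵐ[μ] D f} := fun f =>
    ⟨c f, hC ▸ ⟨f, rfl⟩, hJ f, hA f ▸ hJ (A f)⟩
  refine isDiagonal_topologicalClosure b _ _ (fun i => ?_) fun p hp i => ?_
  · have h1 := Submodule.smul_mem _ (r i) (Submodule.subset_span (R := ℂ) (hset (w i)))
    convert h1 using 1
    refine Prod.ext (hb i) ?_
    simp only [Prod.smul_snd, he, map_smul, hb, smul_smul, mul_comm]
  -- The coefficient relation is linear, so it only has to be checked on the generators (f, D f),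
  -- where it is the symmetry of A against an eigenvector.
  · let W : Submodule ℂ (Lp ℂ 2 μ × Lp ℂ 2 μ) :=
      { carrier := {p | ⟪b i, p.2⟫_ℂ = e i * ⟪b i, p.1⟫_ℂ}
        add_mem' := fun {p q} hp hq => by
          simp only [Set.mem_ofPred_eq, Prod.fst_add, Prod.snd_add, inner_add_right] at *
          rw [hp, hq, mul_add]
        zero_mem' := by simp
        smul_mem' := fun a p hp => by
          simp only [Set.mem_ofPred_eq, Prod.smul_fst, Prod.smul_snd, inner_smul_right] at *
          rw [hp, mul_left_comm] }
    suffices hle : Submodule.span ℂ {p : Lp ℂ 2 μ × Lp ℂ 2 μ |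
        ∃ f ∈ C, (p.1 : ℝ × ℝ → ℂ) =ᵐ[μ] f ∧ (p.2 : ℝ × ℝ → ℂ) =ᵐ[μ] D f} ≤ W from hle hp
    refine Submodule.span_le.2 ?_
    rintro ⟨p1, p2⟩ ⟨f, hf, h1, h2⟩
    rw [hC] at hf
    obtain ⟨v, rfl⟩ := hf
    have h3 : p1 = J v := Lp.ext (h1.trans (hJ v).symm)
    have h4 : p2 = J (A v) := Lp.ext (h2.trans (hA v ▸ (hJ (A v)).symm))
    change ⟪b i, p2⟫_ℂ = e i * ⟪b i, p1⟫_ℂ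
    rw [h3, h4, hb, inner_smul_left, inner_smul_left, ← hsymm, he, map_smul, inner_smul_left,
      conj_ofReal]
    ring

end Core

/-! ### Spectral decomposition on the plane and the Dixmier trace. -/

section Plane

variable {l : ℝ}

theorem areCommutingPairs_K_G (hl : l ≠ 0) :
    AreCommutingPairs (schwartzK1 l) (schwartzK2 l) (schwartzG1 l) (schwartzG2 l) :=
  ⟨commute_K1_G1 hl, commute_K1_G2 l, commute_K2_G1 l, commute_K2_G2 hl⟩

/-- The multiplication by a linear form, in terms of the momenta. -/
theorem exists_mul_linearForm (hl : l ≠ 0) (Λ : StrongDual ℝ (ℝ × ℝ)) :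
    ∃ a b : ℂ, ∀ (f : SchwartzPlane) (x : ℝ × ℝ),
      (a • (schwartzK2 l - schwartzG1 l) + b • (schwartzG2 l - schwartzK1 l)) f x =
        (Λ x : ℂ) * f x := by
  -- The derivatives cancel in K₂ - G₁ = x₁/l and G₂ - K₁ = x₂/l.
  refine ⟨l * Λ (1, 0), l * Λ (0, 1), fun f x => ?_⟩
  have hΛ : Λ x = x.1 * Λ (1, 0) + x.2 * Λ (0, 1) := by
    conv_lhs => rw [show x = x.1 • ((1 : ℝ), (0 : ℝ)) + x.2 • ((0 : ℝ), (1 : ℝ)) by ext <;> simp]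
    rw [map_add, map_smul, map_smul, smul_eq_mul, smul_eq_mul]
  simp only [LinearMap.add_apply, LinearMap.smul_apply, LinearMap.sub_apply, add_apply, sub_apply,
    smul_apply, smul_eq_mul, coe_schwartzK1, coe_schwartzK2, coe_schwartzG1, coe_schwartzG2,
    K1_apply, K2_apply, G1_apply, G2_apply, hΛ]
  have hl' : (l : ℂ) ≠ 0 := by exact_mod_cast hl
  push_cast
  field_simp
  simp
  ring

/-- Half of the Gaussian absorbs the exponential of the linear form, by ‖Λ‖‖x‖ ≤ ‖Λ‖²/(2q) +
q‖x‖²/2. The other half remains for integrability. -/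
theorem gaussian_mul_exp_le {q : ℝ} (hq : 0 < q) (Λ : StrongDual ℝ (ℝ × ℝ)) (x : ℝ × ℝ) :
    Real.exp (-(q * (x.1 ^ 2 + x.2 ^ 2))) * Real.exp |Λ x| ≤
      Real.exp (‖Λ‖ ^ 2 / (2 * q)) * Real.exp (-(q / 2 * (x.1 ^ 2 + x.2 ^ 2))) := by
  rw [← Real.exp_add, ← Real.exp_add]
  refine Real.exp_le_exp.2 ?_
  have h1 : |Λ x| ≤ ‖Λ‖ * ‖x‖ := Λ.le_opNorm x
  have h2 : ‖x‖ ^ 2 ≤ x.1 ^ 2 + x.2 ^ 2 := by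
    rw [Prod.norm_def, Real.norm_eq_abs, Real.norm_eq_abs]
    rcases max_cases |x.1| |x.2| with h | h <;> rw [h.1, sq_abs]
    · exact le_add_of_nonneg_right (sq_nonneg _)
    · exact le_add_of_nonneg_left (sq_nonneg _)
  have h3 : ‖Λ‖ * ‖x‖ ≤ ‖Λ‖ ^ 2 / (2 * q) + q / 2 * ‖x‖ ^ 2 := by
    have h4 : ‖Λ‖ ^ 2 / (2 * q) + q / 2 * ‖x‖ ^ 2 - ‖Λ‖ * ‖x‖ =
        (‖Λ‖ - q * ‖x‖) ^ 2 / (2 * q) := by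
      field_simp
      ring
    have h5 : 0 ≤ (‖Λ‖ - q * ‖x‖) ^ 2 / (2 * q) := by positivity
    linarith
  nlinarith

/-- Completeness of the simultaneous eigenfunctions. -/
theorem eq_zero_of_inner_twoModeVector (hl : 0 < l) {Ω : SchwartzPlane}
    (hΩ : ∀ x, Ω x =
      exp (-(1 / (4 * l ^ 2)) * (x.1 * x.1) + -(1 / (4 * l ^ 2)) * (x.2 * x.2)))
    (hK : lowering (schwartzK1 l) (schwartzK2 l) Ω = 0)
    (hG : lowering (schwartzG1 l) (schwartzG2 l) Ω = 0) (u : L2Plane)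
    (hu : ∀ p, ⟪schwartzToL2 (twoModeVector (schwartzK1 l) (schwartzK2 l) (schwartzG1 l)
      (schwartzG2 l) Ω p), u⟫_ℂ = 0) : u = 0 := by
  set W := Submodule.span ℂ (Set.range (twoModeVector (schwartzK1 l) (schwartzK2 l)
    (schwartzG1 l) (schwartzG2 l) Ω)) with hW
  have hWu : ∀ f ∈ W, ∫ x, conj (f x) * u x = 0 := by
    intro f hf
    have h1 : ⟪schwartzToL2 f, u⟫_ℂ = 0 := by
      induction hf using Submodule.span_induction with
      | mem f hf => obtain ⟨p, rfl⟩ := hf; exact hu p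
      | zero => rw [map_zero, inner_zero_left]
      | add f g _ _ h1 h2 => rw [map_add, inner_add_left, h1, h2, add_zero]
      | smul a f _ h1 => rw [map_smul, inner_smul_left, h1, mul_zero]
    rw [← h1, L2.inner_def]
    refine integral_congr_ae ?_
    filter_upwards [coeFn_schwartzToL2 f] with x hx
    rw [hx, RCLike.inner_apply, mul_comm]
  have hinv : ∀ A, (A = schwartzK2 l ∨ A = schwartzK1 l ∨ A = schwartzG2 l ∨ A = schwartzG1 l) →
      ∀ f ∈ W, A f ∈ W := fun A hA f hf =>
    span_twoModeVector_invariant (isCanonicalPair_K hl.ne') (isCanonicalPair_G hl.ne')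
      (areCommutingPairs_K_G hl.ne') hK hG hA hf
  have hΩr : ∀ x, Ω x =
      (Real.exp (-(1 / (4 * l ^ 2) * (x.1 ^ 2 + x.2 ^ 2))) : ℝ) := fun x => by
    rw [hΩ]
    push_cast
    congr 1
    ring
  have hmom : ∀ (Λ : StrongDual ℝ (ℝ × ℝ)) (n : ℕ),
      ∫ x, (Ω x * u x) * (Λ x : ℂ) ^ n = 0 := by
    intro Λ n
    obtain ⟨a, b, hab⟩ := exists_mul_linearForm hl.ne' Λ
    set A := a • (schwartzK2 l - schwartzG1 l) + b • (schwartzG2 l - schwartzK1 l)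
    -- Multiplication by Λ is a combination of momenta and preserves W, so orthogonality to W says
    -- that all moments of Ωu vanish.
    have hA : ∀ n : ℕ, (A ^ n) Ω ∈ W ∧ ∀ x, (A ^ n) Ω x = (Λ x : ℂ) ^ n * Ω x := by
      intro n
      induction n with
      | zero =>
        refine ⟨Submodule.subset_span ⟨(0, 0), rfl⟩, fun x => ?_⟩
        rw [pow_zero, pow_zero, one_mul]
        rfl
      | succ n ih =>
        rw [pow_succ', Module.End.mul_apply]
        refine ⟨?_, fun x => ?_⟩
        · exact W.add_mem (W.smul_mem _ (W.sub_mem (hinv _ (by simp) _ ih.1)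
            (hinv _ (by simp) _ ih.1))) (W.smul_mem _ (W.sub_mem (hinv _ (by simp) _ ih.1)
            (hinv _ (by simp) _ ih.1)))
        · rw [hab, ih.2, pow_succ']
          ring
    rw [← hWu _ (hA n).1]
    refine integral_congr_ae (Eventually.of_forall fun x => ?_)
    simp only
    rw [(hA n).2, hΩr, map_mul, map_pow, conj_ofReal, conj_ofReal]
    ring
  -- The Gaussian with half the exponent dominates Ω e^|Λ| up to a constant; its product with u is
  -- integrable because both factors are in L².
  obtain ⟨g, hg⟩ := exists_schwartz_gaussian (a := 1 / (4 * l ^ 2) / 2) (by positivity)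
  have hgint : Integrable fun x => (schwartzTensor g g) x * u x :=
    MemLp.integrable_mul ((schwartzTensor g g).memLp 2 volume) (Lp.memLp u)
  have hmeas : AEStronglyMeasurable (fun x => Ω x * u x) volume :=
    Ω.continuous.aestronglyMeasurable.mul (Lp.aestronglyMeasurable u)
  have hint : ∀ Λ : StrongDual ℝ (ℝ × ℝ),
      Integrable (fun x => ‖Ω x * u x‖ * Real.exp |Λ x|) := by
    intro Λ
    refine (hgint.norm.const_mul (Real.exp (‖Λ‖ ^ 2 / (2 * (1 / (4 * l ^ 2)))))).mono'
      (hmeas.norm.mul (by fun_prop)) (Eventually.of_forall fun x => ?_)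
    have h1 := gaussian_mul_exp_le (q := 1 / (4 * l ^ 2)) (by positivity) Λ x
    have h2 : schwartzTensor g g x =
        (Real.exp (-(1 / (4 * l ^ 2) / 2 * (x.1 ^ 2 + x.2 ^ 2))) : ℝ) := by
      change g x.1 * g x.2 = _
      rw [hg, hg, ← ofReal_mul, ← Real.exp_add]
      congr 2
      ring
    rw [Real.norm_of_nonneg (by positivity), norm_mul, norm_mul, h2, hΩr, Complex.norm_real,
      Complex.norm_real, Real.norm_eq_abs, Real.norm_eq_abs, Real.abs_exp, Real.abs_exp]
    calc Real.exp (-(1 / (4 * l ^ 2) * (x.1 ^ 2 + x.2 ^ 2))) * ‖u x‖ * Real.exp |Λ x|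
        = Real.exp (-(1 / (4 * l ^ 2) * (x.1 ^ 2 + x.2 ^ 2))) * Real.exp |Λ x| * ‖u x‖ := by ring
      _ ≤ _ := by
        rw [← mul_assoc]
        gcongr
  have hset : ∀ s : Set (ℝ × ℝ), MeasurableSet s → ∫ x in s, Ω x * u x = 0 := fun s hs =>
    setIntegral_eq_zero_of_moments (τ := id) measurable_id hmeas hint hmom hs
  have hFint : Integrable fun x => Ω x * u x := by
    have h1 := hint 0
    simp only [zero_apply, abs_zero, Real.exp_zero, mul_one] at h1
    exact (integrable_norm_iff hmeas).1 h1
  have hz := hFint.ae_eq_zero_of_forall_setIntegral_eq_zero fun s hs _ => hset s hs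
  refine Lp.ext ?_
  filter_upwards [hz, Lp.coeFn_zero ℂ 2 (volume : Measure (ℝ × ℝ))] with x hx h0
  rw [h0]
  refine (mul_eq_zero.1 hx).resolve_left ?_
  rw [hΩ]
  exact exp_ne_zero _

/-- The Landau Hamiltonian and the harmonic oscillator are simultaneously diagonal. -/
theorem exists_hilbertBasis_plane (hl : 0 < l) : ∃ b : HilbertBasis (ℕ × ℕ) ℂ L2Plane,
    (∀ ε : ℝ, IsDiagonal (landauHamiltonian l ε) b
      fun p => ((ε * (p.1 + 1 / 2) : ℝ) : ℂ)) ∧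
    IsDiagonal (oscillator l) b fun p => ((p.1 + p.2 + 1 : ℝ) : ℂ) := by
  obtain ⟨Ω, hΩ, hK, hG⟩ := exists_groundState hl
  have hcK := isCanonicalPair_K hl.ne'
  have hcG := isCanonicalPair_G hl.ne'
  have hcc := areCommutingPairs_K_G hl.ne'
  have hΩ0 : schwartzToL2 Ω ≠ 0 := by
    intro h0
    have h1 : Ω = 0 := SchwartzMap.injective_toLp 2 (volume : Measure (ℝ × ℝ))
      (h0.trans (map_zero schwartzToL2).symm)
    have h2 := hΩ 0
    rw [h1] at h2
    exact exp_ne_zero _ h2.symm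
  set w := twoModeVector (schwartzK1 l) (schwartzK2 l) (schwartzG1 l) (schwartzG2 l) Ω with hw
  obtain ⟨b, hb⟩ := exists_hilbertBasis_of_orthogonal (w := fun p => schwartzToL2 (w p))
    (twoModeVector_ne_zero hcK hcG hcc hK hG hΩ0)
    (fun p q hpq => twoModeVector_orthogonal hcK hcG hcc hK hG hpq)
    (fun u hu => eq_zero_of_inner_twoModeVector hl hΩ hK hG u hu)
  have hquad : ∀ (P X : Module.End ℂ SchwartzPlane) (f : SchwartzPlane) (x : ℝ × ℝ),
      quadratic P X f x = P (P f) x + X (X f) x := fun P X f x => rfl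
  refine ⟨b, fun ε => ?_, ?_⟩
  · refine isDiagonal_closedRealization (c := fun f : SchwartzPlane => ⇑f) coeFn_schwartzToL2 rfl
      (A := ((ε / 2 : ℝ) : ℂ) • quadratic (schwartzK1 l) (schwartzK2 l)) (fun f => ?_)
      (fun u v => ?_) hb fun p => ?_
    · ext x
      rw [LinearMap.smul_apply, smul_apply, hquad]
      simp only [coe_schwartzK1, coe_schwartzK2, landauExpr, smul_eq_mul]
    · rw [LinearMap.smul_apply, LinearMap.smul_apply, map_smul, map_smul, inner_smul_left,
        inner_smul_right, hcK.symm_quadratic, conj_ofReal]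
    · rw [LinearMap.smul_apply, quadratic_twoModeVector hcK hcc hK, smul_smul]
      congr 1
      push_cast
      ring
  · refine isDiagonal_closedRealization (c := fun f : SchwartzPlane => ⇑f) coeFn_schwartzToL2 rfl
      (A := (1 / 2 : ℂ) • (quadratic (schwartzK1 l) (schwartzK2 l) +
        quadratic (schwartzG1 l) (schwartzG2 l))) (fun f => ?_) (fun u v => ?_) hb fun p => ?_
    · ext x
      rw [LinearMap.smul_apply, LinearMap.add_apply, smul_apply, add_apply, hquad, hquad]
      simp only [coe_schwartzK1, coe_schwartzK2, coe_schwartzG1, coe_schwartzG2, oscillatorExpr,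
        smul_eq_mul]
      ring
    · rw [LinearMap.smul_apply, LinearMap.smul_apply, LinearMap.add_apply, LinearMap.add_apply,
        map_smul, map_smul, map_add, map_add, inner_smul_left, inner_smul_right, inner_add_left,
        inner_add_right, hcK.symm_quadratic, hcG.symm_quadratic]
      simp only [map_div₀, map_one, map_ofNat]
    · rw [LinearMap.smul_apply, LinearMap.add_apply, quadratic_twoModeVector hcK hcc hK,
        quadratic_twoModeVector' hcG hcc hG, ← add_smul, smul_smul]
      congr 1
      push_cast
      ring

/-- In the joint basis the projection keeps the indices (j, m), on which Q_B + 2ξ is m + (j + 1 +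
2ξ); the shift is at least 1 because ξ ≥ 0. -/
theorem oscillatorInv_landauProjection (hl : 0 < l) {ε : ℝ} (hε : 0 < ε) (j : ℕ) {ξ : ℝ}
    (hξ : 0 ≤ ξ) :
    IsResolvent (oscillator l) (-(2 * ξ : ℝ)) (oscillatorInv l ξ) ∧
    IsDixmierMeasurable (oscillatorInv l ξ ∘L landauProjection l ε j) ∧
    ∀ lam : ℝ, Real.exp 1 < lam → ∀ ω : StateAtInfinity lam,
      dixmierTrace ω (oscillatorInv l ξ ∘L landauProjection l ε j) = 1 := by
  obtain ⟨b, hH, hQ⟩ := exists_hilbertBasis_plane hl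
  have hgap : ∀ p : ℕ × ℕ, (1 : ℝ) ≤
      ‖((p.1 + p.2 + 1 : ℝ) : ℂ) - ((-(2 * ξ : ℝ) : ℝ) : ℂ)‖ := fun p => by
    rw [← ofReal_sub, Complex.norm_real, Real.norm_eq_abs]
    refine le_trans ?_ (le_abs_self _)
    have h1 : (0 : ℝ) ≤ p.1 := Nat.cast_nonneg _
    have h2 : (0 : ℝ) ≤ p.2 := Nat.cast_nonneg _
    linarith
  rw [ofReal_neg] at hgap
  refine ⟨hQ.isResolvent_resolventOp one_pos hgap, ?_⟩
  refine dixmier_of_diagonal (b := b) (s := fun m => (j, m)) (c := j + 1 + 2 * ξ)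
    (d := fun p => if p.1 = j then 1 / ((p.2 : ℝ) + (j + 1 + 2 * ξ)) else 0)
    (fun m n h => (Prod.ext_iff.1 h).2) (fun x p => ?_) ?_ (fun m => if_pos rfl)
    fun p hp => if_neg fun h => hp ⟨p.2, by rw [← h]⟩
  · classical
    have h1 : ⟪b p, oscillatorInv l ξ (landauProjection l ε j x)⟫_ℂ = _ :=
      hQ.inner_resolventOp one_pos hgap p _
    have h2 : ⟪b p, landauProjection l ε j x⟫_ℂ = _ :=
      (hH ε).inner_eigenprojection (landauLevel ε j) x p
    have h3 : ((ε * (p.1 + 1 / 2) : ℝ) : ℂ) = landauLevel ε j ↔ p.1 = j := by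
      rw [landauLevel, ofReal_inj, mul_right_inj' hε.ne', add_left_inj, Nat.cast_inj]
    rw [ContinuousLinearMap.comp_apply, h1, h2]
    simp only [h3]
    split_ifs with h
    · rw [h]
      congr 1
      push_cast
      rw [one_div]
      congr 1
      ring
    · simp
  · have : (0 : ℝ) ≤ j := Nat.cast_nonneg _
    linarith

end Plane

end Landau

namespace Landau

/-! ### Translations with a phase and their action on the momenta. -/

section Shift

/-- The operator `f ↦ c e^{i α · x} f(x + s)`. -/
noncomputable def shiftPhase (c : ℂ) (α s : ℝ × ℝ) (f : ℝ × ℝ → ℂ) (x : ℝ × ℝ) : ℂ :=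
  c * exp (I * (α.1 * x.1 + α.2 * x.2)) * f (x + s)

variable {c : ℂ} {α s : ℝ × ℝ} {f : ℝ × ℝ → ℂ} {l : ℝ} {k k' : ℝ × ℝ}

theorem contDiff_phase (α : ℝ × ℝ) {n : ℕ∞} :
    ContDiff ℝ n fun x : ℝ × ℝ => exp (I * (α.1 * x.1 + α.2 * x.2)) :=
  (contDiff_const.mul ((contDiff_const.mul contDiff_ofReal_fst).add
    (contDiff_const.mul contDiff_ofReal_snd))).cexp

theorem contDiff_shiftPhase (hf : ContDiff ℝ (⊤ : ℕ∞) f) :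
    ContDiff ℝ (⊤ : ℕ∞) (shiftPhase c α s f) :=
  (contDiff_const.mul (contDiff_phase α)).mul (hf.comp (contDiff_id.add contDiff_const))

theorem shiftPhase_eq (c : ℂ) (α s : ℝ × ℝ) (f : ℝ × ℝ → ℂ) : shiftPhase c α s f =
    fun x => c * exp (I * (α.1 * x.1 + α.2 * x.2)) * f (x + s) := rfl

theorem d1_comp_add (f : ℝ × ℝ → ℂ) (s x : ℝ × ℝ) :
    d1 (fun y => f (y + s)) x = d1 f (x + s) := by
  rw [d1, fderiv_comp_add_right, d1]

theorem d2_comp_add (f : ℝ × ℝ → ℂ) (s x : ℝ × ℝ) :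
    d2 (fun y => f (y + s)) x = d2 f (x + s) := by
  rw [d2, fderiv_comp_add_right, d2]

/-- The phase adds lα₁ and the translation moves the vector potential by s₂/(2l); the hypothesis
balances the constants. The cases of use are k = k' for magnetic translations, k' = 0 for
`fibreShift`, and s = 0 for the gluing phases of the bundle. -/
theorem K1_shiftPhase (hf : Differentiable ℝ f)
    (h : l * α.1 + s.2 / (2 * l) + l * k.1 = l * k'.1) :
    K1 l k (shiftPhase c α s f) = shiftPhase c α s (K1 l k' f) := by
  have h' : (l * α.1 + s.2 / (2 * l) + l * k.1 : ℂ) = l * k'.1 := by exact_mod_cast h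
  have hg : Differentiable ℝ fun y => f (y + s) := hf.comp (differentiable_id.add_const s)
  have h1 := differentiable_ofReal_fst
  have h2 := differentiable_ofReal_snd
  ext x
  simp (disch := fun_prop) only [shiftPhase_eq, K1_apply, d1_mul, d1_add, d1_cexp, d1_const,
    d1_fst, d1_snd, d1_comp_add, Prod.snd_add, ofReal_add]
  linear_combination (exp (I * (α.1 * x.1 + α.2 * x.2)) * c * f (x + s)) * h' -
    (exp (I * (α.1 * x.1 + α.2 * x.2)) * c * f (x + s)) * l * α.1 * I_sq

theorem K2_shiftPhase (hf : Differentiable ℝ f)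
    (h : l * α.2 - s.1 / (2 * l) + l * k.2 = l * k'.2) :
    K2 l k (shiftPhase c α s f) = shiftPhase c α s (K2 l k' f) := by
  have h' : (l * α.2 - s.1 / (2 * l) + l * k.2 : ℂ) = l * k'.2 := by exact_mod_cast h
  have hg : Differentiable ℝ fun y => f (y + s) := hf.comp (differentiable_id.add_const s)
  have h1 := differentiable_ofReal_fst
  have h2 := differentiable_ofReal_snd
  ext x
  simp (disch := fun_prop) only [shiftPhase_eq, K2_apply, d2_mul, d2_add, d2_cexp, d2_const,
    d2_fst, d2_snd, d2_comp_add, Prod.fst_add, ofReal_add]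
  linear_combination (exp (I * (α.1 * x.1 + α.2 * x.2)) * c * f (x + s)) * h' -
    (exp (I * (α.1 * x.1 + α.2 * x.2)) * c * f (x + s)) * l * α.2 * I_sq

theorem shiftPhase_comm {c' : ℂ} {α' s' : ℝ × ℝ}
    (h : exp (I * (α'.1 * s.1 + α'.2 * s.2)) = exp (I * (α.1 * s'.1 + α.2 * s'.2))) :
    shiftPhase c α s (shiftPhase c' α' s' f) = shiftPhase c' α' s' (shiftPhase c α s f) := by
  ext x
  have h1 : ∀ a t : ℝ × ℝ, exp (I * (a.1 * ((x + t).1 : ℝ) + a.2 * ((x + t).2 : ℝ))) =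
      exp (I * (a.1 * x.1 + a.2 * x.2)) * exp (I * (a.1 * t.1 + a.2 * t.2)) := fun a t => by
    rw [← exp_add]
    congr 1
    simp only [Prod.fst_add, Prod.snd_add, ofReal_add]
    ring
  simp only [shiftPhase, h1, h, add_right_comm x s' s]
  ring

end Shift

/-! ### Magnetic-periodic functions and the fibre momenta. -/

section Fibre

local notation "conj" => starRingEnd ℂ

variable {l : ℝ}

theorem cellSide_pos (hl : 0 < l) : 0 < cellSide l :=
  mul_pos (Real.sqrt_pos.2 (by positivity)) hl

theorem cellSide_sq (l : ℝ) : cellSide l ^ 2 = 2 * Real.pi * l ^ 2 := by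
  rw [cellSide, mul_pow, Real.sq_sqrt (by positivity)]

theorem sqrt_pi_div_two_div (hl : 0 < l) : Real.sqrt (Real.pi / 2) / l = Real.pi / cellSide l := by
  have h1 : Real.sqrt (2 * Real.pi) = 2 * Real.sqrt (Real.pi / 2) := by
    rw [← Real.sqrt_sq (show (0 : ℝ) ≤ 2 by norm_num), ← Real.sqrt_mul (by positivity),
      Real.sqrt_sq (show (0 : ℝ) ≤ 2 by norm_num)]
    congr 1
    ring
  have h2 : Real.sqrt (Real.pi / 2) ^ 2 = Real.pi / 2 := Real.sq_sqrt (by positivity)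
  have h3 : 0 < Real.sqrt (Real.pi / 2) := Real.sqrt_pos.2 (by positivity)
  rw [cellSide, h1, div_eq_div_iff hl.ne' (by positivity)]
  linear_combination (2 * l) * h2

theorem magneticTranslation_eq (hl : 0 < l) (m : ℤ × ℤ) (f : ℝ × ℝ → ℂ) :
    magneticTranslation l m f = shiftPhase ((-1 : ℂ) ^ (m.1 * m.2))
      (Real.pi * m.2 / cellSide l, -(Real.pi * m.1 / cellSide l))
      (-(cellSide l * m.1), -(cellSide l * m.2)) f := by
  ext x
  simp only [magneticTranslation, shiftPhase]
  congr 1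
  · congr 2
    rw [show Real.sqrt (Real.pi / 2) * (m.1 * x.2 - m.2 * x.1) / l =
      (Real.sqrt (Real.pi / 2) / l) * (m.1 * x.2 - m.2 * x.1) by ring, sqrt_pi_div_two_div hl]
    push_cast
    ring

/-- The space of smooth functions that are invariant under the magnetic translations. -/
def fibreSpace (l : ℝ) : Submodule ℂ (ℝ × ℝ → ℂ) where
  carrier := fibreCore l
  add_mem' := fun {f g} hf hg => ⟨hf.1.add hg.1, fun m x => by
    have h1 := hf.2 m x
    have h2 := hg.2 m x
    simp only [magneticTranslation, Pi.add_apply] at h1 h2 ⊢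
    rw [mul_add, h1, h2]⟩
  zero_mem' := ⟨contDiff_const, fun m x => by simp [magneticTranslation]⟩
  smul_mem' := fun c f hf => ⟨contDiff_const.mul hf.1, fun m x => by
    have h1 := hf.2 m x
    simp only [magneticTranslation, Pi.smul_apply, smul_eq_mul] at h1 ⊢
    rw [mul_left_comm, h1]⟩

theorem mem_fibreSpace_iff {f : ℝ × ℝ → ℂ} : f ∈ fibreSpace l ↔
    ContDiff ℝ (⊤ : ℕ∞) f ∧ ∀ m : ℤ × ℤ, magneticTranslation l m f = f :=
  and_congr_right fun _ => forall_congr' fun _ => funext_iff.symm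

theorem contDiff_fibreSpace (f : fibreSpace l) : ContDiff ℝ (⊤ : ℕ∞) (f : ℝ × ℝ → ℂ) := f.2.1

/-- An operator that commutes with all magnetic translations preserves their invariants; the
hypothesis is equality of the two cross phases modulo 2π. -/
theorem shiftPhase_mem_fibreSpace (hl : 0 < l) {c : ℂ} {α s : ℝ × ℝ}
    (h : ∀ m : ℤ × ℤ, ∃ n : ℤ, Real.pi / cellSide l * (m.2 * s.1 - m.1 * s.2) =
      -(cellSide l * (α.1 * m.1 + α.2 * m.2)) + 2 * Real.pi * n)
    {f : ℝ × ℝ → ℂ} (hf : f ∈ fibreSpace l) : shiftPhase c α s f ∈ fibreSpace l := by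
  rw [mem_fibreSpace_iff] at hf ⊢
  refine ⟨contDiff_shiftPhase hf.1, fun m => ?_⟩
  rw [magneticTranslation_eq hl, shiftPhase_comm, ← magneticTranslation_eq hl, hf.2]
  obtain ⟨n, hn⟩ := h m
  have hn' : (Real.pi / cellSide l * (m.2 * s.1 - m.1 * s.2) : ℂ) =
      -(cellSide l * (α.1 * m.1 + α.2 * m.2)) + 2 * Real.pi * n := by exact_mod_cast hn
  refine exp_eq_exp_iff_exists_int.2 ⟨-n, ?_⟩
  push_cast
  linear_combination (-I) * hn'

theorem pi_mul_sq_div_cellSide (hl : 0 < l) : Real.pi * l ^ 2 / cellSide l = cellSide l / 2 := by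
  rw [div_eq_div_iff (cellSide_pos hl).ne' two_ne_zero, ← sq, cellSide_sq]
  ring

/-- `V_k` intertwines `K(k)` with `K(0)`. -/
noncomputable def fibreShift (l : ℝ) (k : ℝ × ℝ) : (ℝ × ℝ → ℂ) → ℝ × ℝ → ℂ :=
  shiftPhase 1 (-(k.1 / 2), -(k.2 / 2)) (l ^ 2 * k.2, -(l ^ 2 * k.1))

theorem fibreShift_mem (hl : 0 < l) (k : ℝ × ℝ) {f : ℝ × ℝ → ℂ} (hf : f ∈ fibreSpace l) :
    fibreShift l k f ∈ fibreSpace l := by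
  -- The two phases agree exactly, with no multiple of 2π; hence every real k is allowed and not
  -- only lattice points.
  refine shiftPhase_mem_fibreSpace hl (fun m => ⟨0, ?_⟩) hf
  have h1 := pi_mul_sq_div_cellSide hl
  simp only [Int.cast_zero, mul_zero, add_zero]
  linear_combination (m.2 * k.2 + m.1 * k.1) * h1

theorem K1_fibreShift (hl : 0 < l) (k : ℝ × ℝ) {f : ℝ × ℝ → ℂ} (hf : Differentiable ℝ f) :
    K1 l k (fibreShift l k f) = fibreShift l k (K1 l 0 f) := by
  refine K1_shiftPhase hf ?_
  simp only [Prod.fst_zero]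
  field_simp
  ring

theorem K2_fibreShift (hl : 0 < l) (k : ℝ × ℝ) {f : ℝ × ℝ → ℂ} (hf : Differentiable ℝ f) :
    K2 l k (fibreShift l k f) = fibreShift l k (K2 l 0 f) := by
  refine K2_shiftPhase hf ?_
  simp only [Prod.snd_zero]
  field_simp
  ring

theorem cellSide_div (hl : 0 < l) : cellSide l / (2 * l) = l * (Real.pi / cellSide l) := by
  rw [mul_div_assoc', div_eq_div_iff (by positivity) (cellSide_pos hl).ne', ← sq, cellSide_sq]
  ring

/-- `K1 l k` commutes with the magnetic translations: because the cell has area 2πl², the phase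
compensates the change of the vector potential. -/
theorem K1_mem_fibreSpace (hl : 0 < l) (k : ℝ × ℝ) {f : ℝ × ℝ → ℂ} (hf : f ∈ fibreSpace l) :
    K1 l k f ∈ fibreSpace l := by
  rw [mem_fibreSpace_iff] at hf ⊢
  refine ⟨contDiff_K1 l k hf.1, fun m => ?_⟩
  conv_rhs => rw [← hf.2 m]
  rw [magneticTranslation_eq hl, magneticTranslation_eq hl]
  refine (K1_shiftPhase (hf.1.differentiable (by simp)) ?_).symm
  linear_combination (-(m.2 : ℝ)) * cellSide_div hl

theorem K2_mem_fibreSpace (hl : 0 < l) (k : ℝ × ℝ) {f : ℝ × ℝ → ℂ} (hf : f ∈ fibreSpace l) :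
    K2 l k f ∈ fibreSpace l := by
  rw [mem_fibreSpace_iff] at hf ⊢
  refine ⟨contDiff_K2 l k hf.1, fun m => ?_⟩
  conv_rhs => rw [← hf.2 m]
  rw [magneticTranslation_eq hl, magneticTranslation_eq hl]
  refine (K2_shiftPhase (hf.1.differentiable (by simp)) ?_).symm
  linear_combination (m.1 : ℝ) * cellSide_div hl

/-- `K₁(k)` as an endomorphism of the core. -/
noncomputable def fibreK1 (hl : 0 < l) (k : ℝ × ℝ) : Module.End ℂ (fibreSpace l) where
  toFun f := ⟨K1 l k f, K1_mem_fibreSpace hl k f.2⟩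
  map_add' f g := Subtype.ext <| by
    have h1 := (contDiff_fibreSpace f).differentiable (by simp)
    have h2 := (contDiff_fibreSpace g).differentiable (by simp)
    ext x
    simp only [Submodule.coe_add, Pi.add_apply, K1,
      show d1 ((f : ℝ × ℝ → ℂ) + g) x = d1 f x + d1 g x from d1_add h1.differentiableAt h2.differentiableAt]
    ring
  map_smul' a f := Subtype.ext <| by
    have h1 := (contDiff_fibreSpace f).differentiable (by simp)
    have h2 : ∀ x, d1 (a • (f : ℝ × ℝ → ℂ)) x = a * d1 f x := fun x => by
      rw [show a • (f : ℝ × ℝ → ℂ) = fun y => a * (f : ℝ × ℝ → ℂ) y from rfl,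
        d1_mul (differentiableAt_const a) h1.differentiableAt, d1_const, zero_mul, zero_add]
    ext x
    simp only [Submodule.coe_smul, Pi.smul_apply, K1, h2, smul_eq_mul, RingHom.id_apply]
    ring

/-- `K₂(k)` as an endomorphism of the core. -/
noncomputable def fibreK2 (hl : 0 < l) (k : ℝ × ℝ) : Module.End ℂ (fibreSpace l) where
  toFun f := ⟨K2 l k f, K2_mem_fibreSpace hl k f.2⟩
  map_add' f g := Subtype.ext <| by
    have h1 := (contDiff_fibreSpace f).differentiable (by simp)
    have h2 := (contDiff_fibreSpace g).differentiable (by simp)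
    ext x
    simp only [Submodule.coe_add, Pi.add_apply, K2,
      show d2 ((f : ℝ × ℝ → ℂ) + g) x = d2 f x + d2 g x from d2_add h1.differentiableAt h2.differentiableAt]
    ring
  map_smul' a f := Subtype.ext <| by
    have h1 := (contDiff_fibreSpace f).differentiable (by simp)
    have h2 : ∀ x, d2 (a • (f : ℝ × ℝ → ℂ)) x = a * d2 f x := fun x => by
      rw [show a • (f : ℝ × ℝ → ℂ) = fun y => a * (f : ℝ × ℝ → ℂ) y from rfl,
        d2_mul (differentiableAt_const a) h1.differentiableAt, d2_const, zero_mul, zero_add]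
    ext x
    simp only [Submodule.coe_smul, Pi.smul_apply, K2, h2, smul_eq_mul, RingHom.id_apply]
    ring

/-- `V_k` as an endomorphism of the core. -/
noncomputable def fibreShiftHom (hl : 0 < l) (k : ℝ × ℝ) : Module.End ℂ (fibreSpace l) where
  toFun f := ⟨fibreShift l k f, fibreShift_mem hl k f.2⟩
  map_add' f g := Subtype.ext <| by
    ext x
    simp only [fibreShift, shiftPhase, Submodule.coe_add, Pi.add_apply]
    ring
  map_smul' a f := Subtype.ext <| by
    ext x
    simp only [fibreShift, shiftPhase, Submodule.coe_smul, Pi.smul_apply, smul_eq_mul,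
      RingHom.id_apply]
    ring

theorem isCompact_unitCell (l : ℝ) : IsCompact (unitCell l) := isCompact_Icc.prod isCompact_Icc

theorem measurableSet_unitCell (l : ℝ) : MeasurableSet (unitCell l) :=
  measurableSet_Icc.prod measurableSet_Icc

instance isFiniteMeasure_cellMeasure (l : ℝ) : IsFiniteMeasure (cellMeasure l) :=
  ⟨by rw [Measure.restrict_apply_univ]; exact (isCompact_unitCell l).measure_lt_top⟩

theorem memLp_cellMeasure {f : ℝ × ℝ → ℂ} (hf : Continuous f) (p : ℝ≥0∞) :
    MemLp f p (cellMeasure l) := by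
  obtain ⟨C, hC⟩ := (isCompact_unitCell l).exists_bound_of_continuousOn hf.continuousOn
  exact MemLp.of_bound hf.aestronglyMeasurable C
    ((ae_restrict_iff' (measurableSet_unitCell l)).2 (Eventually.of_forall hC))

/-- The inclusion of the core in `L²(Y)`. -/
noncomputable def fibreToL2 (l : ℝ) : fibreSpace l →ₗ[ℂ] L2Cell l where
  toFun f := (memLp_cellMeasure (contDiff_fibreSpace f).continuous 2).toLp _
  map_add' _ _ := MemLp.toLp_add _ _
  map_smul' _ _ := MemLp.toLp_const_smul _ _

theorem coeFn_fibreToL2 (f : fibreSpace l) :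
    (fibreToL2 l f : ℝ × ℝ → ℂ) =ᵐ[cellMeasure l] f :=
  (memLp_cellMeasure (contDiff_fibreSpace f).continuous 2).coeFn_toLp

theorem inner_fibreToL2 (f g : fibreSpace l) :
    ⟪fibreToL2 l f, fibreToL2 l g⟫_ℂ =
      ∫ x in unitCell l, conj ((f : ℝ × ℝ → ℂ) x) * (g : ℝ × ℝ → ℂ) x := by
  rw [L2.inner_def]
  refine integral_congr_ae ?_
  filter_upwards [coeFn_fibreToL2 f, coeFn_fibreToL2 g] with x h1 h2
  rw [h1, h2, RCLike.inner_apply, mul_comm]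

/-- Both functions acquire the same unimodular factor, which cancels. Opposite sides of the cell
therefore contribute equally to the divergence theorem, and the momenta are symmetric. -/
theorem fibreSpace_period (f g : fibreSpace l) (m : ℤ × ℤ) (x : ℝ × ℝ) :
    conj ((f : ℝ × ℝ → ℂ) (x + (cellSide l * m.1, cellSide l * m.2))) *
      (g : ℝ × ℝ → ℂ) (x + (cellSide l * m.1, cellSide l * m.2)) =
      conj ((f : ℝ × ℝ → ℂ) x) * (g : ℝ × ℝ → ℂ) x := by
  obtain ⟨u, hu, hT⟩ : ∃ u : ℂ, ‖u‖ = 1 ∧ ∀ f : fibreSpace l,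
      (f : ℝ × ℝ → ℂ) (x + (cellSide l * m.1, cellSide l * m.2)) = u * (f : ℝ × ℝ → ℂ) x := by
    refine ⟨(-1 : ℂ) ^ (m.1 * m.2) * exp (-I * (Real.sqrt (Real.pi / 2) *
      (m.1 * (x.2 + cellSide l * m.2) - m.2 * (x.1 + cellSide l * m.1)) / l : ℝ)), ?_, fun f => ?_⟩
    · rw [norm_mul, norm_zpow, norm_neg, norm_one, one_zpow, one_mul, neg_mul, ← mul_neg,
        ← ofReal_neg, norm_exp_I_mul_ofReal]
    · have h := f.2.2 m (x + (cellSide l * m.1, cellSide l * m.2))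
      simp only [magneticTranslation, Prod.fst_add, Prod.snd_add, add_sub_cancel_right] at h
      exact h.symm
  have h1 : conj u * u = 1 := by rw [mul_comm, mul_conj, normSq_eq_norm_sq, hu]; norm_num
  rw [hT, hT, map_mul]
  linear_combination (conj ((f : ℝ × ℝ → ℂ) x) * (g : ℝ × ℝ → ℂ) x) * h1

theorem setIntegral_unitCell_divergence (hl : 0 < l) {F G : ℝ × ℝ → ℂ} (hF : ContDiff ℝ (⊤ : ℕ∞) F)
    (hG : ContDiff ℝ (⊤ : ℕ∞) G) (hF1 : ∀ y, F (cellSide l, y) = F (0, y))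
    (hG1 : ∀ x, G (x, cellSide l) = G (x, 0)) : ∫ x in unitCell l, d1 F x + d2 G x = 0 := by
  have h := integral_divergence_prod_Icc_of_hasFDerivAt_of_le F G (fderiv ℝ F) (fderiv ℝ G)
    (0, 0) (cellSide l, cellSide l) ⟨(cellSide_pos hl).le, (cellSide_pos hl).le⟩
    hF.continuous.continuousOn hG.continuous.continuousOn
    (fun x _ => (hF.differentiable (by simp) x).hasFDerivAt)
    (fun x _ => (hG.differentiable (by simp) x).hasFDerivAt)
    ((((contDiff_d1 hF).continuous.add (contDiff_d2 hG).continuous).continuousOn).integrableOn_compact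
      isCompact_Icc)
  rw [← Set.Icc_prod_Icc] at h
  refine h.trans ?_
  simp only [hF1, hG1]
  ring

theorem contDiff_conj_mul {f g : ℝ × ℝ → ℂ} (hf : ContDiff ℝ (⊤ : ℕ∞) f)
    (hg : ContDiff ℝ (⊤ : ℕ∞) g) : ContDiff ℝ (⊤ : ℕ∞) fun x => conj (f x) * g x :=
  (conjCLE.contDiff.comp hf).mul hg

theorem hasFDerivAt_conj {f : ℝ × ℝ → ℂ} {x : ℝ × ℝ} (hf : DifferentiableAt ℝ f x) :
    HasFDerivAt (fun y => conj (f y)) ((conjCLE : ℂ →L[ℝ] ℂ) ∘L fderiv ℝ f x) x :=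
  (conjCLE : ℂ →L[ℝ] ℂ).hasFDerivAt.comp x hf.hasFDerivAt

theorem d1_conj_mul {f g : ℝ × ℝ → ℂ} {x : ℝ × ℝ} (hf : DifferentiableAt ℝ f x)
    (hg : DifferentiableAt ℝ g x) :
    d1 (fun y => conj (f y) * g y) x = conj (d1 f x) * g x + conj (f x) * d1 g x := by
  rw [d1_mul (hasFDerivAt_conj hf).differentiableAt hg, (hasFDerivAt_conj hf).d1]
  rfl

theorem d2_conj_mul {f g : ℝ × ℝ → ℂ} {x : ℝ × ℝ} (hf : DifferentiableAt ℝ f x)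
    (hg : DifferentiableAt ℝ g x) :
    d2 (fun y => conj (f y) * g y) x = conj (d2 f x) * g x + conj (f x) * d2 g x := by
  rw [d2_mul (hasFDerivAt_conj hf).differentiableAt hg, (hasFDerivAt_conj hf).d2]
  rfl

theorem integrableOn_unitCell {f : ℝ × ℝ → ℂ} (hf : Continuous f) :
    IntegrableOn f (unitCell l) :=
  hf.continuousOn.integrableOn_compact (isCompact_unitCell l)

theorem isCanonicalPair_fibre (hl : 0 < l) (k : ℝ × ℝ) :
    IsCanonicalPair (fibreToL2 l) (fibreK1 hl k) (fibreK2 hl k) where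
  symmP f g := by
    have hf := contDiff_fibreSpace f
    have hg := contDiff_fibreSpace g
    have hdf := hf.differentiable (by simp)
    have hdg := hg.differentiable (by simp)
    have h0 := setIntegral_unitCell_divergence hl (contDiff_conj_mul hf hg)
      (contDiff_const (c := (0 : ℂ))) (fun y => by
        have := fibreSpace_period f g (1, 0) (0, y)
        simpa using this) (fun _ => rfl)
    simp only [d2_const, add_zero, d1_conj_mul (hdf _) (hdg _)] at h0
    rw [inner_fibreToL2, inner_fibreToL2]
    change ∫ x in unitCell l, conj (K1 l k f x) * (g : ℝ × ℝ → ℂ) x =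
      ∫ x in unitCell l, conj ((f : ℝ × ℝ → ℂ) x) * K1 l k g x
    simp only [conj_K1_mul]
    rw [integral_add, integral_const_mul, h0, mul_zero, add_zero]
    · exact integrableOn_unitCell (contDiff_conj_mul hf (contDiff_K1 l k hg)).continuous
    · exact (integrableOn_unitCell (((contDiff_conj_mul (contDiff_d1 hf) hg).add
        (contDiff_conj_mul hf (contDiff_d1 hg))).continuous)).const_mul _
  symmX f g := by
    have hf := contDiff_fibreSpace f
    have hg := contDiff_fibreSpace g
    have hdf := hf.differentiable (by simp)
    have hdg := hg.differentiable (by simp)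
    have h0 := setIntegral_unitCell_divergence hl (contDiff_const (c := (0 : ℂ)))
      (contDiff_conj_mul hf hg) (fun _ => rfl) (fun y => by
        have := fibreSpace_period f g (0, 1) (y, 0)
        simpa using this)
    simp only [d1_const, zero_add, d2_conj_mul (hdf _) (hdg _)] at h0
    rw [inner_fibreToL2, inner_fibreToL2]
    change ∫ x in unitCell l, conj (K2 l k f x) * (g : ℝ × ℝ → ℂ) x =
      ∫ x in unitCell l, conj ((f : ℝ × ℝ → ℂ) x) * K2 l k g x
    simp only [conj_K2_mul]
    rw [integral_add, integral_const_mul, h0, mul_zero, add_zero]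
    · exact integrableOn_unitCell (contDiff_conj_mul hf (contDiff_K2 l k hg)).continuous
    · exact (integrableOn_unitCell (((contDiff_conj_mul (contDiff_d2 hf) hg).add
        (contDiff_conj_mul hf (contDiff_d2 hg))).continuous)).const_mul _
  comm f := Subtype.ext <| funext fun _ => K1_K2_comm hl.ne' (contDiff_fibreSpace f)

theorem fibreK1_fibreShiftHom (hl : 0 < l) (k : ℝ × ℝ) (f : fibreSpace l) :
    fibreK1 hl k (fibreShiftHom hl k f) = fibreShiftHom hl k (fibreK1 hl 0 f) :=
  Subtype.ext (K1_fibreShift hl k ((contDiff_fibreSpace f).differentiable (by simp)))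

theorem fibreK2_fibreShiftHom (hl : 0 < l) (k : ℝ × ℝ) (f : fibreSpace l) :
    fibreK2 hl k (fibreShiftHom hl k f) = fibreShiftHom hl k (fibreK2 hl 0 f) :=
  Subtype.ext (K2_fibreShift hl k ((contDiff_fibreSpace f).differentiable (by simp)))

end Fibre

end Landau

namespace Landau

/-! ### The magnetic-periodic ground state as a theta function. -/

section Theta

variable {l : ℝ}

/-- The wave number in the second variable of the `n`-th term of the ground state. -/
noncomputable def waveNumber (l : ℝ) (n : ℤ) (a : ℝ) : ℝ :=
  Real.pi * a / cellSide l ^ 2 + 2 * Real.pi * n / cellSide l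

/-- The `n`-th term of `K₂ᵖ` applied to the magnetic-periodic ground state. -/
noncomputable def thetaTerm (l : ℝ) (p : ℕ) (n : ℤ) (x : ℝ × ℝ) : ℂ :=
  (((x.1 + n * cellSide l) / l : ℝ) : ℂ) ^ p *
    (Real.exp (-((x.1 + n * cellSide l) ^ 2 / (2 * l ^ 2))) : ℝ) *
    exp (I * (waveNumber l n x.1 * x.2))

/-- The function `K₂ᵖ Ω`, where `Ω` is the magnetic-periodic ground state. -/
noncomputable def thetaSum (l : ℝ) (p : ℕ) (x : ℝ × ℝ) : ℂ := ∑' n : ℤ, thetaTerm l p n x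

theorem thetaTerm_succ (l : ℝ) (p : ℕ) (n : ℤ) (x : ℝ × ℝ) :
    thetaTerm l (p + 1) n x = (((x.1 + n * cellSide l) / l : ℝ) : ℂ) * thetaTerm l p n x := by
  rw [thetaTerm, thetaTerm, pow_succ']
  ring

theorem norm_thetaTerm (l : ℝ) (p : ℕ) (n : ℤ) (x : ℝ × ℝ) :
    ‖thetaTerm l p n x‖ = |(x.1 + n * cellSide l) / l| ^ p *
      Real.exp (-((x.1 + n * cellSide l) ^ 2 / (2 * l ^ 2))) := by
  rw [thetaTerm, norm_mul, norm_mul, norm_pow, Complex.norm_real, Complex.norm_real,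
    ← ofReal_mul, norm_exp_I_mul_ofReal, mul_one, Real.norm_eq_abs, Real.norm_eq_abs, Real.abs_exp]

theorem summable_exp_neg_abs {L : ℝ} (hL : 0 < L) (a : ℝ) :
    Summable fun n : ℤ => Real.exp (-|a + n * L|) := by
  have h1 : Summable fun n : ℕ => Real.exp (-(n * L)) := by
    have := Real.summable_exp_nat_mul_iff.2 (neg_lt_zero.2 hL)
    simpa using this
  have h2 : Summable fun n : ℤ => Real.exp (-|n * L|) := by
    refine Summable.of_nat_of_neg ?_ ?_
    · simpa [abs_of_pos hL, abs_mul] using h1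
    · simpa [abs_of_pos hL, abs_mul] using h1
  refine (h2.mul_left (Real.exp |a|)).of_nonneg_of_le (fun _ => (Real.exp_pos _).le) fun n => ?_
  rw [← Real.exp_add]
  refine Real.exp_le_exp.2 ?_
  have := abs_sub_abs_le_abs_sub (n * L) (-a)
  rw [abs_neg, sub_neg_eq_add, add_comm (n * L) a] at this
  linarith

/-- The weight e^(c|t|) is not needed for the convergence of the series but for the exponential
decay in the moment problem. -/
theorem exists_pow_mul_exp_le (hl : 0 < l) (p : ℕ) (c : ℝ) : ∃ C, 0 ≤ C ∧ ∀ t : ℝ,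
    |t / l| ^ p * Real.exp (-(t ^ 2 / (2 * l ^ 2))) * Real.exp (c * |t|) ≤
      C * Real.exp (-|t|) := by
  refine ⟨1 / l ^ p * (p.factorial * Real.exp ((c + 1 + 1) ^ 2 / (4 * (1 / (2 * l ^ 2))))),
    by positivity, fun t => ?_⟩
  have h1 := abs_pow_mul_exp_le p (c + 1) (a := 1 / (2 * l ^ 2)) (by positivity) t
  calc |t / l| ^ p * Real.exp (-(t ^ 2 / (2 * l ^ 2))) * Real.exp (c * |t|)
      = 1 / l ^ p * (|t| ^ p * Real.exp ((c + 1) * |t|) *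
          Real.exp (-(1 / (2 * l ^ 2) * t ^ 2))) * Real.exp (-|t|) := by
        rw [abs_div, abs_of_pos hl, div_pow, add_mul, Real.exp_add, one_mul,
          show -(1 / (2 * l ^ 2) * t ^ 2) = -(t ^ 2 / (2 * l ^ 2)) by ring, Real.exp_neg |t|]
        field_simp
    _ ≤ _ := by gcongr

theorem summable_norm_thetaTerm (hl : 0 < l) (p : ℕ) (a : ℝ) :
    Summable fun n : ℤ => |(a + n * cellSide l) / l| ^ p *
      Real.exp (-((a + n * cellSide l) ^ 2 / (2 * l ^ 2))) := by
  obtain ⟨C, -, hC⟩ := exists_pow_mul_exp_le hl p 0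
  refine ((summable_exp_neg_abs (cellSide_pos hl) a).mul_left C).of_nonneg_of_le
    (fun _ => by positivity) fun n => ?_
  simpa using hC (a + n * cellSide l)

theorem summable_thetaTerm (hl : 0 < l) (p : ℕ) (x : ℝ × ℝ) :
    Summable fun n : ℤ => thetaTerm l p n x := by
  refine Summable.of_norm ?_
  simp only [norm_thetaTerm]
  exact summable_norm_thetaTerm hl p x.1

/-- The derivative of the phase and the vector potential add up, so K₂ multiplies the n-th term by
(x₁ + nL)/l, where L is the cell side. This is why the powers of K₂ produce moments. -/
theorem mul_waveNumber (hl : 0 < l) (n : ℤ) (a : ℝ) :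
    l * waveNumber l n a + a / (2 * l) = (a + n * cellSide l) / l := by
  have h1 := cellSide_sq l
  have hL := (cellSide_pos hl).ne'
  rw [waveNumber]
  have h2 : l * (Real.pi * a / cellSide l ^ 2) = a / (2 * l) := by
    rw [h1]
    have := Real.pi_ne_zero
    field_simp
  have h3 : l * (2 * Real.pi * n / cellSide l) = n * cellSide l / l := by
    rw [mul_div_assoc', div_eq_div_iff hL hl.ne']
    linear_combination (-(n : ℝ)) * h1
  rw [mul_add, h2, h3]
  field_simp
  ring

theorem hasDerivAt_thetaTerm (l : ℝ) (p : ℕ) (n : ℤ) (a b : ℝ) :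
    HasDerivAt (fun y : ℝ => thetaTerm l p n (a, y))
      (I * waveNumber l n a * thetaTerm l p n (a, b)) b := by
  have h1 : HasDerivAt (fun y : ℝ => I * ((waveNumber l n a : ℂ) * (y : ℂ)))
      (I * (waveNumber l n a * 1)) b :=
    ((ofRealCLM.hasDerivAt (x := b)).const_mul (waveNumber l n a : ℂ)).const_mul I
  have h2 := (h1.cexp).const_mul ((((a + n * cellSide l) / l : ℝ) : ℂ) ^ p *
    (Real.exp (-((a + n * cellSide l) ^ 2 / (2 * l ^ 2))) : ℝ))
  refine h2.congr_deriv ?_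
  rw [thetaTerm]
  ring

/-- The moduli of the terms do not depend on the second variable, so the dominating series for
termwise differentiation is uniform in it. -/
theorem hasDerivAt_thetaSum (hl : 0 < l) (p : ℕ) (a b : ℝ) :
    HasDerivAt (fun y : ℝ => thetaSum l p (a, y))
      (∑' n : ℤ, I * waveNumber l n a * thetaTerm l p n (a, b)) b := by
  have hk : ∀ n, ‖(waveNumber l n a : ℂ)‖ ≤
      l⁻¹ * (|(a + n * cellSide l) / l| + |a / (2 * l)|) := fun n => by
    rw [Complex.norm_real, Real.norm_eq_abs, le_inv_mul_iff₀ hl, ← abs_of_pos hl, ← abs_mul,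
      abs_of_pos hl, ← mul_waveNumber hl n a]
    have := abs_sub_abs_le_abs_sub (l * waveNumber l n a) (-(a / (2 * l)))
    rw [abs_neg, sub_neg_eq_add] at this
    linarith
  refine hasDerivAt_tsum (u := fun n : ℤ => l⁻¹ * (|(a + n * cellSide l) / l| ^ (p + 1) *
      Real.exp (-((a + n * cellSide l) ^ 2 / (2 * l ^ 2))) + |a / (2 * l)| *
      (|(a + n * cellSide l) / l| ^ p * Real.exp (-((a + n * cellSide l) ^ 2 / (2 * l ^ 2))))))
    (((summable_norm_thetaTerm hl (p + 1) a).add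
      ((summable_norm_thetaTerm hl p a).mul_left _)).mul_left _)
    (fun n y => hasDerivAt_thetaTerm l p n a y) (fun n y => ?_)
    (summable_thetaTerm hl p (a, 0)) b
  rw [norm_mul, norm_mul, norm_I, one_mul, norm_thetaTerm]
  refine (mul_le_mul_of_nonneg_right (hk n) (by positivity)).trans (le_of_eq ?_)
  ring

theorem K2_thetaSum (hl : 0 < l) {p : ℕ} (hd : Differentiable ℝ (thetaSum l p)) :
    K2 l 0 (thetaSum l p) = thetaSum l (p + 1) := by
  ext ⟨a, b⟩
  have h1 : d2 (thetaSum l p) (a, b) =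
      ∑' n : ℤ, I * waveNumber l n a * thetaTerm l p n (a, b) := by
    have h2 : HasDerivAt (fun y : ℝ => (a, y)) ((0 : ℝ), (1 : ℝ)) b :=
      (hasDerivAt_const b a).prodMk (hasDerivAt_id b)
    have h3 := (hd (a, b)).hasFDerivAt.comp_hasDerivAt b h2
    exact h3.unique (hasDerivAt_thetaSum hl p a b)
  have hs := summable_thetaTerm hl p (a, b)
  have hs1 : Summable fun n => I * waveNumber l n a * thetaTerm l p n (a, b) := by
    have h4 : ∀ n, I * waveNumber l n a * thetaTerm l p n (a, b) =
        (I / l) * (thetaTerm l (p + 1) n (a, b) - (a / (2 * l) : ℝ) * thetaTerm l p n (a, b)) := by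
      intro n
      rw [thetaTerm_succ, ← mul_waveNumber hl n a]
      have hl' : (l : ℂ) ≠ 0 := by exact_mod_cast hl.ne'
      push_cast
      field_simp
      ring
    simp only [h4]
    exact ((summable_thetaTerm hl (p + 1) (a, b)).sub (hs.mul_left _)).mul_left _
  simp only [K2, h1, Prod.snd_zero, mul_zero, ofReal_zero, zero_mul, add_zero]
  rw [thetaSum, thetaSum, ← tsum_mul_left, ← tsum_mul_left, ← (hs1.mul_left _).tsum_add (hs.mul_left _)]
  refine tsum_congr fun n => ?_
  rw [thetaTerm_succ, ← mul_waveNumber hl n a]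
  push_cast
  linear_combination (-(l * waveNumber l n a * thetaTerm l p n (a, b))) * I_sq

/-- Expanding the square in the exponent isolates the terms in n and n²; the square cell gives the
modulus i. Smoothness in both variables then comes from holomorphy of the theta function. -/
theorem thetaTerm_zero_eq (hl : 0 < l) (n : ℤ) (x : ℝ × ℝ) :
    thetaTerm l 0 n x = exp ((Real.pi / cellSide l ^ 2 : ℝ) * (I * (x.1 * x.2) - x.1 * x.1)) *
      jacobiTheta₂_term n ((1 / cellSide l : ℝ) * (x.2 + I * x.1)) I := by
  have hL : (cellSide l : ℂ) ≠ 0 := by exact_mod_cast (cellSide_pos hl).ne'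
  have hpi := Real.pi_ne_zero
  have h1 : (x.1 + n * cellSide l) ^ 2 / (2 * l ^ 2) =
      Real.pi * (x.1 + n * cellSide l) ^ 2 / cellSide l ^ 2 := by
    rw [cellSide_sq]
    field_simp
  rw [thetaTerm, pow_zero, one_mul, h1, jacobiTheta₂_term, ofReal_exp, ← exp_add, ← exp_add]
  congr 1
  simp only [waveNumber]
  push_cast
  field_simp
  linear_combination (-(2 * n * x.1 * cellSide l + n ^ 2 * cellSide l ^ 2)) * I_sq

theorem thetaSum_zero_eq (hl : 0 < l) : thetaSum l 0 = fun x : ℝ × ℝ =>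
    exp ((Real.pi / cellSide l ^ 2 : ℝ) * (I * (x.1 * x.2) - x.1 * x.1)) *
      jacobiTheta₂ ((1 / cellSide l : ℝ) * (x.2 + I * x.1)) I := by
  ext x
  simp only [thetaSum, thetaTerm_zero_eq hl, tsum_mul_left, jacobiTheta₂]

theorem differentiable_jacobiTheta₂_I : Differentiable ℂ fun z => jacobiTheta₂ z I := fun z =>
  differentiableAt_jacobiTheta₂_fst z (by simp)

theorem contDiff_thetaSum_zero (hl : 0 < l) : ContDiff ℝ (⊤ : ℕ∞) (thetaSum l 0) := by
  rw [thetaSum_zero_eq hl]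
  have h1 := contDiff_ofReal_fst (n := ⊤)
  have h2 := contDiff_ofReal_snd (n := ⊤)
  have h3 : ContDiff ℝ (⊤ : ℕ∞) fun z => jacobiTheta₂ z I :=
    (differentiable_jacobiTheta₂_I.contDiff (n := (⊤ : ℕ∞))).restrict_scalars ℝ
  exact ((contDiff_const.mul ((contDiff_const.mul (h1.mul h2)).sub (h1.mul h1))).cexp).mul
    (h3.comp (contDiff_const.mul (h2.add (contDiff_const.mul h1))))

theorem magneticTranslation_thetaSum (hl : 0 < l) (m : ℤ × ℤ) :
    magneticTranslation l m (thetaSum l 0) = thetaSum l 0 := by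
  have hL : (cellSide l : ℂ) ≠ 0 := by exact_mod_cast (cellSide_pos hl).ne'
  have hneg : (-1 : ℂ) ^ (m.1 * m.2) = exp (Real.pi * I * (m.1 * m.2 : ℤ)) := by
    rw [mul_comm (Real.pi * I), exp_int_mul, exp_pi_mul_I]
  rw [magneticTranslation_eq hl]
  ext x
  rw [shiftPhase, thetaSum, thetaSum, ← (Equiv.addRight m.1).tsum_eq, ← tsum_mul_left]
  refine tsum_congr fun n => ?_
  have h1 : x.1 + -(cellSide l * m.1) + ((n + m.1 : ℤ) : ℝ) * cellSide l =
      x.1 + n * cellSide l := by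
    push_cast
    ring
  simp only [thetaTerm, Equiv.coe_addRight, Prod.fst_add, Prod.snd_add, h1, pow_zero, one_mul]
  rw [mul_left_comm, hneg, ← exp_add, ← exp_add]
  congr 1
  -- After the reindexing n ↦ n + m₁ the Gaussians agree, and the phases differ by 2πi times -n m₂.
  refine exp_eq_exp_iff_exists_int.2 ⟨-(n * m.2), ?_⟩
  simp only [waveNumber]
  push_cast
  field_simp
  ring

/-- The magnetic-periodic ground state. -/
noncomputable def groundState (hl : 0 < l) : fibreSpace l :=
  ⟨thetaSum l 0, mem_fibreSpace_iff.2
    ⟨contDiff_thetaSum_zero hl, magneticTranslation_thetaSum hl⟩⟩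

/-- The differentiability of `thetaSum l p` that the next step requires is inherited from membership
in the core; only p = 0 is checked by hand. -/
theorem fibreK2_pow_groundState (hl : 0 < l) (p : ℕ) :
    (((fibreK2 hl 0) ^ p) (groundState hl) : ℝ × ℝ → ℂ) = thetaSum l p := by
  induction p with
  | zero => rfl
  | succ p ih =>
    rw [pow_succ', Module.End.mul_apply]
    change K2 l 0 (((fibreK2 hl 0) ^ p) (groundState hl) : ℝ × ℝ → ℂ) = _
    have h := (contDiff_fibreSpace (((fibreK2 hl 0) ^ p) (groundState hl))).differentiable (by simp)
    rw [ih] at h ⊢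
    exact K2_thetaSum hl h

/-- The theta factor is holomorphic in x₂ + ix₁. Its Cauchy–Riemann equation cancels the derivatives
of this factor, and the exponential prefactor cancels the vector potential. -/
theorem lowering_groundState (hl : 0 < l) :
    lowering (fibreK1 hl 0) (fibreK2 hl 0) (groundState hl) = 0 := by
  refine Subtype.ext (funext fun x => ?_)
  change K2 l 0 (thetaSum l 0) x + I * K1 l 0 (thetaSum l 0) x = 0
  have h1 := differentiable_ofReal_fst
  have h2 := differentiable_ofReal_snd
  obtain ⟨φ, hφ, h4, h5⟩ : ∃ φ : ℝ × ℝ → ℂ, (thetaSum l 0 = fun x : ℝ × ℝ =>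
      exp ((Real.pi / cellSide l ^ 2 : ℝ) * (I * (x.1 * x.2) - x.1 * x.1)) * φ x) ∧
      Differentiable ℝ φ ∧ d2 φ x = -I * d1 φ x := by
    have h3 : ∀ y : ℝ × ℝ, HasFDerivAt
        (fun y : ℝ × ℝ => jacobiTheta₂ ((1 / cellSide l : ℝ) * (y.2 + I * y.1)) I)
        ((deriv (fun z => jacobiTheta₂ z I)
        ((1 / cellSide l : ℝ) * (y.2 + I * y.1))) • (((1 / cellSide l : ℝ) : ℂ) •
        ((ofRealCLM ∘L ContinuousLinearMap.snd ℝ ℝ ℝ) +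
          I • (ofRealCLM ∘L ContinuousLinearMap.fst ℝ ℝ ℝ)))) y := fun y =>
      (differentiable_jacobiTheta₂_I _).hasDerivAt.comp_hasFDerivAt y
        ((hasFDerivAt_ofReal_snd.add (hasFDerivAt_ofReal_fst.const_mul I)).const_mul _)
    refine ⟨_, thetaSum_zero_eq hl, fun y => (h3 y).differentiableAt, ?_⟩
    rw [(h3 x).d1, (h3 x).d2]
    generalize deriv (fun z => jacobiTheta₂ z I) _ = D
    simp
    linear_combination (D * (cellSide l : ℂ)⁻¹) * I_sq
  have hL := cellSide_sq l
  have hL' : (cellSide l : ℂ) ^ 2 = 2 * Real.pi * l ^ 2 := by exact_mod_cast hL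
  have hl' : (l : ℂ) ≠ 0 := by exact_mod_cast hl.ne'
  have hpi : (Real.pi : ℂ) ≠ 0 := by exact_mod_cast Real.pi_ne_zero
  rw [hφ]
  simp (disch := fun_prop) only [K1_apply, K2_apply, d1_mul, d1_sub, d1_cexp, d1_const, d1_fst,
    d1_snd, d2_mul, d2_sub, d2_cexp, d2_const, d2_fst, d2_snd]
  simp only [h5, Prod.fst_zero, Prod.snd_zero, ofReal_zero]
  push_cast
  rw [hL']
  field_simp
  ring_nf
  simp only [I_sq, I_pow_three]
  ring

end Theta

end Landau

namespace Landau

/-! ### Completeness of the magnetic-periodic states on the unit cell. -/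

section Completeness

local notation "conj" => starRingEnd ℂ

variable {l : ℝ}

/-- A square integrable function with vanishing Fourier coefficients vanishes. -/
theorem integral_norm_sq_eq_zero_of_fourier {L : ℝ} (hL : 0 < L) {f : ℝ → ℂ}
    (hf : MemLp f 2 (volume.restrict (Set.Icc 0 L)))
    (h : ∀ n : ℤ, ∫ y in Set.Icc 0 L, exp (-I * (2 * Real.pi * n / L * y : ℝ)) * f y = 0) :
    ∫ y in Set.Icc 0 L, ‖f y‖ ^ 2 = 0 := by
  rw [← restrict_Ioc_eq_restrict_Icc] at hf h ⊢
  have h1 := tsum_sq_fourierCoeffOn hL hf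
  have h2 : ∀ n : ℤ, fourierCoeffOn hL f n = 0 := fun n => by
    suffices h3 : ∫ y in Set.Ioc 0 L, fourier (-n) (y : AddCircle (L - 0)) • f y = 0 by
      rw [fourierCoeffOn_eq_integral, intervalIntegral.integral_of_le hL.le, h3, smul_zero]
    rw [← h n]
    refine integral_congr_ae (Eventually.of_forall fun y => ?_)
    simp only [fourier_coe_apply, smul_eq_mul]
    congr 2
    push_cast
    ring
  simp only [h2, norm_zero, ne_eq, OfNat.ofNat_ne_zero, not_false_eq_true, zero_pow, tsum_zero,
    sub_zero, smul_eq_mul] at h1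
  rw [intervalIntegral.integral_of_le hL.le] at h1
  exact (mul_eq_zero.1 h1.symm).resolve_left (inv_ne_zero hL.ne')

theorem cellMeasure_eq_prod (l : ℝ) : cellMeasure l =
    (volume.restrict (Set.Icc 0 (cellSide l))).prod (volume.restrict (Set.Icc 0 (cellSide l))) := by
  rw [Measure.prod_restrict, ← Measure.volume_eq_prod]
  rfl

/-- A function on the cell vanishes if its Fourier coefficients in the second variable do. -/
theorem eq_zero_of_partial_fourier (hl : 0 < l) {u : ℝ × ℝ → ℂ} (hu2 : MemLp u 2 (cellMeasure l))
    (c : ℝ → ℝ)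
    (h : ∀ n : ℤ, ∀ᵐ a ∂volume.restrict (Set.Icc 0 (cellSide l)),
      ∫ y in Set.Icc 0 (cellSide l),
        exp (-I * ((c a + 2 * Real.pi * n / cellSide l) * y : ℝ)) * u (a, y) = 0) : u =ᵐ[cellMeasure l] 0 := by
  have hL := cellSide_pos hl
  have hu : AEStronglyMeasurable u (cellMeasure l) := hu2.1
  have hsq : Integrable (fun x => ‖u x‖ ^ 2) (cellMeasure l) :=
    (memLp_two_iff_integrable_sq_norm hu).1 hu2
  have hsq' := hsq
  have hu' := hu
  rw [cellMeasure_eq_prod] at hsq' hu'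
  have h0 : ∫ x, ‖u x‖ ^ 2 ∂cellMeasure l = 0 := by
    rw [cellMeasure_eq_prod, integral_prod _ hsq']
    refine integral_eq_zero_of_ae ?_
    filter_upwards [ae_all_iff.2 h, hsq'.prod_right_ae, hu'.prodMk_left] with a h1 h2 h3
    have h4 : ∀ y : ℝ, ‖exp (-I * (c a * y : ℝ)) * u (a, y)‖ = ‖u (a, y)‖ := fun y => by
      rw [norm_mul, neg_mul, ← mul_neg, ← ofReal_neg, norm_exp_I_mul_ofReal, one_mul]
    have h5 : AEStronglyMeasurable (fun y : ℝ => exp (-I * (c a * y : ℝ)) * u (a, y))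
        (volume.restrict (Set.Icc 0 (cellSide l))) :=
      (Continuous.aestronglyMeasurable (by fun_prop)).mul h3
    have h6 := integral_norm_sq_eq_zero_of_fourier hL
      (f := fun y => exp (-I * (c a * y : ℝ)) * u (a, y))
      ((memLp_two_iff_integrable_sq_norm h5).2 (by simpa only [h4] using h2)) fun n => by
        rw [← h1 n]
        refine integral_congr_ae (Eventually.of_forall fun y => ?_)
        simp only
        rw [← mul_assoc, ← exp_add]
        congr 2
        push_cast
        ring
    simpa only [h4, Pi.zero_apply] using h6
  have h1 := (integral_eq_zero_iff_of_nonneg (fun x => by positivity) hsq).1 h0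
  filter_upwards [h1] with x hx
  simpa using hx

theorem continuous_thetaTerm (l : ℝ) (p : ℕ) (n : ℤ) : Continuous (thetaTerm l p n) := by
  unfold thetaTerm waveNumber
  fun_prop

/-- The kernel on `Y × ℤ` whose moments are the inner products with the functions `K₂ᵖ Ω`. -/
noncomputable def thetaKernel (l : ℝ) (α s : ℝ × ℝ) (u : ℝ × ℝ → ℂ) (p : ℕ)
    (q : (ℝ × ℝ) × ℤ) : ℂ :=
  conj (exp (I * (α.1 * q.1.1 + α.2 * q.1.2)) * thetaTerm l p q.2 (q.1 + s)) * u q.1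

theorem aestronglyMeasurable_thetaKernel (α s : ℝ × ℝ) {u : ℝ × ℝ → ℂ}
    (hu : MemLp u 2 (cellMeasure l)) (p : ℕ) :
    AEStronglyMeasurable (thetaKernel l α s u p) ((cellMeasure l).prod Measure.count) := by
  refine AEStronglyMeasurable.mul ?_ hu.1.comp_fst
  refine (measurable_from_prod_countable_left fun n => ?_).aestronglyMeasurable
  exact (continuous_conj.comp ((by fun_prop : Continuous fun x : ℝ × ℝ =>
    exp (I * (α.1 * x.1 + α.2 * x.2))).mul
    ((continuous_thetaTerm l p n).comp (continuous_id.add continuous_const)))).measurable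

theorem norm_thetaKernel (l : ℝ) (α s : ℝ × ℝ) (u : ℝ × ℝ → ℂ) (p : ℕ) (q : (ℝ × ℝ) × ℤ) :
    ‖thetaKernel l α s u p q‖ = |(q.1.1 + s.1 + q.2 * cellSide l) / l| ^ p *
      Real.exp (-((q.1.1 + s.1 + q.2 * cellSide l) ^ 2 / (2 * l ^ 2))) * ‖u q.1‖ := by
  rw [thetaKernel, norm_mul, RCLike.norm_conj, norm_mul, norm_thetaTerm, Prod.fst_add]
  norm_cast
  rw [norm_exp_I_mul_ofReal, one_mul]

theorem integrable_thetaKernel_mul_exp (hl : 0 < l) (α s : ℝ × ℝ) {u : ℝ × ℝ → ℂ}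
    (hu : MemLp u 2 (cellMeasure l)) (p : ℕ) (c : ℝ) :
    Integrable (fun q : (ℝ × ℝ) × ℤ => ‖thetaKernel l α s u p q‖ *
      Real.exp (c * |q.1.1 + s.1 + q.2 * cellSide l|)) ((cellMeasure l).prod Measure.count) := by
  obtain ⟨C, hC0, hC⟩ := exists_pow_mul_exp_le hl p c
  have h1 : Integrable (fun x : ℝ × ℝ => (Real.exp |x.1 + s.1| : ℂ) * u x) (cellMeasure l) :=
    MemLp.integrable_mul (memLp_cellMeasure (by fun_prop) 2) hu
  have h2 : Integrable (fun n : ℤ => Real.exp (-|0 + n * cellSide l|)) Measure.count :=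
    integrable_count_iff.2 <| by
      simpa only [Real.norm_eq_abs, Real.abs_exp] using summable_exp_neg_abs (cellSide_pos hl) 0
  refine ((h1.norm.mul_prod h2).const_mul C).mono' ?_ (Eventually.of_forall fun q => ?_)
  · refine (aestronglyMeasurable_thetaKernel α s hu p).norm.mul ?_
    refine (measurable_from_prod_countable_left fun n => ?_).aestronglyMeasurable
    exact Continuous.measurable (by fun_prop)
  · rw [Real.norm_of_nonneg (by positivity), norm_thetaKernel, mul_right_comm, norm_mul,
      Complex.norm_real, Real.norm_eq_abs, Real.abs_exp, zero_add]
    calc _ ≤ C * Real.exp (-|q.1.1 + s.1 + q.2 * cellSide l|) * ‖u q.1‖ :=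
        mul_le_mul_of_nonneg_right (hC _) (norm_nonneg _)
      _ ≤ C * (Real.exp |q.1.1 + s.1| * Real.exp (-|q.2 * cellSide l|)) * ‖u q.1‖ := by
        rw [← Real.exp_add]
        gcongr
        have := abs_sub_abs_le_abs_sub (q.2 * cellSide l) (-(q.1.1 + s.1))
        rw [abs_neg, sub_neg_eq_add, add_comm (q.2 * cellSide l)] at this
        linarith
      _ = _ := by ring

/-- Unfolding: with counting measure on ℤ, the series inside the inner product becomes an integral
over the cell times ℤ. -/
theorem integral_thetaKernel (hl : 0 < l) (α s : ℝ × ℝ) {u : ℝ × ℝ → ℂ}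
    (hu : MemLp u 2 (cellMeasure l)) (p : ℕ) :
    ∫ q, thetaKernel l α s u p q ∂(cellMeasure l).prod Measure.count =
      ∫ x in unitCell l, conj (shiftPhase 1 α s (thetaSum l p) x) * u x := by
  have hint : Integrable (thetaKernel l α s u p) ((cellMeasure l).prod Measure.count) := by
    have := integrable_thetaKernel_mul_exp hl α s hu p 0
    simp only [zero_mul, Real.exp_zero, mul_one] at this
    exact (integrable_norm_iff (aestronglyMeasurable_thetaKernel α s hu p)).1 this
  rw [integral_prod _ hint]
  refine integral_congr_ae ?_
  filter_upwards [hint.prod_right_ae] with x hx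
  rw [integral_countable hx]
  simp only [count_real_singleton, one_smul, thetaKernel, shiftPhase, one_mul, thetaSum]
  rw [tsum_mul_right, ← tsum_mul_left, conj_tsum]

/-- On Y × ℤ put τ = x₁ + s₁ + nL, L being the cell side. The hypotheses say that all moments of the
kernel in τ vanish, so it integrates to zero over τ⁻¹(S) for every S. Away from the cell boundary τ
determines both x₁ and n, so this isolates each n and almost every x₁. What is left is a nonzero
multiple of the n-th Fourier coefficient in x₂ of u times a phase, and Parseval finishes. -/
theorem eq_zero_of_integral_thetaSum (hl : 0 < l) (α s : ℝ × ℝ) {u : ℝ × ℝ → ℂ}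
    (hu : MemLp u 2 (cellMeasure l)) (hu0 : ∀ p, ∫ x in unitCell l, conj (shiftPhase 1 α s (thetaSum l p) x) * u x = 0) :
    u =ᵐ[cellMeasure l] 0 := by
  have hL := cellSide_pos hl
  have hl' : (l : ℂ) ≠ 0 := by exact_mod_cast hl.ne'
  set τ : (ℝ × ℝ) × ℤ → ℝ := fun q => q.1.1 + s.1 + q.2 * cellSide l with hτ
  have hτm : Measurable τ := measurable_from_prod_countable_left fun n =>
    Continuous.measurable (by fun_prop)
  have hF0 := aestronglyMeasurable_thetaKernel α s hu 0
  have hΛ : ∀ (Λ : StrongDual ℝ ℝ) (t : ℝ), Λ t = t * Λ 1 := fun Λ t => by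
    conv_lhs => rw [show t = t • (1 : ℝ) by simp, map_smul, smul_eq_mul]
  have hset : ∀ S : Set ℝ, MeasurableSet S →
      ∫ q in τ ⁻¹' S, thetaKernel l α s u 0 q ∂(cellMeasure l).prod Measure.count = 0 := by
    intro S hS
    refine setIntegral_eq_zero_of_moments hτm hF0 (fun Λ => ?_) (fun Λ p => ?_) hS
    · have := integrable_thetaKernel_mul_exp hl α s hu 0 |Λ 1|
      refine this.congr (Eventually.of_forall fun q => ?_)
      change _ = ‖thetaKernel l α s u 0 q‖ * Real.exp |Λ (τ q)|
      rw [hΛ Λ (τ q), abs_mul, mul_comm |τ q|]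
    · have h1 : ∀ q, thetaKernel l α s u 0 q * (Λ (τ q) : ℂ) ^ p =
          (l * Λ 1 : ℂ) ^ p * thetaKernel l α s u p q := fun q => by
        have h2 : thetaTerm l p q.2 (q.1 + s) =
            (((τ q) / l : ℝ) : ℂ) ^ p * thetaTerm l 0 q.2 (q.1 + s) := by
          simp only [thetaTerm, pow_zero, one_mul, hτ, Prod.fst_add]
          ring
        rw [hΛ Λ (τ q), thetaKernel, thetaKernel, h2, map_mul, map_mul, map_mul, map_pow,
          conj_ofReal]
        push_cast
        have h3 : ((τ q : ℂ) * Λ 1) ^ p = (l * Λ 1 : ℂ) ^ p * ((τ q : ℂ) / l) ^ p := by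
          rw [← mul_pow]
          congr 1
          field_simp
        rw [h3]
        ring
      simp only [h1]
      rw [integral_const_mul, integral_thetaKernel hl α s hu, hu0, mul_zero]
  have hint : Integrable (thetaKernel l α s u 0) ((cellMeasure l).prod Measure.count) := by
    have := integrable_thetaKernel_mul_exp hl α s hu 0 0
    simp only [zero_mul, Real.exp_zero, mul_one] at this
    exact (integrable_norm_iff hF0).1 this
  have hslice : ∀ n : ℤ, Integrable (fun x => thetaKernel l α s u 0 (x, n)) (cellMeasure l) := by
    intro n
    have h1 := hint.prod_left_ae
    exact (ae_iff_of_countable.1 h1) n (by simp)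
  refine eq_zero_of_partial_fourier hl hu (fun a => α.2 + Real.pi * (a + s.1) / cellSide l ^ 2)
    fun n => ?_
  set μ1 := (volume : Measure ℝ).restrict (Set.Icc 0 (cellSide l)) with hμ1
  have hsl := hslice n
  rw [cellMeasure_eq_prod] at hsl
  -- The open interval excludes the endpoints, where a value of τ belongs to two consecutive n.
  have hφ : ∀ᵐ a ∂μ1.restrict (Set.Ioo 0 (cellSide l)),
      ∫ y, thetaKernel l α s u 0 ((a, y), n) ∂μ1 = 0 := by
    refine Integrable.ae_eq_zero_of_forall_setIntegral_eq_zero hsl.integral_prod_left.restrict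
      fun A hA _ => ?_
    rw [Measure.restrict_restrict hA]
    set B := A ∩ Set.Ioo 0 (cellSide l)
    have hB : MeasurableSet B := hA.inter measurableSet_Ioo
    -- The set tested is B moved to the n-th copy of the cell on the τ-line.
    have h1 := hset ((fun t => t - s.1 - n * cellSide l) ⁻¹' B)
      (hB.preimage (by fun_prop))
    rw [← integral_indicator (hτm (hB.preimage (by fun_prop))), integral_prod _
      (hint.indicator (hτm (hB.preimage (by fun_prop))))] at h1
    rw [← integral_indicator hB]
    have h2 : Integrable ((Prod.fst ⁻¹' B).indicator fun x : ℝ × ℝ => thetaKernel l α s u 0 (x, n))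
      (μ1.prod μ1) := hsl.indicator (measurable_fst hB)
    have h3 := integral_prod _ h2
    rw [← cellMeasure_eq_prod] at h3
    have h4 : ∀ a, ∫ y, (Prod.fst ⁻¹' B).indicator
        (fun x : ℝ × ℝ => thetaKernel l α s u 0 (x, n)) (a, y) ∂μ1 =
        B.indicator (fun a => ∫ y, thetaKernel l α s u 0 ((a, y), n) ∂μ1) a := fun a => by
      by_cases ha : a ∈ B
      · rw [Set.indicator_of_mem ha]
        exact integral_congr_ae (Eventually.of_forall fun y =>
          Set.indicator_of_mem (show (a, y) ∈ Prod.fst ⁻¹' B from ha) _)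
      · rw [Set.indicator_of_notMem ha]
        exact integral_eq_zero_of_ae (Eventually.of_forall fun y =>
          Set.indicator_of_notMem (show (a, y) ∉ Prod.fst ⁻¹' B from ha) _)
    simp only [h4] at h3
    rw [← h3, ← h1]
    refine integral_congr_ae ?_
    filter_upwards [ae_restrict_mem (measurableSet_unitCell l),
      (hint.indicator (hτm (hB.preimage (f := fun t => t - s.1 - n * cellSide l)
        (by fun_prop)))).prod_right_ae] with x hx hxi
    rw [integral_countable hxi]
    simp only [count_real_singleton, one_smul]
    have hmem : ∀ m : ℤ, (x, m) ∈ τ ⁻¹' ((fun t => t - s.1 - n * cellSide l) ⁻¹' B) ↔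
        x.1 + (m - n) * cellSide l ∈ B := fun m => by
      simp only [Set.mem_preimage, hτ]
      rw [show x.1 + s.1 + m * cellSide l - s.1 - n * cellSide l =
        x.1 + (m - n) * cellSide l by ring]
    -- For m ≠ n the point x₁ + (m - n)L lies outside the open interval, so only one term of the sum
    -- survives.
    rw [tsum_eq_single n]
    · have h5 := hmem n
      rw [sub_self, zero_mul, add_zero] at h5
      by_cases hxB : x.1 ∈ B
      · rw [Set.indicator_of_mem (h5.2 hxB), Set.indicator_of_mem (show x ∈ Prod.fst ⁻¹' B from hxB)]
      · rw [Set.indicator_of_notMem (fun h => hxB (h5.1 h)),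
          Set.indicator_of_notMem (show x ∉ Prod.fst ⁻¹' B from hxB)]
    · intro m hm
      refine Set.indicator_of_notMem (fun h => ?_) _
      have h6 := ((hmem m).1 h).2
      have h7 := hx.1
      rcases lt_or_gt_of_ne hm with h8 | h8
      · have h9 : (m : ℝ) + 1 ≤ n := by exact_mod_cast h8
        nlinarith [h6.1, h7.2]
      · have h9 : (n : ℝ) + 1 ≤ m := by exact_mod_cast h8
        nlinarith [h6.2, h7.1]
  rw [hμ1, Measure.restrict_restrict measurableSet_Ioo,
    Set.inter_eq_left.2 Set.Ioo_subset_Icc_self, restrict_Ioo_eq_restrict_Icc, ← hμ1] at hφ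
  filter_upwards [hφ] with a ha
  -- For fixed a, everything but the plane wave in y and u is a nonzero constant.
  obtain ⟨c, hc, hck⟩ : ∃ c : ℂ, c ≠ 0 ∧ ∀ y : ℝ, thetaKernel l α s u 0 ((a, y), n) = c *
      (exp (-I * ((α.2 + Real.pi * (a + s.1) / cellSide l ^ 2 +
        2 * Real.pi * n / cellSide l) * y : ℝ)) * u (a, y)) := by
    refine ⟨exp (-I * (α.1 * a + waveNumber l n (a + s.1) * s.2)) *
      (Real.exp (-((a + s.1 + n * cellSide l) ^ 2 / (2 * l ^ 2))) : ℝ),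
      mul_ne_zero (exp_ne_zero _) (by rw [ofReal_exp]; exact exp_ne_zero _), fun y => ?_⟩
    rw [thetaKernel, thetaTerm, pow_zero, one_mul, map_mul, map_mul, ← exp_conj, ← exp_conj,
      conj_ofReal]
    have h1 : exp (conj (I * (α.1 * a + α.2 * y))) *
        exp (conj (I * (waveNumber l n (a + s.1) * ((y + s.2 : ℝ) : ℂ)))) =
        exp (-I * (α.1 * a + waveNumber l n (a + s.1) * s.2)) *
        exp (-I * ((α.2 + Real.pi * (a + s.1) / cellSide l ^ 2 +
        2 * Real.pi * n / cellSide l) * y : ℝ)) := by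
      rw [← exp_add, ← exp_add]
      congr 1
      simp only [map_mul, map_add, conj_I, conj_ofReal, waveNumber]
      push_cast
      ring
    linear_combination ((Real.exp (-((a + s.1 + n * cellSide l) ^ 2 / (2 * l ^ 2))) : ℝ) : ℂ) *
      u (a, y) * h1
  simp only [hck] at ha
  rw [integral_const_mul] at ha
  exact (mul_eq_zero.1 ha).resolve_left hc

end Completeness

end Landau

namespace Landau

/-! ### Spectral decomposition of the fibre Hamiltonians. -/

section Spectrum

local notation "conj" => starRingEnd ℂ

variable {l : ℝ}

/-- The `n`-th excited magnetic-periodic state, an eigenfunction of `K₁² + K₂²`. -/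
noncomputable def excitedState (hl : 0 < l) (n : ℕ) : fibreSpace l :=
  (raising (fibreK1 hl 0) (fibreK2 hl 0) ^ n) (groundState hl)

/-- The `n`-th excited state at the quasi-momentum `k`. -/
noncomputable def fibreState (hl : 0 < l) (k : ℝ × ℝ) (n : ℕ) : fibreSpace l :=
  fibreShiftHom hl k (excitedState hl n)

theorem fibreState_eq_raising_pow (hl : 0 < l) (k : ℝ × ℝ) (n : ℕ) :
    fibreState hl k n = (raising (fibreK1 hl k) (fibreK2 hl k) ^ n) (fibreState hl k 0) := by
  induction n with
  | zero => rfl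
  | succ n ih =>
    rw [pow_succ', Module.End.mul_apply, ← ih, fibreState, excitedState, pow_succ',
      Module.End.mul_apply]
    simp only [raising, fibreState, LinearMap.sub_apply, LinearMap.smul_apply, map_sub, map_smul,
      fibreK1_fibreShiftHom, fibreK2_fibreShiftHom, excitedState]

theorem lowering_fibreState (hl : 0 < l) (k : ℝ × ℝ) :
    lowering (fibreK1 hl k) (fibreK2 hl k) (fibreState hl k 0) = 0 := by
  have h := congrArg (fibreShiftHom hl k) (lowering_groundState hl)
  rw [map_zero] at h
  rw [← h]
  simp only [lowering, fibreState, excitedState, pow_zero, Module.End.one_apply,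
    LinearMap.add_apply, LinearMap.smul_apply, map_add, map_smul, fibreK1_fibreShiftHom,
    fibreK2_fibreShiftHom]

theorem fibreK2_pow_fibreState (hl : 0 < l) (k : ℝ × ℝ) (p : ℕ) :
    (((fibreK2 hl k) ^ p) (fibreState hl k 0) : ℝ × ℝ → ℂ) = fibreShift l k (thetaSum l p) := by
  have h : ((fibreK2 hl k) ^ p) (fibreState hl k 0) =
      fibreShiftHom hl k (((fibreK2 hl 0) ^ p) (groundState hl)) := by
    induction p with
    | zero => rfl
    | succ p ih =>
      rw [pow_succ', Module.End.mul_apply, ih, fibreK2_fibreShiftHom, pow_succ',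
        Module.End.mul_apply]
  rw [h, ← fibreK2_pow_groundState hl p]
  rfl

/-- The powers of K₂(k) applied to the ground state lie in the span of the excited states, and they
are the shifted functions `thetaSum l p`. -/
theorem eq_zero_of_inner_fibreState (hl : 0 < l) (k : ℝ × ℝ) (u : L2Cell l)
    (hu : ∀ n, ⟪fibreToL2 l (fibreState hl k n), u⟫_ℂ = 0) : u = 0 := by
  have h : ∀ p, ⟪fibreToL2 l (((fibreK2 hl k) ^ p) (fibreState hl k 0)), u⟫_ℂ = 0 := by
    intro p
    have h1 := (isCanonicalPair_fibre hl k).pow_mem_span (lowering_fibreState hl k) p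
    simp only [← fibreState_eq_raising_pow] at h1
    generalize ((fibreK2 hl k) ^ p) (fibreState hl k 0) = f at h1 ⊢
    induction h1 using Submodule.span_induction with
    | mem f hf => obtain ⟨n, rfl⟩ := hf; exact hu n
    | zero => rw [map_zero, inner_zero_left]
    | add f g _ _ h1 h2 => rw [map_add, inner_add_left, h1, h2, add_zero]
    | smul a f _ h1 => rw [map_smul, inner_smul_left, h1, mul_zero]
  refine Lp.ext ((eq_zero_of_integral_thetaSum hl (-(k.1 / 2), -(k.2 / 2))
    (l ^ 2 * k.2, -(l ^ 2 * k.1)) (Lp.memLp u) fun p => ?_).trans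
    (Lp.coeFn_zero ℂ 2 (cellMeasure l)).symm)
  rw [← h p, L2.inner_def]
  refine integral_congr_ae ?_
  filter_upwards [coeFn_fibreToL2 (((fibreK2 hl k) ^ p) (fibreState hl k 0))] with x hx
  rw [hx, RCLike.inner_apply, mul_comm, fibreK2_pow_fibreState]
  rfl

/-- No value of the theta function is computed: if the ground state vanished, so would every excited
state, and completeness would make L² of a cell of positive area trivial. -/
theorem fibreToL2_fibreState_ne_zero (hl : 0 < l) (k : ℝ × ℝ) (n : ℕ) :
    fibreToL2 l (fibreState hl k n) ≠ 0 := by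
  have hc := isCanonicalPair_fibre hl k
  have h0 : fibreToL2 l (fibreState hl k 0) ≠ 0 := by
    intro h0
    have h1 : ∀ n, fibreToL2 l (fibreState hl k n) = 0 := by
      intro n
      induction n with
      | zero => exact h0
      | succ n ih =>
        rw [← inner_self_eq_zero (𝕜 := ℂ)]
        have h2 := fibreState_eq_raising_pow hl k (n + 1)
        rw [pow_succ', Module.End.mul_apply, ← fibreState_eq_raising_pow] at h2
        conv_lhs => rw [h2]
        rw [hc.inner_raising, ih, inner_zero_left]
    have h2 : ∀ u : L2Cell l, u = 0 := fun u =>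
      eq_zero_of_inner_fibreState hl k u fun n => by rw [h1, inner_zero_left]
    have h3 := h2 ((memLp_const (1 : ℂ)).toLp _)
    have h4 := (MemLp.coeFn_toLp (memLp_const (1 : ℂ) (p := 2) (μ := cellMeasure l))).symm.trans
      (h3 ▸ Lp.coeFn_zero ℂ 2 (cellMeasure l))
    have h5 : cellMeasure l = 0 := by
      rw [← ae_eq_bot]
      refine eventually_false_iff_eq_bot.1 ?_
      filter_upwards [h4] with x hx
      exact one_ne_zero hx
    have h6 : cellMeasure l Set.univ = 0 := by rw [h5]; rfl
    rw [Measure.restrict_apply_univ, unitCell, Measure.volume_eq_prod, Measure.prod_prod,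
      Real.volume_Icc, mul_self_eq_zero, ENNReal.ofReal_eq_zero, sub_zero] at h6
    exact absurd (cellSide_pos hl) (not_lt.2 h6)
  rw [fibreState_eq_raising_pow]
  exact hc.raising_pow_ne_zero (lowering_fibreState hl k) h0 n

theorem quadratic_fibreState (hl : 0 < l) (k : ℝ × ℝ) (n : ℕ) :
    quadratic (fibreK1 hl k) (fibreK2 hl k) (fibreState hl k n) =
      ((2 * n + 1 : ℝ) : ℂ) • fibreState hl k n := by
  rw [fibreState_eq_raising_pow]
  exact (isCanonicalPair_fibre hl k).quadratic_raising_pow (lowering_fibreState hl k) n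

/-- The excited states at `k` diagonalize the fibre Hamiltonian. -/
theorem exists_hilbertBasis_fibre (hl : 0 < l) (k : ℝ × ℝ) :
    ∃ b : HilbertBasis ℕ ℂ (L2Cell l),
      (∀ n, b n = ((‖fibreToL2 l (fibreState hl k n)‖⁻¹ : ℝ) : ℂ) •
        fibreToL2 l (fibreState hl k n)) ∧
      ∀ ε : ℝ, IsDiagonal (fibreHamiltonian l ε k) b
        fun n => ((ε * (n + 1 / 2) : ℝ) : ℂ) := by
  have hc := isCanonicalPair_fibre hl k
  obtain ⟨b, hb⟩ := exists_hilbertBasis_of_orthogonal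
    (w := fun n => fibreToL2 l (fibreState hl k n)) (fibreToL2_fibreState_ne_zero hl k)
    (fun m n hmn => inner_eq_zero_of_eigenvalue_ne hc.symm_quadratic (quadratic_fibreState hl k m)
      (quadratic_fibreState hl k n) fun h => hmn (by
        have : (m : ℝ) = n := by linarith
        exact_mod_cast this))
    (fun u hu => eq_zero_of_inner_fibreState hl k u hu)
  refine ⟨b, hb, fun ε => ?_⟩
  refine isDiagonal_closedRealization (c := fun f : fibreSpace l => (f : ℝ × ℝ → ℂ))
    coeFn_fibreToL2 Subtype.range_coe.symm
    (A := ((ε / 2 : ℝ) : ℂ) • quadratic (fibreK1 hl k) (fibreK2 hl k)) (fun f => rfl)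
    (fun u v => ?_) hb fun n => ?_
  · rw [LinearMap.smul_apply, LinearMap.smul_apply, map_smul, map_smul, inner_smul_left,
      inner_smul_right, hc.symm_quadratic, conj_ofReal]
  · rw [LinearMap.smul_apply, quadratic_fibreState, smul_smul]
    congr 1
    push_cast
    ring

theorem mem_range_fibreProjection_iff (hl : 0 < l) {ε : ℝ} (hε : 0 < ε) (j : ℕ) (k : ℝ × ℝ)
    (v : L2Cell l) : v ∈ (fibreProjection l ε j k).range ↔
      ∀ i, i ≠ j → ⟪fibreToL2 l (fibreState hl k i), v⟫_ℂ = 0 := by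
  obtain ⟨b, hb, hd⟩ := exists_hilbertBasis_fibre hl k
  have hsub : ∀ i : ℕ, ((ε * (i + 1 / 2) : ℝ) : ℂ) - landauLevel ε j = ((ε * (i - j) : ℝ) : ℂ) :=
    fun i => by
      rw [landauLevel, ← ofReal_sub]
      congr 1
      ring
  have hgap : ∀ i : ℕ, i ≠ j → ε ≤ ‖((ε * (i + 1 / 2) : ℝ) : ℂ) - landauLevel ε j‖ := fun i hi => by
    rw [hsub, Complex.norm_real, Real.norm_eq_abs, abs_mul, abs_of_pos hε]
    refine le_mul_of_one_le_right hε.le ?_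
    have h1 : (1 : ℤ) ≤ |(i : ℤ) - j| := Int.one_le_abs (sub_ne_zero.2 (by exact_mod_cast hi))
    exact_mod_cast h1
  have hball : ∀ i : ℕ, ((ε * (i + 1 / 2) : ℝ) : ℂ) ∈ Metric.ball (landauLevel ε j) (ε / 2) ↔
      i = j := fun i => by
    rw [Metric.mem_ball, dist_eq_norm]
    constructor
    · intro h
      by_contra hi
      linarith [hgap i hi]
    · rintro rfl
      rw [hsub, sub_self, mul_zero, ofReal_zero, norm_zero]
      positivity
  -- Neighbouring levels are ε apart, so the circle of radius ε/2 stays at distance ε/2 from all of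
  -- them.
  have hdist : ∀ z ∈ Metric.sphere (landauLevel ε j) (ε / 2), ∀ i : ℕ,
      ε / 2 ≤ ‖((ε * (i + 1 / 2) : ℝ) : ℂ) - z‖ := by
    intro z hz i
    rw [Metric.mem_sphere, dist_eq_norm] at hz
    by_cases hi : i = j
    · subst hi
      have h1 : ((ε * (i + 1 / 2) : ℝ) : ℂ) = landauLevel ε i := rfl
      rw [h1, ← neg_sub, norm_neg, hz]
    · have h1 := hgap i hi
      have h2 := norm_sub_le_norm_sub_add_norm_sub ((ε * (i + 1 / 2) : ℝ) : ℂ) z (landauLevel ε j)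
      linarith
  have hP : ∀ x i, ⟪b i, fibreProjection l ε j k x⟫_ℂ = if i = j then ⟪b i, x⟫_ℂ else 0 := by
    classical
    intro x i
    have h1 := (hd ε).inner_rieszProjection (half_pos hε) (half_pos hε) hdist x i
    simp only [hball] at h1
    exact h1
  have hbi : ∀ i v, ⟪b i, v⟫_ℂ = 0 ↔ ⟪fibreToL2 l (fibreState hl k i), v⟫_ℂ = 0 := by
    intro i v
    rw [hb, inner_smul_left, mul_eq_zero, or_iff_right]
    rw [conj_ofReal, ofReal_eq_zero, inv_eq_zero, norm_eq_zero]
    exact fibreToL2_fibreState_ne_zero hl k i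
  constructor
  · rintro ⟨x, rfl⟩ i hi
    rw [← hbi]
    exact (hP x i).trans (if_neg hi)
  · intro h
    refine ⟨v, ?_⟩
    refine b.ext_inner fun i => ?_
    refine (hP v i).trans ?_
    split_ifs with hi
    · rfl
    · exact ((hbi i v).2 (h i hi)).symm

theorem exists_eq_smul_of_mem_range (hl : 0 < l) {ε : ℝ} (hε : 0 < ε) (j : ℕ) (k : ℝ × ℝ)
    {v : L2Cell l} (hv : v ∈ (fibreProjection l ε j k).range) :
    ∃ a : ℂ, v = a • fibreToL2 l (fibreState hl k j) := by
  obtain ⟨b, hb, -⟩ := exists_hilbertBasis_fibre hl k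
  rw [mem_range_fibreProjection_iff hl hε] at hv
  suffices h : v = ⟪b j, v⟫_ℂ • b j from ⟨_, h.trans (by rw [hb, smul_smul])⟩
  refine b.ext_inner fun i => ?_
  rw [inner_smul_right]
  by_cases hi : i = j
  · rw [hi, inner_self_eq_norm_sq_to_K, b.orthonormal.1 j]
    simp
  · rw [b.orthonormal.2 hi, mul_zero]
    conv_lhs => rw [hb i]
    rw [inner_smul_left, hv i hi, mul_zero]

end Spectrum

end Landau

namespace Landau

/-! ### Local sections and local triviality of the Landau bundle. -/

section Bundle

variable {l : ℝ}

/-- A jointly continuous family of functions depends continuously on the parameter in `L²(Y)`. -/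
theorem continuous_of_ae_eq_cell {Q : Type*} [TopologicalSpace Q] {F : Q → ℝ × ℝ → ℂ}
    (hF : Continuous F.uncurry) {g : Q → L2Cell l}
    (hg : ∀ q, (g q : ℝ × ℝ → ℂ) =ᵐ[cellMeasure l] F q) : Continuous g := by
  refine continuous_iff_continuousAt.2 fun q => Metric.continuousAt_iff'.2 fun ε hε => ?_
  set M : ℝ := measureUnivNNReal (cellMeasure l) ^ ((2 : ℝ≥0∞).toReal)⁻¹ with hM
  have hM0 : 0 ≤ M := by positivity
  have hε' : 0 < ε / (M + 1) := by positivity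
  -- Compactness of the cell makes the continuity in the parameter uniform in y. The 1 in M + 1
  -- avoids a division by zero.
  obtain ⟨v, hv, hvF⟩ := (isCompact_unitCell l).mem_uniformity_of_prod (q := q) (s := Set.univ)
    hF.continuousOn (Set.mem_univ q) (Metric.dist_mem_uniformity hε')
  rw [nhdsWithin_univ] at hv
  filter_upwards [hv] with p hp
  rw [dist_eq_norm]
  have h1 : ‖g p - g q‖ ≤ M * (ε / (M + 1)) := by
    refine Lp.norm_le_of_ae_bound hε'.le ?_
    filter_upwards [Lp.coeFn_sub (g p) (g q), hg p, hg q,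
      ae_restrict_mem (measurableSet_unitCell l)] with x h2 h3 h4 h5
    rw [h2, Pi.sub_apply, h3, h4, ← dist_eq_norm]
    exact (hvF p hp x h5).le
  refine h1.trans_lt ?_
  rw [mul_div_assoc', div_lt_iff₀ (by positivity)]
  nlinarith

/-- The sides of the cell and of the Brillouin torus multiply to 2π, so the phase is trivial on the
magnetic lattice. -/
theorem phase_mem_fibreSpace (hl : 0 < l) {k r : ℝ × ℝ} (h : toTorus l k = toTorus l r)
    {f : ℝ × ℝ → ℂ} (hf : f ∈ fibreSpace l) : shiftPhase 1 (-(k - r)) 0 f ∈ fibreSpace l := by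
  have hside : cellSide l * dualSide l = 2 * Real.pi := by
    rw [cellSide, dualSide, mul_div_assoc', mul_right_comm, Real.mul_self_sqrt (by positivity),
      mul_div_cancel_right₀ _ hl.ne']
  have hint : ∀ a b : ℝ, (a : AddCircle (dualSide l)) = b → ∃ n : ℤ, a - b = n * dualSide l := by
    intro a b hab
    have h1 : ((a - b : ℝ) : AddCircle (dualSide l)) = 0 := by
      rw [AddCircle.coe_sub, hab, sub_self]
    obtain ⟨n, hn⟩ := (AddCircle.coe_eq_zero_iff _).1 h1
    exact ⟨n, by rw [← hn, zsmul_eq_mul]⟩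
  obtain ⟨n1, hn1⟩ := hint k.1 r.1 (Prod.ext_iff.1 h).1
  obtain ⟨n2, hn2⟩ := hint k.2 r.2 (Prod.ext_iff.1 h).2
  refine shiftPhase_mem_fibreSpace hl (fun m => ⟨-(n1 * m.1 + n2 * m.2), ?_⟩) hf
  simp only [Prod.fst_neg, Prod.snd_neg, Prod.fst_sub, Prod.snd_sub, hn1, hn2, Prod.fst_zero,
    Prod.snd_zero]
  push_cast
  linear_combination (-(n1 * m.1 + n2 * m.2 : ℝ)) * hside

/-- The multiplication by `e^{-i (k - r) · y}`, for two representatives of the same point. -/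
noncomputable def fibrePhase (hl : 0 < l) {k r : ℝ × ℝ} (h : toTorus l k = toTorus l r)
    (f : fibreSpace l) : fibreSpace l :=
  ⟨shiftPhase 1 (-(k - r)) 0 f, phase_mem_fibreSpace hl h f.2⟩

theorem K1_phase {k r : ℝ × ℝ} {f : ℝ × ℝ → ℂ} (hf : Differentiable ℝ f) :
    K1 l k (shiftPhase 1 (-(k - r)) 0 f) = shiftPhase 1 (-(k - r)) 0 (K1 l r f) :=
  K1_shiftPhase hf (by simp only [Prod.fst_neg, Prod.fst_sub, Prod.snd_zero]; ring)

theorem K2_phase {k r : ℝ × ℝ} {f : ℝ × ℝ → ℂ} (hf : Differentiable ℝ f) :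
    K2 l k (shiftPhase 1 (-(k - r)) 0 f) = shiftPhase 1 (-(k - r)) 0 (K2 l r f) :=
  K2_shiftPhase hf (by simp only [Prod.snd_neg, Prod.snd_sub, Prod.fst_zero]; ring)

theorem quadratic_fibrePhase (hl : 0 < l) {k r : ℝ × ℝ} (h : toTorus l k = toTorus l r)
    (n : ℕ) : quadratic (fibreK1 hl k) (fibreK2 hl k) (fibrePhase hl h (fibreState hl r n)) =
      ((2 * n + 1 : ℝ) : ℂ) • fibrePhase hl h (fibreState hl r n) := by
  have hq := congrArg (fun f : fibreSpace l => (f : ℝ × ℝ → ℂ)) (quadratic_fibreState hl r n)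
  generalize fibreState hl r n = f at hq ⊢
  have h0 := contDiff_fibreSpace f
  have hd := h0.differentiable (by simp)
  have hd1 := (contDiff_K1 l r h0).differentiable (by simp)
  have hd2 := (contDiff_K2 l r h0).differentiable (by simp)
  refine Subtype.ext (funext fun x => ?_)
  have hx : K1 l r (K1 l r f) (x + 0) + K2 l r (K2 l r f) (x + 0) =
      ((2 * n + 1 : ℝ) : ℂ) * (f : ℝ × ℝ → ℂ) (x + 0) := congrFun hq (x + 0)
  change K1 l k (K1 l k (shiftPhase 1 (-(k - r)) 0 f)) x +
    K2 l k (K2 l k (shiftPhase 1 (-(k - r)) 0 f)) x =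
    ((2 * n + 1 : ℝ) : ℂ) * shiftPhase 1 (-(k - r)) 0 f x
  rw [K1_phase hd, K2_phase hd, K1_phase hd1, K2_phase hd2]
  simp only [shiftPhase]
  linear_combination (1 * exp (I * (((-(k - r)).1 : ℝ) * x.1 + ((-(k - r)).2 : ℝ) * x.2))) * hx

/-- The gluing phase intertwines K(k) with K(r), so it sends the j-th state at r to an eigenvector
at k of the same level, orthogonal to all other levels. -/
theorem fibrePhase_mem_range (hl : 0 < l) {ε : ℝ} (hε : 0 < ε) (j : ℕ) {k r : ℝ × ℝ}
    (h : toTorus l k = toTorus l r) :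
    fibreToL2 l (fibrePhase hl h (fibreState hl r j)) ∈ (fibreProjection l ε j k).range := by
  rw [mem_range_fibreProjection_iff hl hε]
  intro i hi
  refine inner_eq_zero_of_eigenvalue_ne (isCanonicalPair_fibre hl k).symm_quadratic
    (quadratic_fibreState hl k i) (quadratic_fibrePhase hl h j) fun h => hi ?_
  have : (i : ℝ) = j := by linarith
  exact_mod_cast this

/-- The local section of the Landau bundle attached to a choice of representatives. -/
noncomputable def landauSection (hl : 0 < l) {ε : ℝ} (hε : 0 < ε) (j : ℕ)
    {rep : BrillouinTorus l → ℝ × ℝ} (hrep : ∀ κ, toTorus l (rep κ) = κ) (κ : BrillouinTorus l) :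
    landauBundle l ε j κ :=
  ⟨fun k => fibreToL2 l (fibrePhase hl (k.2.trans (hrep κ).symm) (fibreState hl (rep κ) j)), by
    refine ⟨fun k k' => ?_, fun k _ => fibrePhase_mem_range hl hε j _⟩
    filter_upwards [coeFn_fibreToL2 (fibrePhase hl (k.2.trans (hrep κ).symm)
      (fibreState hl (rep κ) j)), coeFn_fibreToL2 (fibrePhase hl (k'.2.trans (hrep κ).symm)
      (fibreState hl (rep κ) j))] with y h1 h2
    rw [h1, h2]
    simp only [fibrePhase, shiftPhase, one_mul]
    rw [← mul_assoc, ← exp_add]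
    congr 2
    simp only [Prod.fst_neg, Prod.snd_neg, Prod.fst_sub, Prod.snd_sub]
    push_cast
    ring⟩

/-- The parameters stand for k - r and r. Letting them vary independently, without the lattice
condition, makes the family jointly continuous on all of ℝ² × ℝ². -/
theorem continuous_section (hl : 0 < l) (j : ℕ) : Continuous
    (Function.uncurry fun (q : (ℝ × ℝ) × (ℝ × ℝ)) (y : ℝ × ℝ) =>
      shiftPhase 1 (-q.1) 0 (fibreState hl q.2 j : ℝ × ℝ → ℂ) y) := by
  have h1 : Continuous (excitedState hl j : ℝ × ℝ → ℂ) := (contDiff_fibreSpace _).continuous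
  change Continuous fun z : ((ℝ × ℝ) × (ℝ × ℝ)) × (ℝ × ℝ) => 1 *
    exp (I * (((-z.1.1).1 : ℝ) * z.2.1 + ((-z.1.1).2 : ℝ) * z.2.2)) *
    (1 * exp (I * ((-(z.1.2.1 / 2) : ℝ) * ((z.2 + 0).1 : ℝ) +
      (-(z.1.2.2 / 2) : ℝ) * ((z.2 + 0).2 : ℝ))) *
    (excitedState hl j : ℝ × ℝ → ℂ) (z.2 + 0 + (l ^ 2 * z.1.2.2, -(l ^ 2 * z.1.2.1))))
  fun_prop

theorem continuousOn_landauSection (hl : 0 < l) {ε : ℝ} (hε : 0 < ε) (j : ℕ)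
    {rep : BrillouinTorus l → ℝ × ℝ} (hrep : ∀ κ, toTorus l (rep κ) = κ) {S : Set (ℝ × ℝ)}
    (hS : ContinuousOn (fun k => rep (toTorus l k)) S) :
    ContinuousOn (fun k => (landauSection hl hε j hrep (toTorus l k)).1 ⟨k, rfl⟩) S := by
  obtain ⟨Φ, hΦ, hΦF⟩ : ∃ Φ : (ℝ × ℝ) × (ℝ × ℝ) → L2Cell l, Continuous Φ ∧
      ∀ q, (Φ q : ℝ × ℝ → ℂ) =ᵐ[cellMeasure l]
        shiftPhase 1 (-q.1) 0 (fibreState hl q.2 j : ℝ × ℝ → ℂ) := by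
    have hmem : ∀ q : (ℝ × ℝ) × (ℝ × ℝ), MemLp
        (shiftPhase 1 (-q.1) 0 (fibreState hl q.2 j : ℝ × ℝ → ℂ)) 2 (cellMeasure l) := fun q =>
      memLp_cellMeasure (contDiff_shiftPhase (contDiff_fibreSpace _)).continuous 2
    exact ⟨fun q => (hmem q).toLp _, continuous_of_ae_eq_cell (continuous_section hl j)
      fun q => (hmem q).coeFn_toLp, fun q => (hmem q).coeFn_toLp⟩
  refine (hΦ.comp_continuousOn ((continuousOn_id.sub hS).prodMk hS)).congr fun k _ => Lp.ext ?_
  exact (coeFn_fibreToL2 _).trans (hΦF (k - rep (toTorus l k), rep (toTorus l k))).symm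

/-- Cutting each circle away from κ₀ gives representatives that depend continuously on the point.
The j-th state at the representative is a nowhere zero section, and each fibre is a line. -/
theorem landauBundle_isVectorBundle (hl : 0 < l) {ε : ℝ} (hε : 0 < ε) (j : ℕ) :
    IsVectorBundleOfRank (landauBundle l ε j) 1 := by
  have hp : 0 < dualSide l := div_pos (Real.sqrt_pos.2 (by positivity)) hl
  have : Fact (0 < dualSide l) := ⟨hp⟩
  -- The cut is placed half a period away from the point.
  have hloc : ∀ x : AddCircle (dualSide l), ∃ a : ℝ, x ≠ (a : AddCircle (dualSide l)) := by
    intro x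
    obtain ⟨y, rfl⟩ := QuotientAddGroup.mk_surjective x
    refine ⟨y - dualSide l / 2, fun h => ?_⟩
    have h1 : ((y - (y - dualSide l / 2) : ℝ) : AddCircle (dualSide l)) = 0 := by
      rw [AddCircle.coe_sub, ← h]
      exact sub_self _
    obtain ⟨n, hn⟩ := (AddCircle.coe_eq_zero_iff _).1 h1
    rw [zsmul_eq_mul, sub_sub_cancel] at hn
    have h2 : (2 * n : ℝ) = 1 := by
      have : (2 * n - 1 : ℝ) * dualSide l = 0 := by linarith
      rcases mul_eq_zero.1 this with h3 | h3
      · linarith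
      · exact absurd h3 hp.ne'
    have h3 : 2 * n = 1 := by exact_mod_cast h2
    omega
  intro κ₀
  obtain ⟨a1, ha1⟩ := hloc κ₀.1
  obtain ⟨a2, ha2⟩ := hloc κ₀.2
  set rep : BrillouinTorus l → ℝ × ℝ := fun κ =>
    ((AddCircle.equivIco (dualSide l) a1 κ.1 : ℝ), (AddCircle.equivIco (dualSide l) a2 κ.2 : ℝ))
    with hrepdef
  have hrep : ∀ κ, toTorus l (rep κ) = κ := fun κ =>
    Prod.ext AddCircle.coe_equivIco AddCircle.coe_equivIco
  set U : Set (BrillouinTorus l) := {(a1 : AddCircle (dualSide l))}ᶜ ×ˢ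
    {(a2 : AddCircle (dualSide l))}ᶜ with hU
  refine ⟨U, isOpen_compl_singleton.prod isOpen_compl_singleton, ⟨ha1, ha2⟩,
    fun _ => landauSection hl hε j hrep, fun _ => ?_, fun κ _ => ?_⟩
  · have hcont : ContinuousOn rep U := fun κ hκ => by
      refine ContinuousAt.continuousWithinAt (ContinuousAt.prodMk ?_ ?_)
      · exact continuousAt_subtype_val.comp
          ((AddCircle.continuousAt_equivIco (dualSide l) a1 hκ.1).comp continuousAt_fst)
      · exact continuousAt_subtype_val.comp
          ((AddCircle.continuousAt_equivIco (dualSide l) a2 hκ.2).comp continuousAt_snd)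
    have hT : Continuous (toTorus l) :=
      ((AddCircle.continuous_mk' (dualSide l)).comp continuous_fst).prodMk
        ((AddCircle.continuous_mk' (dualSide l)).comp continuous_snd)
    have hr : ContinuousOn (fun k => rep (toTorus l k)) (toTorus l ⁻¹' U) :=
      hcont.comp hT.continuousOn fun k hk => hk
    exact continuousOn_landauSection hl hε j hrep hr
  · set s := landauSection hl hε j hrep κ with hs
    let k₀ : {k : ℝ × ℝ // toTorus l k = κ} := ⟨rep κ, hrep κ⟩
    have hs0 : s.1 k₀ = fibreToL2 l (fibreState hl (rep κ) j) := by
      have h1 : fibrePhase hl (k₀.2.trans (hrep κ).symm) (fibreState hl (rep κ) j) =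
          fibreState hl (rep κ) j := by
        refine Subtype.ext (funext fun x => ?_)
        simp [fibrePhase, shiftPhase, k₀]
      exact congrArg (fibreToL2 l) h1
    have hne : s ≠ 0 := fun h0 => by
      refine fibreToL2_fibreState_ne_zero hl (rep κ) j ?_
      rw [← hs0, h0]
      rfl
    refine ⟨LinearIndependent.of_subsingleton (0 : Fin 1) hne, ?_⟩
    rw [eq_top_iff]
    rintro v -
    obtain ⟨a, ha⟩ := exists_eq_smul_of_mem_range hl hε j (rep κ)
      (v.2.2 k₀ (Set.mem_univ _))
    suffices h : v = a • s from h ▸ Submodule.smul_mem _ _ (Submodule.subset_span ⟨0, rfl⟩)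
    -- An element of the fibre is determined by its value at one representative, so proportionality
    -- at `k₀` spreads to all k.
    refine Subtype.ext (funext fun k => Lp.ext ?_)
    have h1 := v.2.1 k₀ k
    have h2 := s.2.1 k₀ k
    have h3 : (v.1 k₀ : ℝ × ℝ → ℂ) =ᵐ[cellMeasure l] fun y => a * s.1 k₀ y := by
      rw [show v.1 k₀ = a • s.1 k₀ from ha.trans (by rw [hs0])]
      exact Lp.coeFn_smul a (s.1 k₀)
    have h4 : ((a • s).1 k : ℝ × ℝ → ℂ) =ᵐ[cellMeasure l] fun y => a * s.1 k y :=
      Lp.coeFn_smul a (s.1 k)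
    filter_upwards [h1, h2, h3, h4] with y e1 e2 e3 e4
    rw [e1, e4, e2, e3]
    ring

end Bundle

end Landau

theorem mainTheorem10 (l ε : ℝ) (hl : 0 < l) (hε : 0 < ε) (j : ℕ) (ξ : ℝ) (hξ : 0 ≤ ξ) :
    Landau.IsResolvent (Landau.oscillator l) (-(2 * ξ : ℝ)) (Landau.oscillatorInv l ξ) ∧
    Landau.IsDixmierMeasurable (Landau.oscillatorInv l ξ ∘L Landau.landauProjection l ε j) ∧
    ∃ r : ℕ, Landau.IsVectorBundleOfRank (Landau.landauBundle l ε j) r ∧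
      (∀ lam : ℝ, Real.exp 1 < lam → ∀ ω : Landau.StateAtInfinity lam,
        (r : ℂ) = Landau.dixmierTrace ω
          (Landau.oscillatorInv l ξ ∘L Landau.landauProjection l ε j)) ∧
      r = 1 := by
  obtain ⟨h1, h2, h3⟩ := Landau.oscillatorInv_landauProjection hl hε j hξ
  exact ⟨h1, h2, 1, Landau.landauBundle_isVectorBundle hl hε j,
    fun lam hlam ω => by rw [h3 lam hlam ω, Nat.cast_one], rfl⟩
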